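/- **Conventions.** Graphs are simple; $d$ is the graph distance and $I(x,y)=\{z : d(x,y)=d(x,z)+d(z,y)\}$. A *clique* is a maximal complete subgraph. A subgraph is *convex* if it contains every geodesic (vertices and edges) between any two of its vertices. *Rotation systems.* Let $G$ be a group acting by automorphisms on a connected graph $X$, and let $\mathcal R$ be a collection of subgroups of $G$. The pair $(G\curvearrowright X,\mathcal R)$ is a *rotation system* if: (i) $\mathcal R$ is stable under conjugation and generates $G$; (ii) for every clique $C$ there is a unique $R\in\mathcal R$ that stabilises $C$ and acts freely and transitively on its vertices, called the *rotative-stabiliser* of $C$; (iii) every $R\in\mathcal R$ is the rotative-stabiliser of some clique; (iv) for every clique $C$, removing from $X$ the edges of all the cliques with the same rotative-stabiliser as $C$ separates any two distinct vertices of $C$. For a vertex $o$, $\mathcal R_o$ denotes the set of the rotative-stabilisers of the cliques containing $o$. *Periagroups.* Let $\Gamma$ be a graph, $\lambda:E(\Gamma)\to\mathbb N_{\ge2}$ a labelling and $\mathcal G=\{G_u\}_{u\in V(\Gamma)}$ a collection of groups such that, for every edge $\{u,v\}$ with $\lambda(\{u,v\})>2$, both $G_u$ and $G_v$ have order two. Let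 $\langle a,b\rangle^k$ be the alternating product $abab\cdots$ with $k$ factors. The periagroup $\Pi(\Gamma,\lambda,\mathcal G)$ is the quotient of the free product of the groups $G_u$ by the relations $\langle a,b\rangle^{\lambda(\{u,v\})}=\langle b,a\rangle^{\lambda(\{u,v\})}$ for all edges $\{u,v\}$ and all non-trivial $a\in G_u$, $b\in G_v$. Given a group $G$ and a collection $\mathcal B$ of non-trivial subgroups, let $\Gamma$ be the graph with vertex-set $\mathcal B$ in which two distinct $A,B\in\mathcal B$ are adjacent if and only if $\langle A,B\rangle\ne A*B$ (i.e. the canonical morphism $A*B\to G$ is not injective). Then $G$ is a *periagroup with basis $\mathcal B$* if there is a labelling $\lambda:E(\Gamma)\to\mathbb N_{\geq 2}$ such that $A$ and $B$ have order two for every edge $\{A,B\}$ with $\lambda(\{A,B\})>2$, and such that the inclusions of the subgroups in $\mathcal B$ extend to an isomorphism $\Pi(\Gamma,\lambda,\mathcal B)\to G$. The graph $\mathrm{Cayl}(G,\mathcal B)$ has vertex-set $G$, two distinct elements $g,h$ being adjacent if and only if $g^{-1}h$ belongs to some $B\in\mathcal B$; $G$ acts on it by left multiplication. *Mediangle graphs.*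 A connected graph $X$ is *mediangle* if: (1) for all vertices $o,x,y$ with $d(o,x)=d(o,y)$ and $d(x,y)=1$, there is a common neighbour $z$ of $x,y$ with $z\in I(o,x)\cap I(o,y)$; (2) $X$ contains no induced copy of $K_4^-$ (the complete graph $K_4$ minus an edge); (3) for all vertices $o,x,y,z$ with $x\neq y$, $d(o,x)=d(o,y)=d(o,z)-1$ and $d(x,z)=d(y,z)=1$, there is a convex cycle of even length containing the edges $[z,x]$ and $[z,y]$ in which the vertex opposite to $z$ belongs to $I(o,x)\cap I(o,y)$; (4) any two distinct convex cycles of even lengths have at most one edge in common. **Theorem.** Let $G$ be a group. (a) Let $(G\curvearrowright X,\mathcal R)$ be a rotation system, where $X$ has at least two vertices, and let $o$ be a vertex of $X$. Then $G$ is a periagroup with basis $\mathcal R_o$, $X$ is a mediangle graph, and the orbit map $g\mapsto g\cdot o$ is a graph isomorphism $\mathrm{Cayl}(G,\mathcal R_o)\to X$. (b) Conversely, if $G$ is non-trivial and is a periagroup with basis $\mathcal B$, then $Y:=\mathrm{Cayl}(G,\mathcal B)$ is a mediangle graph and $(G\curvearrowright Y,\{gBg^{-1} : g\in G,\ B\in\mathcal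 B\})$ is a rotation system. -/

import Mathlib

/-! ## Intervals, convexity, mediangle graphs -/

/-- The interval `I(x, y)` of a graph. -/
def GInterval {V : Type*} (X : SimpleGraph V) (x y : V) : Set V :=
  {z | X.dist x y = X.dist x z + X.dist z y}

/-- A subgraph is convex if every geodesic of `X` between two of its vertices lies in it
(vertices and edges; in particular a convex subgraph is induced). -/
def IsConvexSubgraph {V : Type*} (X : SimpleGraph V) (H : X.Subgraph) : Prop :=
  ∀ x ∈ H.verts, ∀ y ∈ H.verts, ∀ p : X.Walk x y, p.length = X.dist x y → p.toSubgraph ≤ H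

/-- A convex cycle of even length, presented as a closed walk based at one of its vertices. -/
def IsConvexEvenCycle {V : Type*} (X : SimpleGraph V) {z : V} (c : X.Walk z z) : Prop :=
  c.IsCycle ∧ Even c.length ∧ IsConvexSubgraph X c.toSubgraph

/-- Mediangle graphs. In the cycle condition, the cycle is based at `z`, so that the vertex
opposite to `z` is the vertex visited after half the length of the cycle. -/
structure IsMediangle {V : Type*} (X : SimpleGraph V) : Prop where
  connected : X.Connected
  triangle_condition : ∀ o x y : V, X.dist o x = X.dist o y → X.Adj x y →
    ∃ z, X.Adj x z ∧ X.Adj y z ∧ z ∈ GInterval X o x ∩ GInterval X o y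
  /-- No induced copy of the complete graph `K₄` minus an edge. -/
  no_K4_minus : ∀ a b c d : V, X.Adj a b → X.Adj a c → X.Adj b c → X.Adj a d → X.Adj b d →
    c ≠ d → X.Adj c d
  cycle_condition : ∀ o x y z : V, x ≠ y → X.dist o z = X.dist o x + 1 →
    X.dist o z = X.dist o y + 1 → X.Adj x z → X.Adj y z →
    ∃ c : X.Walk z z, IsConvexEvenCycle X c ∧ s(z, x) ∈ c.edges ∧ s(z, y) ∈ c.edges ∧
      c.getVert (c.length / 2) ∈ GInterval X o x ∩ GInterval X o y
  /-- Two distinct convex even cycles share at most one edge. -/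
  even_cycles : ∀ (u v : V) (c : X.Walk u u) (d : X.Walk v v),
    IsConvexEvenCycle X c → IsConvexEvenCycle X d → c.toSubgraph ≠ d.toSubgraph →
    (c.toSubgraph.edgeSet ∩ d.toSubgraph.edgeSet).Subsingleton

/-! ## Rotation systems -/

/-- A clique is a maximal complete subgraph, given by its set of vertices. -/
def IsMaxClique {V : Type*} (X : SimpleGraph V) (C : Set V) : Prop :=
  Maximal (fun s : Set V => X.IsClique s) C

/-- The subgroup `H` stabilises `C` and acts freely and transitively on it. -/
def ActsFreelyTransitivelyOn {G V : Type*} [Group G] [MulAction G V]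
    (H : Subgroup G) (C : Set V) : Prop :=
  (∀ h ∈ H, ∀ x ∈ C, h • x ∈ C) ∧ ∀ x ∈ C, ∀ y ∈ C, ∃! h, h ∈ H ∧ h • x = y

/-- The edges of all the cliques on which `H` acts freely and transitively. -/
def barrier {G V : Type*} [Group G] [MulAction G V] (X : SimpleGraph V) (H : Subgroup G) :
    Set (Sym2 V) :=
  {e | ∃ C, IsMaxClique X C ∧ ActsFreelyTransitivelyOn H C ∧
    ∃ x ∈ C, ∃ y ∈ C, x ≠ y ∧ e = s(x, y)}

/-- `(G ↷ X, R)` is a rotation system; `G` acts on the connected graph `X` by automorphisms. -/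
structure IsRotationSystem {G V : Type*} [Group G] [MulAction G V]
    (X : SimpleGraph V) (R : Set (Subgroup G)) : Prop where
  connected : X.Connected
  adj_smul : ∀ (g : G) (x y : V), X.Adj x y → X.Adj (g • x) (g • y)
  conj_mem : ∀ H ∈ R, ∀ g : G, H.map (MulAut.conj g).toMonoidHom ∈ R
  generates : sSup R = ⊤
  existsUnique_rotStab : ∀ C, IsMaxClique X C → ∃! H, H ∈ R ∧ ActsFreelyTransitivelyOn H C
  isRotStab : ∀ H ∈ R, ∃ C, IsMaxClique X C ∧ ActsFreelyTransitivelyOn H C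
  separates : ∀ C, IsMaxClique X C → ∀ H ∈ R, ActsFreelyTransitivelyOn H C →
    ∀ x ∈ C, ∀ y ∈ C, x ≠ y → ¬ (X.deleteEdges (barrier X H)).Reachable x y

/-- The set `R_o` of the rotative-stabilisers of the cliques containing `o`. -/
def rotStabsAt {G V : Type*} [Group G] [MulAction G V]
    (X : SimpleGraph V) (R : Set (Subgroup G)) (o : V) : Set (Subgroup G) :=
  {H | H ∈ R ∧ ∃ C, IsMaxClique X C ∧ o ∈ C ∧ ActsFreelyTransitivelyOn H C}

/-! ## Periagroups -/

/-- The alternating product `a b a b ⋯` with `k` factors. -/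
def altProd {M : Type*} [Monoid M] : M → M → ℕ → M
  | _, _, 0 => 1
  | a, b, k + 1 => a * altProd b a k

/-- The relators `⟨a, b⟩^k (⟨b, a⟩^k)⁻¹`, in the free product of the vertex-groups, where `a`, `b`
are non-trivial elements of adjacent vertex-groups and `k` is the label of the edge. -/
def periaRelators {I : Type*} (Γ : SimpleGraph I) (lam : Γ.edgeSet → ℕ)
    (A : I → Type*) [∀ i, Group (A i)] : Set (Monoid.CoprodI A) :=
  {r | ∃ (u v : I) (h : Γ.Adj u v) (a : A u) (b : A v), a ≠ 1 ∧ b ≠ 1 ∧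
    r = altProd (Monoid.CoprodI.of a) (Monoid.CoprodI.of b) (lam ⟨s(u, v), h⟩) *
      (altProd (Monoid.CoprodI.of b) (Monoid.CoprodI.of a) (lam ⟨s(u, v), h⟩))⁻¹}

/-- The group `Π(Γ, λ, 𝒢)` given by the periagroup presentation. -/
abbrev Periagroup {I : Type*} (Γ : SimpleGraph I) (lam : Γ.edgeSet → ℕ)
    (A : I → Type*) [∀ i, Group (A i)] : Type _ :=
  Monoid.CoprodI A ⧸ Subgroup.normalClosure (periaRelators Γ lam A)

/-- Labels are at least two, and labels larger than two occur only between groups of order two. -/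
def IsPeriaLabelling {I : Type*} (Γ : SimpleGraph I) (lam : Γ.edgeSet → ℕ)
    (A : I → Type*) : Prop :=
  (∀ e, 2 ≤ lam e) ∧
    ∀ (u v : I) (h : Γ.Adj u v), 2 < lam ⟨s(u, v), h⟩ → Nat.card (A u) = 2 ∧ Nat.card (A v) = 2

/-- The graph with vertex set `B` in which distinct `H`, `K` are adjacent when `⟨H, K⟩` is not the
free product of `H` and `K`, i.e. the canonical morphism `H * K → G` is not injective. -/
def basisGraph {G : Type*} [Group G] (B : Set (Subgroup G)) : SimpleGraph B :=
  SimpleGraph.fromRel fun H K : B =>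
    ¬ Function.Injective (Monoid.Coprod.lift H.1.subtype K.1.subtype)

/-- `G` is a periagroup with `B` as a basis. -/
def IsPeriagroupBasis {G : Type*} [Group G] (B : Set (Subgroup G)) : Prop :=
  (∀ H ∈ B, H ≠ ⊥) ∧
    ∃ lam : (basisGraph B).edgeSet → ℕ,
      IsPeriaLabelling (basisGraph B) lam (fun H : B => H.1) ∧
      ∃ φ : Periagroup (basisGraph B) lam (fun H : B => H.1) ≃* G,
        ∀ (H : B) (h : H.1), φ (QuotientGroup.mk (Monoid.CoprodI.of (i := H) h)) = h

/-- The Cayley graph of `G` with respect to the union of the subgroups in `B`: distinct `g`, `h`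
are adjacent if `g⁻¹ h` lies in some subgroup of `B`. -/
def cayleyGraph {G : Type*} [Group G] (B : Set (Subgroup G)) : SimpleGraph G :=
  SimpleGraph.mulCayley {g : G | ∃ H ∈ B, g ∈ H}

/-- The set of the conjugates of the subgroups in `B`. -/
def conjugateSubgroups {G : Type*} [Group G] (B : Set (Subgroup G)) : Set (Subgroup G) :=
  {K | ∃ g : G, ∃ H ∈ B, K = H.map (MulAut.conj g).toMonoidHom}

/-!
The proof passes through an intermediate notion, a *retraction system* on a set `B` of subgroups of
`G` (`IsRetractionSystem`): for each `H ∈ B` an `H`-equivariant map `f H : G → H` which is constant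
along an edge of the Cayley graph, from `x` to `x l` with `l ∈ L ∈ B`, unless `x L x⁻¹ = H`. The
fibres of `f H` are the sectors cut out by the cosets whose stabiliser is `H`. Both halves of the
theorem follow once rotation systems and periagroups are each shown to give a retraction system,
and a retraction system is shown to give everything else.

*From a rotation system.* Deleting the barrier of `H ∈ R_o` leaves components which `H` permutes
simply transitively, and `f H g` is the label of the component of `g • o`
(`IsRotationSystem.exists_isRetractionSystem`). Two cliques with a common edge coincide
(`IsRotationSystem.eq_of_mem_of_mem`), which gives the invariance of `f H` along edges. By the
exchange lemma, a non-trivial element has a non-trivial label for some `H`; hence the action is free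
on vertices and the orbit map is an isomorphism (`IsRotationSystem.exists_iso`).

*From a periagroup.* As for the reflection representation of a Coxeter group, the group acts on
pairs `(K, k)`, where `K` stands for a wall and `k` for one of its sectors: `h ∈ H` multiplies the
labels of the wall `H` and conjugates all other pairs (`sectorMap`). The defining relations hold for
this action, and the labels can be read off from it (`IsPeriagroupBasis.exists_isRetractionSystem`).

*From a retraction system to a periagroup.* The exchange lemma (`IsRetractionSystem.exchange`)
holds: a word whose path crosses the wall of `H` is shortened by a suitable rotation in `H`. For two
subgroups `H`, `L` in `B` which do not generate their free product, it yields an integer `m` such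
that alternating words of length at most `m` are geodesic and the braid relation of length `m`
holds, with `m = 2` unless both groups have order two (`IsRankTwo`,
`IsRetractionSystem.exists_isRankTwo`). Matsumoto's argument then shows that any two reduced words
for the same element are related by braid relations (`IsRetractionSystem.injective_of_braid`), which
is the periagroup presentation (`IsRetractionSystem.isPeriagroupBasis`).

*From a retraction system to graphs.* The cliques of the Cayley graph are the cosets `x H` with
`H ∈ B`, with stabiliser `x H x⁻¹`, and a path which avoids a barrier keeps its label; so the
conjugates of `B` form a rotation system (`IsRetractionSystem.isRotationSystem`). The length of `g`
drops under left multiplication by a non-trivial `h⁻¹`, with `h ∈ H`, exactly if `f H g = h`. With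
the two sides of the braid relations as convex even cycles, this gives the mediangle axioms; every
convex even cycle of the Cayley graph is of this form (`IsRetractionSystem.isMediangle`).
-/

/-! ### Conjugates of subgroups and words -/

section Words

variable {G : Type*} [Group G]

/-- The conjugate `x H x⁻¹` of a subgroup. -/
abbrev conjSubgroup (x : G) (H : Subgroup G) : Subgroup G :=
  H.map (MulAut.conj x).toMonoidHom

theorem mem_conjSubgroup {x y : G} {H : Subgroup G} :
    y ∈ conjSubgroup x H ↔ x⁻¹ * y * x ∈ H := by
  constructor
  · rintro ⟨h, hh, rfl⟩
    simpa [mul_assoc] using hh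
  · intro h
    exact ⟨_, h, by simp [mul_assoc]⟩

theorem conjSubgroup_one (H : Subgroup G) : conjSubgroup 1 H = H := by
  ext y; simp

theorem conjSubgroup_mul (x y : G) (H : Subgroup G) :
    conjSubgroup (x * y) H = conjSubgroup x (conjSubgroup y H) := by
  ext z; simp [mul_assoc]

theorem conjSubgroup_of_mem {h : G} {H : Subgroup G} (hh : h ∈ H) : conjSubgroup h H = H := by
  ext z
  rw [mem_conjSubgroup, H.mul_mem_cancel_right hh, H.mul_mem_cancel_left (H.inv_mem hh)]

theorem conjSubgroup_injective (x : G) : Function.Injective (conjSubgroup x) := by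
  intro H K h
  have := congrArg (conjSubgroup x⁻¹) h
  simpa [← conjSubgroup_mul, conjSubgroup_one] using this

/-- `IsWord B n g` means that `g` is a product of `n` (possibly trivial) elements of the subgroups
in `B`. -/
inductive IsWord (B : Set (Subgroup G)) : ℕ → G → Prop
  | one : IsWord B 0 1
  | snoc {n : ℕ} {x s : G} {L : Subgroup G} :
      IsWord B n x → L ∈ B → s ∈ L → IsWord B (n + 1) (x * s)

variable {B : Set (Subgroup G)}

theorem IsWord.cons {n : ℕ} {x s : G} {L : Subgroup G} (h : IsWord B n x) (hL : L ∈ B)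
    (hs : s ∈ L) : IsWord B (n + 1) (s * x) := by
  induction h with
  | one => simpa using IsWord.snoc IsWord.one hL hs
  | snoc _ hL' hs' ih => rw [← mul_assoc]; exact ih.snoc hL' hs'

theorem isWord_zero_iff {g : G} : IsWord B 0 g ↔ g = 1 := by
  constructor
  · intro h; cases h; rfl
  · rintro rfl; exact IsWord.one

theorem IsWord.exists_snoc {n : ℕ} {g : G} (h : IsWord B (n + 1) g) :
    ∃ x, IsWord B n x ∧ ∃ L ∈ B, ∃ s ∈ L, g = x * s := by
  cases h with
  | snoc hx hL hs => exact ⟨_, hx, _, hL, _, hs, rfl⟩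

theorem IsWord.exists_cons {n : ℕ} {g : G} (h : IsWord B (n + 1) g) :
    ∃ x, IsWord B n x ∧ ∃ L ∈ B, ∃ s ∈ L, g = s * x := by
  induction n generalizing g with
  | zero =>
    obtain ⟨x, hx, L, hL, s, hs, rfl⟩ := h.exists_snoc
    rw [isWord_zero_iff] at hx
    exact ⟨1, IsWord.one, L, hL, s, hs, by simp [hx]⟩
  | succ n ih =>
    obtain ⟨x, hx, L, hL, s, hs, rfl⟩ := h.exists_snoc
    obtain ⟨y, hy, M, hM, t, ht, rfl⟩ := ih hx
    exact ⟨y * s, hy.snoc hL hs, M, hM, t, ht, mul_assoc _ _ _⟩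

theorem IsWord.mem_sSup {n : ℕ} {g : G} (h : IsWord B n g) : g ∈ sSup B := by
  induction h with
  | one => exact one_mem _
  | snoc _ hL hs ih => exact mul_mem ih (le_sSup hL hs)

theorem IsWord.mul {n m : ℕ} {x y : G} (hx : IsWord B n x) (hy : IsWord B m y) :
    IsWord B (n + m) (x * y) := by
  induction hy with
  | one => simpa using hx
  | snoc _ hL hs ih => rw [← mul_assoc]; exact ih.snoc hL hs

theorem exists_isWord_of_mem_sSup {g : G} (h : g ∈ sSup B) : ∃ n, IsWord B n g := by
  rw [sSup_eq_iSup'] at h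
  refine Subgroup.iSup_induction (C := fun g => ∃ n, IsWord B n g) _ h ?_ ?_ ?_
  · intro L x hx
    exact ⟨1, by simpa using IsWord.one.snoc L.2 hx⟩
  · exact ⟨0, IsWord.one⟩
  · rintro x y ⟨n, hn⟩ ⟨m, hm⟩
    exact ⟨n + m, hn.mul hm⟩

/-- The word length of `g` with respect to the subgroups in `B` (it is `0` if `g` is not in the
subgroup generated by `B`). -/
noncomputable def wordLength (B : Set (Subgroup G)) (g : G) : ℕ := sInf {n | IsWord B n g}

theorem wordLength_le {n : ℕ} {g : G} (h : IsWord B n g) : wordLength B g ≤ n :=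
  Nat.sInf_le h

theorem isWord_wordLength {g : G} (h : g ∈ sSup B) : IsWord B (wordLength B g) g :=
  Nat.sInf_mem (exists_isWord_of_mem_sSup h)

theorem wordLength_letter_mul_le {H : Subgroup G} (hH : H ∈ B) {h g : G} (hh : h ∈ H)
    (hg : g ∈ sSup B) : wordLength B (h * g) ≤ wordLength B g + 1 :=
  wordLength_le ((isWord_wordLength hg).cons hH hh)

theorem eq_one_of_wordLength_eq_zero {g : G} (hg : g ∈ sSup B) (h : wordLength B g = 0) :
    g = 1 := by
  have := isWord_wordLength hg
  rwa [h, isWord_zero_iff] at this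

end Words

/-! ### Retraction systems and the exchange lemma -/

section Retractions

variable {G : Type*} [Group G] {B : Set (Subgroup G)} {f : Subgroup G → G → G}

/-- A retraction system on a set `B` of subgroups of `G`: for each `H ∈ B`, an `H`-equivariant map
`f H : G → H` which only changes along an edge from `x` to `x l`, with `l ∈ L ∈ B`, if
`x L x⁻¹ = H`. The fibres of `f H` are the sectors delimited by the edges of the cliques which
are stabilised by `H`. The value `f H x` is junk for `H ∉ B`. -/
structure IsRetractionSystem (B : Set (Subgroup G)) (f : Subgroup G → G → G) : Prop where
  mem : ∀ H ∈ B, ∀ x, f H x ∈ H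
  map_one : ∀ H ∈ B, f H 1 = 1
  map_mul_left : ∀ H ∈ B, ∀ h ∈ H, ∀ x, f H (h * x) = h * f H x
  map_mul_right : ∀ H ∈ B, ∀ L ∈ B, ∀ x, ∀ l ∈ L, conjSubgroup x L ≠ H → f H (x * l) = f H x

namespace IsRetractionSystem

theorem mono {B' : Set (Subgroup G)} (hf : IsRetractionSystem B f) (h : B' ⊆ B) :
    IsRetractionSystem B' f where
  mem H hH := hf.mem H (h hH)
  map_one H hH := hf.map_one H (h hH)
  map_mul_left H hH := hf.map_mul_left H (h hH)
  map_mul_right H hH L hL := hf.map_mul_right H (h hH) L (h hL)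

theorem apply_of_mem (hf : IsRetractionSystem B f) {H : Subgroup G} (hH : H ∈ B) {h : G}
    (hh : h ∈ H) : f H h = h := by
  simpa [hf.map_one H hH] using hf.map_mul_left H hH h hh 1

theorem apply_of_mem_of_ne (hf : IsRetractionSystem B f) {H L : Subgroup G} (hH : H ∈ B)
    (hL : L ∈ B) (hne : L ≠ H) {l : G} (hl : l ∈ L) : f H l = 1 := by
  have := hf.map_mul_right H hH L hL 1 l hl (by rwa [conjSubgroup_one])
  rwa [one_mul, hf.map_one H hH] at this

theorem eq_one_of_mem_of_mem (hf : IsRetractionSystem B f) {H L : Subgroup G} (hH : H ∈ B)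
    (hL : L ∈ B) (hne : L ≠ H) {l : G} (hl : l ∈ L) (hl' : l ∈ H) : l = 1 :=
  (hf.apply_of_mem hH hl').symm.trans (hf.apply_of_mem_of_ne hH hL hne hl)

theorem apply_inv_mul (hf : IsRetractionSystem B f) {H : Subgroup G} (hH : H ∈ B) (g : G) :
    f H ((f H g)⁻¹ * g) = 1 := by
  rw [hf.map_mul_left H hH _ (inv_mem (hf.mem H hH g)), inv_mul_cancel]

/-- If a path crosses the wall `H` from `x` to `x l`, then `x l` is a rotation of `x` by an element
of `H`. -/
theorem exists_mul_left (hf : IsRetractionSystem B f) {H L : Subgroup G} (hH : H ∈ B)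
    (hL : L ∈ B) {x l : G} (hl : l ∈ L) (h : f H (x * l) ≠ f H x) :
    conjSubgroup x L = H ∧ ∃ k ∈ H, x * l = k * x ∧ f H (x * l) = k * f H x := by
  have hc : conjSubgroup x L = H := by
    by_contra hc
    exact h (hf.map_mul_right H hH L hL x l hl hc)
  have hk : x * l * x⁻¹ ∈ H := by
    rw [← hc, mem_conjSubgroup]; simpa [mul_assoc] using hl
  refine ⟨hc, _, hk, by group, ?_⟩
  rw [← hf.map_mul_left H hH _ hk]
  congr 1; group

/-- The exchange lemma, for the wall `p⁻¹ L p`: a word whose path crosses it gets shorter when the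
part after the crossing is rotated back. -/
theorem exchange (hf : IsRetractionSystem B f) {L : Subgroup G} (hL : L ∈ B) (p : G) {n : ℕ}
    {u : G} (hu : IsWord B n u) (h : f L (p * u) ≠ f L p) :
    ∃ n', n = n' + 1 ∧ IsWord B n' (p⁻¹ * (f L (p * u) * (f L p)⁻¹)⁻¹ * p * u) := by
  induction hu with
  | one => simp at h
  | @snoc n x s M hx hM hs ih =>
    refine ⟨n, rfl, ?_⟩
    rw [← mul_assoc p x s] at h ⊢
    by_cases hc : f L (p * x * s) = f L (p * x)
    · rw [hc] at h ⊢
      obtain ⟨n', rfl, hw⟩ := ih h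
      have := hw.snoc hM hs
      simpa [mul_assoc] using this
    · obtain ⟨-, k, hk, hkx, hfk⟩ := hf.exists_mul_left hL hM hs hc
      have hs' : s = (p * x)⁻¹ * k * (p * x) := by
        rw [mul_assoc, ← hkx]; group
      have e : p⁻¹ * (f L (p * x * s) * (f L p)⁻¹)⁻¹ * p * (x * s) =
          p⁻¹ * (f L (p * x) * (f L p)⁻¹)⁻¹ * p * x := by
        rw [hfk, hs']; group
      rw [e]
      by_cases hx1 : f L (p * x) = f L p
      · rw [hx1]; simpa using hx
      · obtain ⟨n', rfl, hw⟩ := ih hx1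
        simpa using hw.snoc hL (one_mem L)

theorem isWord_of_apply_ne_one (hf : IsRetractionSystem B f) {H : Subgroup G} (hH : H ∈ B) {n : ℕ}
    {g : G} (hg : IsWord B n g) (h : f H g ≠ 1) :
    ∃ n', n = n' + 1 ∧ IsWord B n' ((f H g)⁻¹ * g) := by
  have := hf.exchange hH 1 hg (by rwa [one_mul, hf.map_one H hH])
  simpa [hf.map_one H hH] using this

theorem wordLength_inv_mul (hf : IsRetractionSystem B f) {H : Subgroup G} (hH : H ∈ B)
    {g : G} (hg : g ∈ sSup B) (h : f H g ≠ 1) :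
    wordLength B g = wordLength B ((f H g)⁻¹ * g) + 1 := by
  obtain ⟨n, hn, hw⟩ := hf.isWord_of_apply_ne_one hH (isWord_wordLength hg) h
  have h1 := wordLength_le hw
  have h2 := wordLength_letter_mul_le hH (hf.mem H hH g)
    (mul_mem (inv_mem (le_sSup hH (hf.mem H hH g))) hg)
  rw [mul_inv_cancel_left] at h2
  omega

theorem wordLength_mul_of_apply_eq_one (hf : IsRetractionSystem B f) {H : Subgroup G} (hH : H ∈ B)
    {g h : G} (hg : g ∈ sSup B) (hh : h ∈ H) (h1 : h ≠ 1) (h2 : f H g = 1) :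
    wordLength B (h * g) = wordLength B g + 1 := by
  have h3 : f H (h * g) = h := by rw [hf.map_mul_left H hH h hh, h2, mul_one]
  have := hf.wordLength_inv_mul hH (mul_mem (le_sSup hH hh) hg) (by rwa [h3])
  rwa [h3, inv_mul_cancel_left] at this

/-- The element of the coset `H g` which is closest to `1` is `(f H g)⁻¹ g`. -/
theorem wordLength_lt_iff (hf : IsRetractionSystem B f) {H : Subgroup G} (hH : H ∈ B)
    {g h : G} (hg : g ∈ sSup B) (hh : h ∈ H) (h1 : h ≠ 1) :
    wordLength B (h⁻¹ * g) < wordLength B g ↔ f H g = h := by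
  have hg' : (h⁻¹ * g) ∈ sSup B := mul_mem (inv_mem (le_sSup hH hh)) hg
  have e : f H (h⁻¹ * g) = h⁻¹ * f H g := hf.map_mul_left H hH _ (inv_mem hh) g
  constructor
  · intro hlt
    by_contra hne
    have h3 : f H (h⁻¹ * g) ≠ 1 := by
      rw [e]; intro h4; exact hne (inv_mul_eq_one.mp h4).symm
    have h4 := hf.wordLength_inv_mul hH hg' h3
    have h5 : (f H (h⁻¹ * g))⁻¹ * (h⁻¹ * g) = (f H g)⁻¹ * g := by rw [e]; group
    rw [h5] at h4
    have h6 := wordLength_letter_mul_le hH (hf.mem H hH g)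
      (mul_mem (inv_mem (le_sSup hH (hf.mem H hH g))) hg)
    rw [mul_inv_cancel_left] at h6
    omega
  · rintro rfl
    have := hf.wordLength_inv_mul hH hg h1
    omega

theorem exists_apply_ne_one (hf : IsRetractionSystem B f) {g : G} (hg : g ∈ sSup B) (h1 : g ≠ 1) :
    ∃ H ∈ B, f H g ≠ 1 := by
  have hw := isWord_wordLength hg
  obtain ⟨n, hn⟩ := Nat.exists_eq_succ_of_ne_zero
    (fun h0 => h1 (eq_one_of_wordLength_eq_zero hg h0))
  rw [hn] at hw
  obtain ⟨x, hx, H, hH, s, hs, rfl⟩ := hw.exists_cons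
  refine ⟨H, hH, fun h2 => ?_⟩
  rw [hf.map_mul_left H hH s hs] at h2
  by_cases hs1 : s = 1
  · subst hs1
    rw [one_mul] at hn
    have := wordLength_le hx
    omega
  · have hne : f H x ≠ 1 := fun h3 => hs1 (by simpa [h3] using h2)
    obtain ⟨n', hn', hw'⟩ := hf.isWord_of_apply_ne_one hH hx hne
    rw [inv_eq_of_mul_eq_one_left h2] at hw'
    have := wordLength_le hw'
    omega

/-- A path with letters in `B'` stays on the same side of every wall `H ∈ B \ B'`: a crossing
would give a non-trivial element of `H` in the subgroup generated by `B'`, to be detected by some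
`f L` with `L ∈ B'`, whereas `f L` is trivial on `H`. -/
theorem apply_eq_one_of_mem_sSup (hf : IsRetractionSystem B f) {B' : Set (Subgroup G)}
    (hB' : B' ⊆ B) {H : Subgroup G} (hH : H ∈ B) (hH' : H ∉ B') {p : G} (hp : p ∈ sSup B') :
    f H p = 1 := by
  obtain ⟨n, hn⟩ := exists_isWord_of_mem_sSup hp
  induction hn with
  | one => exact hf.map_one H hH
  | @snoc n x s M hx hM hs ih =>
    rw [← ih hx.mem_sSup]
    by_contra hne
    obtain ⟨hc, k, hk, hkx, hfk⟩ := hf.exists_mul_left hH (hB' hM) hs hne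
    have hs1 : k ≠ 1 := by
      rintro rfl; exact hne (by simpa using hfk)
    have hkP : k ∈ sSup B' := by
      have : k = x * s * x⁻¹ := by rw [hkx]; group
      rw [this]
      exact mul_mem (mul_mem hx.mem_sSup (le_sSup hM hs)) (inv_mem hx.mem_sSup)
    obtain ⟨L, hL, hne'⟩ := (hf.mono hB').exists_apply_ne_one hkP hs1
    exact hne' (hf.apply_of_mem_of_ne (hB' hL) hH (fun h => hH' (h ▸ hL)) hk)

end IsRetractionSystem

end Retractions

/-! ### Pairs of subgroups: the rank two case -/

section AltProd

variable {G : Type*} [Group G]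

theorem altProd_mem {P : Subgroup G} {a b : G} (ha : a ∈ P) (hb : b ∈ P) (k : ℕ) :
    altProd a b k ∈ P := by
  induction k generalizing a b with
  | zero => exact one_mem _
  | succ k ih => exact mul_mem ha (ih hb ha)

theorem isWord_altProd {B : Set (Subgroup G)} {H L : Subgroup G} (hH : H ∈ B) (hL : L ∈ B)
    {a b : G} (ha : a ∈ H) (hb : b ∈ L) (k : ℕ) : IsWord B k (altProd a b k) := by
  induction k generalizing a b H L with
  | zero => exact IsWord.one
  | succ k ih => exact (ih hL hH hb ha).cons hH ha

theorem map_altProd {M N : Type*} [Monoid M] [Monoid N] (φ : M →* N) (a b : M) (k : ℕ) :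
    φ (altProd a b k) = altProd (φ a) (φ b) k := by
  induction k generalizing a b with
  | zero => exact map_one φ
  | succ k ih => rw [altProd, map_mul, ih]; rfl

end AltProd

section RankTwo

variable {G : Type*} [Group G] {f : Subgroup G → G → G}

/-- `m` is the length of the shortest elements of `⟨H, L⟩` which can be shortened by both `H` and
`L` on the left. It gives the braid relation between `H` and `L`, and it describes all the elements
`g` of the group generated by `B` that can be shortened by both `H` and `L`: such a `g` starts with
an alternating product of length `m`, and every intermediate word is reduced. -/
structure IsRankTwo (B : Set (Subgroup G)) (f : Subgroup G → G → G) (H L : Subgroup G) (m : ℕ) :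
    Prop where
  two_le : 2 ≤ m
  card : 2 < m → Nat.card H = 2 ∧ Nat.card L = 2
  braid : ∀ a ∈ H, ∀ b ∈ L, a ≠ 1 → b ≠ 1 → altProd a b m = altProd b a m
  apply_altProd_left : ∀ a ∈ H, ∀ b ∈ L, a ≠ 1 → b ≠ 1 → ∀ k < m, f H (altProd b a k) = 1
  apply_altProd_right : ∀ a ∈ H, ∀ b ∈ L, a ≠ 1 → b ≠ 1 → ∀ k < m, f L (altProd a b k) = 1
  factor : ∀ g ∈ sSup B, f H g ≠ 1 → f L g ≠ 1 → ∃ u ∈ sSup B,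
    g = altProd (f H g) (f L g) m * u ∧ ∀ k < m,
      f H (altProd (f L g) (f H g) k * u) = 1 ∧ f L (altProd (f H g) (f L g) k * u) = 1

theorem IsRankTwo.symm {B : Set (Subgroup G)} {H L : Subgroup G} {m : ℕ}
    (hf : IsRetractionSystem B f) (hH : H ∈ B) (hL : L ∈ B)
    (h : IsRankTwo B f H L m) : IsRankTwo B f L H m where
  two_le := h.two_le
  card hm := (h.card hm).symm
  braid a ha b hb ha1 hb1 := (h.braid b hb a ha hb1 ha1).symm
  apply_altProd_left a ha b hb ha1 hb1 := h.apply_altProd_right b hb a ha hb1 ha1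
  apply_altProd_right a ha b hb ha1 hb1 := h.apply_altProd_left b hb a ha hb1 ha1
  factor g hg h1 h2 := by
    obtain ⟨u, hu, e, hk⟩ := h.factor g hg h2 h1
    refine ⟨u, hu, ?_, fun k hkm => (hk k hkm).symm⟩
    rwa [h.braid _ (hf.mem H hH g) _ (hf.mem L hL g) h2 h1] at e

namespace IsRetractionSystem

variable {H L : Subgroup G} {n : ℕ}

/-- Alternating products which are shorter than the shortest elements with two descents have a
single descent. -/
theorem apply_altProd_of_minimal (hf : IsRetractionSystem {H, L} f)
    (hmin : ∀ k < n, ∀ x, IsWord {H, L} k x → f H x = 1 ∨ f L x = 1) {a b : G} (ha : a ∈ H)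
    (hb : b ∈ L) (ha1 : a ≠ 1) (hb1 : b ≠ 1) {k : ℕ} (hk : k < n) :
    f L (altProd a b k) = 1 ∧ f H (altProd b a k) = 1 := by
  have hH : H ∈ ({H, L} : Set (Subgroup G)) := Or.inl rfl
  have hL : L ∈ ({H, L} : Set (Subgroup G)) := Or.inr rfl
  induction k with
  | zero => exact ⟨hf.map_one L hL, hf.map_one H hH⟩
  | succ k ih =>
    obtain ⟨h1, h2⟩ := ih (by omega)
    have h3 : f H (altProd a b (k + 1)) = a := by
      rw [altProd, hf.map_mul_left H hH a ha, h2, mul_one]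
    have h4 : f L (altProd b a (k + 1)) = b := by
      rw [altProd, hf.map_mul_left L hL b hb, h1, mul_one]
    constructor
    · exact (hmin _ hk _ (isWord_altProd hH hL ha hb _)).resolve_left (by rwa [h3])
    · exact (hmin _ hk _ (isWord_altProd hL hH hb ha _)).resolve_right (by rwa [h4])

/-- Let `w` be of minimal length among the elements with two descents. Removing the last letter `s`
of a reduced word which starts in `H` removes the descent in `L`, hence the edge corresponding to
`s` is in the wall `L`, and `s` can be moved to the front as the letter `f L w`. -/
theorem eq_mul_of_minimal (hf : IsRetractionSystem {H, L} f) {j : ℕ}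
    (hmin : ∀ k < j + 2, ∀ x, IsWord {H, L} k x → f H x = 1 ∨ f L x = 1) {a y s : G}
    {M : Subgroup G} (ha : a ∈ H) (hy : IsWord {H, L} j y) (hM : M ∈ ({H, L} : Set (Subgroup G)))
    (hs : s ∈ M) (hw1 : f H (a * y * s) ≠ 1) (hw2 : f L (a * y * s) ≠ 1) :
    a * y * s = f L (a * y * s) * (a * y) := by
  have hH : H ∈ ({H, L} : Set (Subgroup G)) := Or.inl rfl
  have hL : L ∈ ({H, L} : Set (Subgroup G)) := Or.inr rfl
  have hy' : IsWord {H, L} (j + 1) (a * y) := hy.cons hH ha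
  have h1 : f H (a * y) ≠ 1 := by
    intro h1
    obtain ⟨-, k, hk, e, -⟩ := hf.exists_mul_left hH hM hs (by rwa [h1])
    have hw : IsWord {H, L} (j + 1) (a * y * s) := by
      rw [e, ← mul_assoc]; exact hy.cons hH (mul_mem hk ha)
    rcases hmin _ (by omega) _ hw with h | h
    · exact hw1 h
    · exact hw2 h
  have h2 : f L (a * y) = 1 := (hmin _ (by omega) _ hy').resolve_left h1
  obtain ⟨-, k, -, e, e'⟩ := hf.exists_mul_left hL hM hs (by rwa [h2])
  rw [e', h2, mul_one, e]

/-- An element of minimal length among those with two descents is an alternating product of its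
descents, in both orders. -/
theorem eq_altProd_of_minimal (hf : IsRetractionSystem {H, L} f)
    (hmin : ∀ k < n, ∀ x, IsWord {H, L} k x → f H x = 1 ∨ f L x = 1) {w : G}
    (hw : IsWord {H, L} n w) (hw1 : f H w ≠ 1) (hw2 : f L w ≠ 1) :
    w = altProd (f H w) (f L w) n ∧ w = altProd (f L w) (f H w) n := by
  have hH : H ∈ ({H, L} : Set (Subgroup G)) := Or.inl rfl
  have hL : L ∈ ({H, L} : Set (Subgroup G)) := Or.inr rfl
  have hfL : IsRetractionSystem {L, H} f := by rwa [Set.pair_comm]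
  -- the alternating prefixes are lengthened one letter at a time, by applying `eq_mul_of_minimal`
  -- to the factorisation of `w` which starts with the other descent
  have key : ∀ j, 1 ≤ j → j ≤ n →
      (∃ x, IsWord {H, L} (n - j) x ∧ w = altProd (f H w) (f L w) j * x) ∧
      (∃ x, IsWord {H, L} (n - j) x ∧ w = altProd (f L w) (f H w) j * x) := by
    intro j hj
    induction j, hj using Nat.le_induction with
    | base =>
      intro hn
      obtain ⟨k, rfl, hk⟩ := hf.isWord_of_apply_ne_one hH hw hw1
      obtain ⟨k', hk', hk''⟩ := hf.isWord_of_apply_ne_one hL hw hw2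
      obtain rfl : k' = k := by omega
      exact ⟨⟨_, hk, by simp [altProd]⟩, ⟨_, hk'', by simp [altProd]⟩⟩
    | succ j hj ih =>
      intro hjn
      obtain ⟨⟨x, hx, hwx⟩, ⟨y, hy, hwy⟩⟩ := ih (by omega)
      obtain ⟨i, hi⟩ : ∃ i, n - j = i + 1 := ⟨n - j - 1, by omega⟩
      obtain ⟨j, rfl⟩ : ∃ j', j = j' + 1 := ⟨j - 1, by omega⟩
      have hi' : n - (j + 1 + 1) = i := by omega
      have hn : n = j + i + 2 := by omega
      subst hn
      rw [hi] at hx hy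
      rw [hi']
      obtain ⟨x', hx', M, hM, s, hs, rfl⟩ := hx.exists_snoc
      obtain ⟨y', hy', M', hM', s', hs', rfl⟩ := hy.exists_snoc
      constructor
      · refine ⟨y', hy', ?_⟩
        have e : w = f L w * (altProd (f H w) (f L w) j * y') * s' := by
          conv_lhs => rw [hwy]
          simp only [altProd, mul_assoc]
        have hmin' : ∀ k < j + i + 2, ∀ x, IsWord {L, H} k x → f L x = 1 ∨ f H x = 1 := by
          intro k hk x hx
          rw [Set.pair_comm] at hx
          exact (hmin k hk x hx).symm
        have hy'' := (isWord_altProd hH hL (hf.mem H hH w) (hf.mem L hL w) j).mul hy'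
        rw [Set.pair_comm] at hy'' hM'
        have := hfL.eq_mul_of_minimal hmin' (hf.mem L hL w) hy'' hM' hs' (by rwa [← e])
          (by rwa [← e])
        rw [← e] at this
        conv_lhs => rw [this]
        simp only [altProd, mul_assoc]
      · refine ⟨x', hx', ?_⟩
        have e : w = f H w * (altProd (f L w) (f H w) j * x') * s := by
          conv_lhs => rw [hwx]
          simp only [altProd, mul_assoc]
        have := hf.eq_mul_of_minimal hmin (hf.mem H hH w)
          (y := altProd (f L w) (f H w) j * x') (s := s) (M := M)
          ((isWord_altProd hL hH (hf.mem L hL w) (hf.mem H hH w) j).mul hx') hM hs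
          (by rwa [← e]) (by rwa [← e])
        rw [← e] at this
        conv_lhs => rw [this]
        simp only [altProd, mul_assoc]
  have hn : 1 ≤ n := by
    rcases Nat.eq_zero_or_pos n with rfl | h
    · rw [isWord_zero_iff] at hw
      exact absurd (by rw [hw]; exact hf.map_one H hH) hw1
    · exact h
  obtain ⟨⟨x, hx, hwx⟩, ⟨y, hy, hwy⟩⟩ := key n hn le_rfl
  rw [Nat.sub_self, isWord_zero_iff] at hx hy
  rw [hx, mul_one] at hwx
  rw [hy, mul_one] at hwy
  exact ⟨hwx, hwy⟩

theorem two_le_of_isWord (hf : IsRetractionSystem {H, L} f) (hne : H ≠ L) {w : G}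
    (hw : IsWord {H, L} n w) (hw1 : f H w ≠ 1) (hw2 : f L w ≠ 1) : 2 ≤ n := by
  have hH : H ∈ ({H, L} : Set (Subgroup G)) := Or.inl rfl
  have hL : L ∈ ({H, L} : Set (Subgroup G)) := Or.inr rfl
  by_contra hn
  obtain rfl | rfl : n = 0 ∨ n = 1 := by omega
  · rw [isWord_zero_iff] at hw
    exact hw1 (by rw [hw]; exact hf.map_one H hH)
  · obtain ⟨x, hx, M, hM, s, hs, rfl⟩ := hw.exists_snoc
    rw [isWord_zero_iff] at hx
    subst hx
    rw [one_mul] at hw1 hw2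
    rcases hM with rfl | rfl
    · exact hw2 (hf.apply_of_mem_of_ne hL hH hne hs)
    · exact hw1 (hf.apply_of_mem_of_ne hH hL hne.symm hs)

/-- If the minimal length is two, an element of `L` which commutes with one non-trivial element of
`H`, thus crossing the wall `H` in parallel, commutes with all of `H`. -/
theorem commute_of_minimal_two (hf : IsRetractionSystem {H, L} f) (hne : H ≠ L)
    (hmin : ∀ k < 2, ∀ x, IsWord {H, L} k x → f H x = 1 ∨ f L x = 1) {a b : G} (ha : a ∈ H)
    (hb : b ∈ L) (ha1 : a ≠ 1) (hb1 : b ≠ 1) (hab : a * b = b * a) {h : G} (hh : h ∈ H) :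
    h * b = b * h := by
  have hH : H ∈ ({H, L} : Set (Subgroup G)) := Or.inl rfl
  have hL : L ∈ ({H, L} : Set (Subgroup G)) := Or.inr rfl
  have hbH : f H b = 1 := hf.apply_of_mem_of_ne hH hL hne.symm hb
  by_cases hh1 : h = 1
  · simp [hh1]
  have hc : conjSubgroup b H = H := by
    refine (hf.exists_mul_left hH hH ha ?_).1
    rw [← hab, hf.map_mul_left H hH a ha, hbH, mul_one]
    exact ha1
  have hh' : b * h * b⁻¹ ∈ H := by
    rw [← hc, mem_conjSubgroup]; simpa [mul_assoc] using hh
  have e : b * h = (b * h * b⁻¹) * b := by group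
  have h1 : f H (b * h) = b * h * b⁻¹ := by
    rw [e, hf.map_mul_left H hH _ hh', hbH, mul_one, ← e]
  have h2 : f L (b * h) = b := by
    rw [hf.map_mul_right L hL H hH b h hh (by rwa [hc]), hf.apply_of_mem hL hb]
  obtain ⟨-, h4⟩ := hf.eq_altProd_of_minimal hmin (w := b * h)
    (by simpa using (IsWord.one.cons hH hh).cons hL hb)
    (by rw [h1]; intro h3; exact hh1 (by simpa using h3)) (by rwa [h2])
  rw [h1, h2] at h4
  simp only [altProd, mul_one] at h4
  have h5 : h = b * h * b⁻¹ := mul_left_cancel h4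
  calc h * b = b * h * b⁻¹ * b := by rw [← h5]
    _ = b * h := by group

/-- If the minimal length is at least three, then `b` is the only non-trivial element of `L`:
replacing the first letter of `altProd b a n` with `c ∈ L` yields another element of minimal length
with two descents, which is equal to `altProd a c n`, and whose second letter can be read in
`altProd a b (n - 1)`. -/
theorem eq_of_minimal (hf : IsRetractionSystem {H, L} f) (hne : H ≠ L)
    (hmin : ∀ k < n + 3, ∀ x, IsWord {H, L} k x → f H x = 1 ∨ f L x = 1) {a b : G} (ha : a ∈ H)
    (hb : b ∈ L) (ha1 : a ≠ 1) (hb1 : b ≠ 1)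
    (hab : altProd a b (n + 3) = altProd b a (n + 3)) {c : G} (hc : c ∈ L) (hc1 : c ≠ 1) :
    c = b := by
  have hH : H ∈ ({H, L} : Set (Subgroup G)) := Or.inl rfl
  have hL : L ∈ ({H, L} : Set (Subgroup G)) := Or.inr rfl
  have hred := fun {c : G} (hc : c ∈ L) (hc1 : c ≠ 1) {k : ℕ} (hk : k < n + 3) =>
    hf.apply_altProd_of_minimal hmin ha hc ha1 hc1 hk
  set p := altProd a b (n + 2) with hp
  have hpw : IsWord {H, L} (n + 2) p := isWord_altProd hH hL ha hb _
  have hpL : f L p = 1 := (hred hb hb1 (by omega)).1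
  have hpH : f H p = a := by
    rw [hp, altProd, hf.map_mul_left H hH a ha, (hred hb hb1 (by omega)).2, mul_one]
  have hw : IsWord {H, L} (n + 3) (c * p) := hpw.cons hL hc
  have h1 : f L (c * p) = c := by rw [hf.map_mul_left L hL c hc, hpL, mul_one]
  have h2 : f H (c * p) = a := by
    -- the wall crossed last by `altProd a b (n + 3)` is `L`
    obtain ⟨M, hM, s, hs, hps⟩ : ∃ M ∈ ({H, L} : Set (Subgroup G)), ∃ s ∈ M, b * p = p * s := by
      have hlast : ∀ (j : ℕ) {H' L' : Subgroup G} {a' b' : G}, a' ∈ H' → b' ∈ L' →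
          ∃ M ∈ ({H', L'} : Set (Subgroup G)), ∃ s ∈ M,
            altProd a' b' (j + 1) = altProd a' b' j * s := by
        intro j
        induction j with
        | zero => intro H' L' a' b' ha' _; exact ⟨H', Or.inl rfl, a', ha', by simp [altProd]⟩
        | succ j ih =>
          intro H' L' a' b' ha' hb'
          obtain ⟨M, hM, s, hs, e⟩ := ih hb' ha'
          exact ⟨M, by rwa [Set.pair_comm], s, hs, by rw [altProd, e, altProd, mul_assoc]⟩
      obtain ⟨M, hM, s, hs, e⟩ := hlast (n + 2) ha hb
      refine ⟨M, hM, s, hs, ?_⟩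
      rw [← e, hab]; rfl
    obtain ⟨hcj, -⟩ := hf.exists_mul_left hL hM hs (x := p)
      (by rw [← hps, hf.map_mul_left L hL b hb, hpL, mul_one]; exact hb1)
    have ht : p⁻¹ * c * p ∈ M := by rw [← mem_conjSubgroup, hcj]; exact hc
    have e : c * p = p * (p⁻¹ * c * p) := by group
    rw [e, hf.map_mul_right H hH M hM p _ ht (by rw [hcj]; exact hne.symm), hpH]
  obtain ⟨-, h4⟩ := hf.eq_altProd_of_minimal hmin hw (by rwa [h2]) (by rwa [h1])
  rw [h1, h2, altProd] at h4
  have h5 := mul_left_cancel h4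
  change a * (b * altProd a b n) = a * (c * altProd a c n) at h5
  have h6 := congrArg (f L) (mul_left_cancel h5)
  rw [hf.map_mul_left L hL c hc, hf.map_mul_left L hL b hb,
    (hred hc hc1 (by omega)).1, (hred hb hb1 (by omega)).1, mul_one, mul_one] at h6
  exact h6.symm

end IsRetractionSystem

end RankTwo

section RankTwoExistence

variable {G : Type*} [Group G] {f : Subgroup G → G → G} {B : Set (Subgroup G)}
  {H L : Subgroup G}

namespace IsRetractionSystem

/-- If `u` is of minimal length in the coset `⟨B'⟩ g`, then no wall of a member of `B'` separates
`q` and `q u`, for `q ∈ ⟨B'⟩`: otherwise the exchange lemma shortens `u` within the coset. -/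
theorem exists_gate (hf : IsRetractionSystem B f) {B' : Set (Subgroup G)} (hB' : B' ⊆ B) {g : G}
    (hg : g ∈ sSup B) : ∃ p ∈ sSup B', ∃ u ∈ sSup B, g = p * u ∧
      ∀ q ∈ sSup B', ∀ M ∈ B', f M (q * u) = f M q := by
  have hle : sSup B' ≤ sSup B := sSup_le_sSup hB'
  have hex : ∃ n, ∃ p ∈ sSup B', wordLength B (p⁻¹ * g) = n := ⟨_, 1, one_mem _, rfl⟩
  classical
  obtain ⟨p, hp, hn⟩ := Nat.find_spec hex
  have hu : p⁻¹ * g ∈ sSup B := mul_mem (inv_mem (hle hp)) hg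
  refine ⟨p, hp, p⁻¹ * g, hu, by group, fun q hq M hM => ?_⟩
  by_contra hne
  obtain ⟨n', hn', hw⟩ := hf.exchange (hB' hM) q (isWord_wordLength hu) hne
  have hk : f M (q * (p⁻¹ * g)) * (f M q)⁻¹ ∈ M :=
    mul_mem (hf.mem M (hB' hM) _) (inv_mem (hf.mem M (hB' hM) _))
  set k := f M (q * (p⁻¹ * g)) * (f M q)⁻¹ with hkdef
  have hk' : k ∈ sSup B' := le_sSup hM hk
  have hlt : wordLength B ((p * (q⁻¹ * k * q))⁻¹ * g) < Nat.find hex := by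
    have e : (p * (q⁻¹ * k * q))⁻¹ * g = q⁻¹ * k⁻¹ * q * (p⁻¹ * g) := by group
    rw [e, ← hn, hn']
    exact Nat.lt_succ_of_le (wordLength_le hw)
  exact Nat.find_min hex hlt
    ⟨_, mul_mem hp (mul_mem (mul_mem (inv_mem hq) hk') hq), rfl⟩

/-- The elements of `⟨H, L⟩` if `H` and `L` commute. -/
theorem exists_eq_mul_of_commute {p : G} (hp : p ∈ sSup ({H, L} : Set (Subgroup G)))
    (hc : ∀ x ∈ H, ∀ y ∈ L, x * y = y * x) : ∃ x ∈ H, ∃ y ∈ L, p = x * y := by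
  obtain ⟨n, hn⟩ := exists_isWord_of_mem_sSup hp
  induction hn with
  | one => exact ⟨1, one_mem _, 1, one_mem _, by simp⟩
  | @snoc n z s M hz hM hs ih =>
    obtain ⟨x, hx, y, hy, rfl⟩ := ih hz.mem_sSup
    rcases hM with rfl | rfl
    · exact ⟨x * s, mul_mem hx hs, y, hy, by rw [mul_assoc, ← hc s hs y hy, mul_assoc]⟩
    · exact ⟨x, hx, y * s, mul_mem hy hs, by rw [mul_assoc]⟩

/-- The elements of the dihedral group `⟨H, L⟩`. -/
theorem exists_eq_altProd {a b : G} (ha : ∀ h ∈ H, h = 1 ∨ h = a) (hb : ∀ h ∈ L, h = 1 ∨ h = b)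
    (ha2 : a * a = 1) (hb2 : b * b = 1) {n : ℕ} (hn : 0 < n)
    (hab : altProd a b n = altProd b a n) {p : G} (hp : p ∈ sSup ({H, L} : Set (Subgroup G))) :
    ∃ k ≤ n, p = altProd a b k ∨ p = altProd b a k := by
  have step : ∀ {x y : G}, altProd x y n = altProd y x n → x * x = 1 → ∀ k ≤ n,
      ∀ p, (p = altProd x y k ∨ p = altProd y x k) →
      ∃ k ≤ n, x * p = altProd x y k ∨ x * p = altProd y x k := by
    intro x y hxy hx k hk p hp
    have h1 : ∀ k ≤ n, 1 ≤ k → ∃ k' ≤ n, x * altProd x y k = altProd y x k' := by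
      intro k hk hk1
      obtain ⟨k, rfl⟩ := Nat.exists_eq_succ_of_ne_zero (Nat.one_le_iff_ne_zero.mp hk1)
      exact ⟨k, by omega, by rw [altProd, ← mul_assoc, hx, one_mul]⟩
    rcases hp with rfl | rfl
    · rcases Nat.eq_zero_or_pos k with rfl | hk1
      · exact ⟨1, hn, Or.inl (by simp [altProd])⟩
      · obtain ⟨k', hk', e⟩ := h1 k hk hk1
        exact ⟨k', hk', Or.inr e⟩
    · rcases hk.lt_or_eq with hlt | rfl
      · exact ⟨k + 1, hlt, Or.inl rfl⟩
      · obtain ⟨k', hk', e⟩ := h1 k hk hn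
        exact ⟨k', hk', Or.inr (by rw [← hxy]; exact e)⟩
  obtain ⟨m, hm⟩ := exists_isWord_of_mem_sSup hp
  clear hp
  induction m generalizing p with
  | zero => exact ⟨0, Nat.zero_le _, Or.inl (by rwa [isWord_zero_iff] at hm)⟩
  | succ m ih =>
    obtain ⟨x, hx, M, hM, s, hs, rfl⟩ := hm.exists_cons
    obtain ⟨k, hk, hk'⟩ := ih hx
    have hs' : s = 1 ∨ s = a ∨ s = b := by
      rcases hM with rfl | rfl
      · exact (ha s hs).imp_right Or.inl
      · exact (hb s hs).imp_right Or.inr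
    rcases hs' with rfl | rfl | rfl
    · exact ⟨k, hk, by simpa using hk'⟩
    · exact step hab ha2 k hk x hk'
    · obtain ⟨k', h1, h2⟩ := step hab.symm hb2 k hk x hk'.symm
      exact ⟨k', h1, h2.symm⟩

/-- Two members of `B` which both shorten some element of the group have a braid relation. -/
theorem exists_isRankTwo (hf : IsRetractionSystem B f) (hH : H ∈ B) (hL : L ∈ B) (hne : H ≠ L)
    {g : G} (hg : g ∈ sSup B) (hgH : f H g ≠ 1) (hgL : f L g ≠ 1) :
    ∃ m, IsRankTwo B f H L m := by
  have hsub : ({H, L} : Set (Subgroup G)) ⊆ B := by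
    rintro M (rfl | rfl)
    · exact hH
    · exact hL
  have hH' : H ∈ ({H, L} : Set (Subgroup G)) := Or.inl rfl
  have hL' : L ∈ ({H, L} : Set (Subgroup G)) := Or.inr rfl
  have hf' := hf.mono hsub
  have hf'' : IsRetractionSystem {L, H} f := by rwa [Set.pair_comm]
  -- descents in `H` and `L` only depend on the `⟨H, L⟩`-part of an element
  have hgate : ∀ g ∈ sSup B, ∃ p ∈ sSup ({H, L} : Set (Subgroup G)), ∃ u ∈ sSup B, g = p * u ∧
      f H p = f H g ∧ f L p = f L g ∧ ∀ q ∈ sSup ({H, L} : Set (Subgroup G)),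
        ∀ M ∈ ({H, L} : Set (Subgroup G)), f M (q * u) = f M q := by
    intro g hg
    obtain ⟨p, hp, u, hu, rfl, h⟩ := hf.exists_gate hsub hg
    exact ⟨p, hp, u, hu, rfl, (h p hp H hH').symm, (h p hp L hL').symm, h⟩
  have hex : ∃ n, ∃ w, IsWord {H, L} n w ∧ f H w ≠ 1 ∧ f L w ≠ 1 := by
    obtain ⟨p, hp, u, -, -, h1, h2, -⟩ := hgate g hg
    obtain ⟨n, hn⟩ := exists_isWord_of_mem_sSup hp
    exact ⟨n, p, hn, by rwa [h1], by rwa [h2]⟩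
  classical
  obtain ⟨w, hw, hw1, hw2⟩ := Nat.find_spec hex
  have hmin : ∀ k < Nat.find hex, ∀ x, IsWord {H, L} k x → f H x = 1 ∨ f L x = 1 := by
    intro k hk x hx
    by_contra! h
    exact Nat.find_min hex hk ⟨x, hx, h⟩
  generalize Nat.find hex = n at hw hmin
  have hmin' : ∀ k < n, ∀ x, IsWord {L, H} k x → f L x = 1 ∨ f H x = 1 := by
    intro k hk x hx
    rw [Set.pair_comm] at hx
    exact (hmin k hk x hx).symm
  have hn := hf'.two_le_of_isWord hne hw hw1 hw2
  have hred : ∀ a ∈ H, ∀ b ∈ L, a ≠ 1 → b ≠ 1 → ∀ k < n,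
      f L (altProd a b k) = 1 ∧ f H (altProd b a k) = 1 := fun a ha b hb ha1 hb1 k hk =>
    hf'.apply_altProd_of_minimal hmin ha hb ha1 hb1 hk
  have hwa := hf'.eq_altProd_of_minimal hmin hw hw1 hw2
  have hab := hwa.1.symm.trans hwa.2
  have haH := hf'.mem H hH' w
  have hbL := hf'.mem L hL' w
  generalize f H w = a at *
  generalize f L w = b at *
  -- it remains to treat the elements of `⟨H, L⟩` with two descents
  suffices hmain : (2 < n → Nat.card H = 2 ∧ Nat.card L = 2) ∧
      (∀ a ∈ H, ∀ b ∈ L, a ≠ 1 → b ≠ 1 → altProd a b n = altProd b a n) ∧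
      ∀ p ∈ sSup ({H, L} : Set (Subgroup G)), f H p ≠ 1 → f L p ≠ 1 →
        p = altProd (f H p) (f L p) n by
    refine ⟨n, hn, hmain.1, hmain.2.1, fun a ha b hb ha1 hb1 k hk =>
      (hred a ha b hb ha1 hb1 k hk).2, fun a ha b hb ha1 hb1 k hk =>
      (hred a ha b hb ha1 hb1 k hk).1, fun g hg h1 h2 => ?_⟩
    obtain ⟨p, hp, u, hu, e, e1, e2, h⟩ := hgate g hg
    have hp' := hmain.2.2 p hp (by rwa [e1]) (by rwa [e2])
    rw [e1, e2] at hp'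
    refine ⟨u, hu, by rw [← hp', e], fun k hk => ?_⟩
    have hHP := (le_sSup hH' : H ≤ sSup ({H, L} : Set (Subgroup G))) (hf.mem H hH g)
    have hLP := (le_sSup hL' : L ≤ sSup ({H, L} : Set (Subgroup G))) (hf.mem L hL g)
    rw [h _ (altProd_mem hLP hHP k) H hH', h _ (altProd_mem hHP hLP k) L hL']
    exact (hred _ (hf.mem H hH g) _ (hf.mem L hL g) h1 h2 k hk).symm
  -- for `n ≥ 3` the group `⟨H, L⟩` is dihedral, and for `n = 2` it is a direct product
  rcases hn.lt_or_eq with hn3 | rfl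
  · obtain ⟨n, rfl⟩ : ∃ n', n = n' + 3 := ⟨n - 3, by omega⟩
    have hL1 : ∀ c ∈ L, c = 1 ∨ c = b := fun c hc => or_iff_not_imp_left.mpr fun hc1 =>
      hf'.eq_of_minimal hne hmin haH hbL hw1 hw2 hab hc hc1
    have hH1 : ∀ c ∈ H, c = 1 ∨ c = a := fun c hc => or_iff_not_imp_left.mpr fun hc1 =>
      hf''.eq_of_minimal hne.symm hmin' hbL haH hw2 hw1 hab.symm hc hc1
    have hcard : ∀ {K : Subgroup G} {c : G}, c ∈ K → c ≠ 1 → (∀ h ∈ K, h = 1 ∨ h = c) →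
        Nat.card K = 2 ∧ c * c = 1 := by
      intro K c hc hc1 h
      refine ⟨Nat.card_eq_two_iff.mpr ⟨1, ⟨c, hc⟩, ?_, ?_⟩, ?_⟩
      · intro e; exact hc1 (congrArg Subtype.val e).symm
      · ext ⟨x, hx⟩
        simpa [Subtype.ext_iff] using h x hx
      · exact (h _ (mul_mem hc hc)).resolve_right fun e => hc1 (mul_eq_left.mp e)
    obtain ⟨hcH, ha2⟩ := hcard haH hw1 hH1
    obtain ⟨hcL, hb2⟩ := hcard hbL hw2 hL1
    refine ⟨fun _ => ⟨hcH, hcL⟩, ?_, ?_⟩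
    · intro a' ha' b' hb' ha1 hb1
      obtain rfl := (hH1 a' ha').resolve_left ha1
      obtain rfl := (hL1 b' hb').resolve_left hb1
      exact hab
    · intro p hp h1 h2
      rw [(hH1 _ (hf.mem H hH p)).resolve_left h1, (hL1 _ (hf.mem L hL p)).resolve_left h2]
      obtain ⟨k, hk, hk'⟩ := exists_eq_altProd hH1 hL1 ha2 hb2 (by omega) hab hp
      rcases hk.lt_or_eq with hlt | rfl
      · rcases hk' with rfl | rfl
        · exact absurd (hred a haH b hbL hw1 hw2 k hlt).1 h2
        · exact absurd (hred a haH b hbL hw1 hw2 k hlt).2 h1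
      · exact hk'.elim id (fun h => h.trans hab.symm)
  · have hcb : ∀ x ∈ H, x * b = b * x := fun x hx =>
      hf'.commute_of_minimal_two hne hmin haH hbL hw1 hw2 (by simpa [altProd] using hab) hx
    have hc : ∀ x ∈ H, ∀ y ∈ L, x * y = y * x := by
      intro x hx y hy
      by_cases hx1 : x = 1
      · simp [hx1]
      · exact (hf''.commute_of_minimal_two hne.symm hmin' hbL hx hw2 hx1 (hcb x hx).symm hy).symm
    refine ⟨fun h => absurd h (lt_irrefl _), fun x hx y hy _ _ => by
      simpa [altProd] using hc x hx y hy, fun p hp _ _ => ?_⟩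
    obtain ⟨x, hx, y, hy, rfl⟩ := exists_eq_mul_of_commute hp hc
    have e1 : f H (x * y) = x := by
      rw [hf.map_mul_left H hH x hx, hf.apply_of_mem_of_ne hH hL hne.symm hy, mul_one]
    have e2 : f L (x * y) = y := by
      rw [hc x hx y hy, hf.map_mul_left L hL y hy, hf.apply_of_mem_of_ne hL hH hne hx, mul_one]
    rw [e1, e2]
    simp [altProd]

end IsRetractionSystem

end RankTwoExistence

/-! ### The word problem: braid relations suffice -/

section WordProblem

variable {G Q : Type*} [Group G] [Group Q] {f : Subgroup G → G → G} {B : Set (Subgroup G)}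
  {ι : Subgroup G → G → Q}

/-- `IsReducedLift B f ι g x` means that `x` is obtained by evaluating in `Q`, through the maps
`ι H : H → Q` for `H ∈ B`, a reduced word which represents `g`. -/
inductive IsReducedLift (B : Set (Subgroup G)) (f : Subgroup G → G → G) (ι : Subgroup G → G → Q) :
    G → Q → Prop
  | one : IsReducedLift B f ι 1 1
  | cons {g : G} {x : Q} {H : Subgroup G} {h : G} : IsReducedLift B f ι g x → H ∈ B → h ∈ H →
      h ≠ 1 → f H g = 1 → IsReducedLift B f ι (h * g) (ι H h * x)

theorem IsReducedLift.mem_sSup {g : G} {x : Q} (h : IsReducedLift B f ι g x) : g ∈ sSup B := by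
  induction h with
  | one => exact one_mem _
  | cons _ hH hh _ _ ih => exact mul_mem (le_sSup hH hh) ih

theorem IsReducedLift.eq_or_exists {g : G} {x : Q} (h : IsReducedLift B f ι g x) :
    (g = 1 ∧ x = 1) ∨ ∃ g' x' H h, IsReducedLift B f ι g' x' ∧ H ∈ B ∧ h ∈ H ∧ h ≠ 1 ∧
      f H g' = 1 ∧ g = h * g' ∧ x = ι H h * x' := by
  cases h with
  | one => exact Or.inl ⟨rfl, rfl⟩
  | cons h1 h2 h3 h4 h5 => exact Or.inr ⟨_, _, _, _, h1, h2, h3, h4, h5, rfl, rfl⟩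

namespace IsRetractionSystem

theorem exists_isReducedLift (hf : IsRetractionSystem B f) (ι : Subgroup G → G → Q) {g : G}
    (hg : g ∈ sSup B) : ∃ x, IsReducedLift B f ι g x := by
  induction hn : wordLength B g using Nat.strong_induction_on generalizing g with
  | _ n ih =>
    by_cases h1 : g = 1
    · exact ⟨1, h1 ▸ IsReducedLift.one⟩
    · obtain ⟨H, hH, hne⟩ := hf.exists_apply_ne_one hg h1
      have hlt := hf.wordLength_inv_mul hH hg hne
      obtain ⟨x, hx⟩ := ih _ (by omega)
        (mul_mem (inv_mem (le_sSup hH (hf.mem H hH g))) hg) rfl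
      have := hx.cons hH (hf.mem H hH g) hne (hf.apply_inv_mul hH g)
      rw [mul_inv_cancel_left] at this
      exact ⟨_, this⟩

theorem isReducedLift_altProd {H L : Subgroup G} {u a b : G} {x : Q}
    (hu : IsReducedLift B f ι u x) (hH : H ∈ B) (hL : L ∈ B) (ha : a ∈ H) (hb : b ∈ L)
    (ha1 : a ≠ 1) (hb1 : b ≠ 1) {k : ℕ}
    (hk : ∀ j < k, f H (altProd b a j * u) = 1 ∧ f L (altProd a b j * u) = 1) :
    IsReducedLift B f ι (altProd a b k * u) (altProd (ι H a) (ι L b) k * x) := by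
  induction k generalizing a b H L with
  | zero => simpa [altProd] using hu
  | succ k ih =>
    have := ih hL hH hb ha hb1 ha1 (fun j hj => (hk j (by omega)).symm)
    simp only [altProd, mul_assoc]
    exact this.cons hH ha ha1 (hk k (by omega)).1

/-- Matsumoto's theorem: if the braid relations hold in `Q`, then all the reduced words
representing `g` have the same value in `Q`. If two such words start in distinct `H` and `L`, they
are compared with words which start with the two sides of the braid relation between `H` and
`L`. -/
theorem isReducedLift_unique (hf : IsRetractionSystem B f)
    (hbraid : ∀ H ∈ B, ∀ L ∈ B, H ≠ L → ∀ m, IsRankTwo B f H L m → ∀ a ∈ H, ∀ b ∈ L, a ≠ 1 →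
      b ≠ 1 → altProd (ι H a) (ι L b) m = altProd (ι L b) (ι H a) m) {g : G} {x y : Q}
    (hx : IsReducedLift B f ι g x) (hy : IsReducedLift B f ι g y) : x = y := by
  induction hn : wordLength B g using Nat.strong_induction_on generalizing g x y with
  | _ n ih =>
    have hg := hx.mem_sSup
    have key : ∀ {g' : G} {H : Subgroup G} {h : G}, g' ∈ sSup B → H ∈ B → h ∈ H → h ≠ 1 →
        f H g' = 1 → g = h * g' → f H g = h ∧ wordLength B g' < n := by
      rintro g' H h hg' hH hh hh1 h1 rfl
      have := hf.wordLength_mul_of_apply_eq_one hH hg' hh hh1 h1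
      exact ⟨by rw [hf.map_mul_left H hH h hh, h1, mul_one], by omega⟩
    have hone : ∀ {H : Subgroup G} {h : G}, H ∈ B → f H g = h → h ≠ 1 → g ≠ 1 := by
      rintro H h hH h1 h2 rfl
      exact h2 (h1.symm.trans (hf.map_one H hH))
    rcases hx.eq_or_exists with ⟨hg1, rfl⟩ | ⟨g₁, x₁, H, h, hx', hH, hh, hh1, h1, hg1, rfl⟩
    · rcases hy.eq_or_exists with ⟨-, rfl⟩ | ⟨g₂, y₂, L, l, hy', hL, hl, hl1, h2, hg2, rfl⟩
      · rfl
      · exact absurd hg1 (hone hL (key hy'.mem_sSup hL hl hl1 h2 hg2).1 hl1)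
    · have hgH := key hx'.mem_sSup hH hh hh1 h1 hg1
      rcases hy.eq_or_exists with ⟨hg2, rfl⟩ | ⟨g₂, y₂, L, l, hy', hL, hl, hl1, h2, hg2, rfl⟩
      · exact absurd hg2 (hone hH hgH.1 hh1)
      · have hgL := key hy'.mem_sSup hL hl hl1 h2 hg2
        by_cases hHL : H = L
        · subst hHL
          obtain rfl : h = l := hgH.1.symm.trans hgL.1
          obtain rfl := mul_left_cancel (hg1.symm.trans hg2)
          rw [ih _ hgH.2 hx' hy' rfl]
        · obtain ⟨m, hm⟩ := hf.exists_isRankTwo hH hL hHL hg (by rwa [hgH.1]) (by rwa [hgL.1])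
          obtain ⟨u, hu, e, hk⟩ := hm.factor _ hg (by rwa [hgH.1]) (by rwa [hgL.1])
          rw [hgH.1, hgL.1] at e hk
          -- complete a reduced word of `u` to two reduced words of `g` by the two sides of the
          -- braid relation, and apply the induction hypothesis after the first letters `h` and `l`
          obtain ⟨z, hz⟩ := hf.exists_isReducedLift ι hu
          have hm2 := hm.two_le
          obtain ⟨m, rfl⟩ : ∃ m', m = m' + 1 := ⟨m - 1, by omega⟩
          have e1 : g₁ = altProd l h m * u := by
            apply mul_left_cancel (a := h)
            rw [← hg1, e, altProd, mul_assoc]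
          have e2 : g₂ = altProd h l m * u := by
            apply mul_left_cancel (a := l)
            rw [← hg2, e, hm.braid h hh l hl hh1 hl1, altProd, mul_assoc]
          have hz1 := isReducedLift_altProd hz hL hH hl hh hl1 hh1
            (fun j (hj : j < m) => (hk j (by omega)).symm)
          have hz2 := isReducedLift_altProd hz hH hL hh hl hh1 hl1
            (fun j (hj : j < m) => hk j (by omega))
          rw [← e1] at hz1
          rw [← e2] at hz2
          rw [ih _ hgH.2 hx' hz1 rfl, ih _ hgL.2 hy' hz2 rfl, ← mul_assoc, ← mul_assoc]
          congr 1
          exact hbraid H hH L hL hHL _ hm h hh l hl hh1 hl1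

/-- A group `Q` generated by copies of the members of `B` in which the braid relations hold, and
which maps compatibly to `G`, embeds into `G`: every element of `Q` is the value of a reduced
word. -/
theorem injective_of_braid (hf : IsRetractionSystem B f)
    (hι : ∀ H ∈ B, ∀ h ∈ H, ∀ h' ∈ H, ι H (h * h') = ι H h * ι H h')
    (hbraid : ∀ H ∈ B, ∀ L ∈ B, H ≠ L → ∀ m, IsRankTwo B f H L m → ∀ a ∈ H, ∀ b ∈ L, a ≠ 1 →
      b ≠ 1 → altProd (ι H a) (ι L b) m = altProd (ι L b) (ι H a) m)
    (ev : Q →* G) (hev : ∀ H ∈ B, ∀ h ∈ H, ev (ι H h) = h)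
    (hgen : Subgroup.closure {x | ∃ H ∈ B, ∃ h ∈ H, x = ι H h} = ⊤) : Function.Injective ev := by
  have hι1 : ∀ H ∈ B, ι H 1 = 1 := fun H hH => by
    have := hι H hH 1 (one_mem _) 1 (one_mem _)
    rwa [one_mul, left_eq_mul] at this
  have hstep : ∀ {g : G} {x : Q}, IsReducedLift B f ι g x → ∀ H ∈ B, ∀ h ∈ H,
      IsReducedLift B f ι (h * g) (ι H h * x) := by
    intro g x hx H hH h hh
    by_cases hg1 : f H g = 1
    · by_cases hh1 : h = 1
      · subst hh1; simpa [hι1 H hH] using hx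
      · exact hx.cons hH hh hh1 hg1
    · have hk := hf.mem H hH g
      obtain ⟨y, hy⟩ := hf.exists_isReducedLift ι
        (mul_mem (inv_mem (le_sSup hH hk)) hx.mem_sSup)
      have hy' := hy.cons hH hk hg1 (hf.apply_inv_mul hH g)
      rw [mul_inv_cancel_left] at hy'
      rw [hf.isReducedLift_unique hbraid hx hy', ← mul_assoc, ← hι H hH h hh _ hk]
      have e : h * g = (h * f H g) * ((f H g)⁻¹ * g) := by group
      rw [e]
      by_cases hhk : h * f H g = 1
      · rw [hhk, hι1 H hH]; simpa using hy
      · exact hy.cons hH (mul_mem hh hk) hhk (hf.apply_inv_mul hH g)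
  have hall : ∀ x : Q, IsReducedLift B f ι (ev x) x := by
    intro x
    have hx : x ∈ Subgroup.closure {x | ∃ H ∈ B, ∃ h ∈ H, x = ι H h} := hgen ▸ Subgroup.mem_top x
    induction hx using Subgroup.closure_induction_left with
    | one => simpa using IsReducedLift.one
    | mul_left x hx y _ ih =>
      obtain ⟨H, hH, h, hh, rfl⟩ := hx
      rw [map_mul, hev H hH h hh]
      exact hstep ih H hH h hh
    | inv_mul_cancel x hx y _ ih =>
      obtain ⟨H, hH, h, hh, rfl⟩ := hx
      have e : (ι H h)⁻¹ = ι H h⁻¹ := by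
        rw [inv_eq_iff_mul_eq_one, ← hι H hH h hh _ (inv_mem hh), mul_inv_cancel, hι1 H hH]
      rw [e, map_mul, hev H hH _ (inv_mem hh)]
      exact hstep ih H hH _ (inv_mem hh)
  rw [injective_iff_map_eq_one]
  intro x hx
  have := hall x
  rw [hx] at this
  exact hf.isReducedLift_unique hbraid this IsReducedLift.one

end IsRetractionSystem

end WordProblem

/-! ### Retraction systems yield periagroups -/

section FreeProducts

open Monoid

theorem exists_word_altProd {I : Type*} {M : I → Type*} [∀ i, Group (M i)] {i j : I} (hij : i ≠ j)
    {a : M i} {b : M j} (ha : a ≠ 1) (hb : b ≠ 1) (k : ℕ) :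
    ∃ w : CoprodI.Word M, w.prod = altProd (CoprodI.of a) (CoprodI.of b) (k + 1) ∧
      w.fstIdx = some i := by
  classical
  induction k generalizing i j with
  | zero =>
    refine ⟨CoprodI.Word.cons a CoprodI.Word.empty (by simp [CoprodI.Word.fstIdx]) ha, ?_, ?_⟩
    · rw [CoprodI.Word.prod_cons]; simp [altProd]
    · exact CoprodI.Word.fstIdx_cons _ _ _ _
  | succ k ih =>
    obtain ⟨w, hw, hw'⟩ := ih hij.symm hb ha
    refine ⟨CoprodI.Word.cons a w (by rw [hw']; simpa using hij.symm) ha, ?_, ?_⟩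
    · rw [CoprodI.Word.prod_cons, hw]; rfl
    · exact CoprodI.Word.fstIdx_cons _ _ _ _

theorem altProd_of_ne {I : Type*} {M : I → Type*} [∀ i, Group (M i)] {i j : I} (hij : i ≠ j)
    {a : M i} {b : M j} (ha : a ≠ 1) (hb : b ≠ 1) {k : ℕ} (hk : k ≠ 0) :
    altProd (CoprodI.of a : CoprodI M) (CoprodI.of b) k ≠
      altProd (CoprodI.of b) (CoprodI.of a) k := by
  classical
  obtain ⟨k, rfl⟩ := Nat.exists_eq_succ_of_ne_zero hk
  obtain ⟨w, hw, hwi⟩ := exists_word_altProd hij ha hb k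
  obtain ⟨w', hw', hwj⟩ := exists_word_altProd hij.symm hb ha k
  intro e
  have : w = w' := CoprodI.Word.equiv.symm.injective (hw.trans (e.trans hw'.symm))
  rw [this, hwj] at hwi
  exact hij (Option.some.inj hwi).symm

end FreeProducts

section Presentation

open Monoid

variable {G : Type*} [Group G] {f : Subgroup G → G → G} {B : Set (Subgroup G)}

theorem exists_ne_one_of_ne_bot {H : Subgroup G} (h : H ≠ ⊥) : ∃ a ∈ H, a ≠ 1 := by
  by_contra! h'
  exact h ((Subgroup.eq_bot_iff_forall H).mpr h')

theorem IsRankTwo.apply_altProd {H L : Subgroup G} {m : ℕ} (h : IsRankTwo B f H L m)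
    (hf : IsRetractionSystem B f) (hH : H ∈ B) (hL : L ∈ B) {a b : G} (ha : a ∈ H) (hb : b ∈ L)
    (ha1 : a ≠ 1) (hb1 : b ≠ 1) :
    f H (altProd a b m) = a ∧ f L (altProd a b m) = b := by
  have hm := h.two_le
  obtain ⟨m, rfl⟩ : ∃ m', m = m' + 1 := ⟨m - 1, by omega⟩
  constructor
  · rw [altProd, hf.map_mul_left H hH a ha, h.apply_altProd_left a ha b hb ha1 hb1 m (by omega),
      mul_one]
  · rw [h.braid a ha b hb ha1 hb1, altProd, hf.map_mul_left L hL b hb,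
      h.apply_altProd_right a ha b hb ha1 hb1 m (by omega), mul_one]

/-- Without a braid relation, two members of `B` generate their free product. -/
theorem IsRetractionSystem.injective_lift (hf : IsRetractionSystem B f)
    {H L : Subgroup G} (hH : H ∈ B) (hL : L ∈ B) (hne : H ≠ L)
    (h : ¬ ∃ m, IsRankTwo B f H L m) :
    Function.Injective (Coprod.lift H.subtype L.subtype) := by
  classical
  have hsub : ({H, L} : Set (Subgroup G)) ⊆ B := by
    rintro M (rfl | rfl)
    · exact hH
    · exact hL
  have hf' := hf.mono hsub
  let ι : Subgroup G → G → Coprod H L := fun K g =>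
    if K = H then (if hg : g ∈ H then Coprod.inl ⟨g, hg⟩ else 1)
    else (if hg : g ∈ L then Coprod.inr ⟨g, hg⟩ else 1)
  have ιH : ∀ g (hg : g ∈ H), ι H g = Coprod.inl ⟨g, hg⟩ := fun g hg => by simp [ι, hg]
  have ιL : ∀ g (hg : g ∈ L), ι L g = Coprod.inr ⟨g, hg⟩ := fun g hg => by simp [ι, hg, hne.symm]
  refine hf'.injective_of_braid (ι := ι) ?_ ?_ _ ?_ ?_
  · rintro K (rfl | rfl) g hg g' hg'
    · rw [ιH _ hg, ιH _ hg', ιH _ (mul_mem hg hg'), ← map_mul]; rfl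
    · rw [ιL _ hg, ιL _ hg', ιL _ (mul_mem hg hg'), ← map_mul]; rfl
  · intro K hK M hM hKM m hm a ha b hb ha1 hb1
    exfalso
    obtain ⟨h1, h2⟩ := hm.apply_altProd hf' hK hM ha hb ha1 hb1
    have hmem : altProd a b m ∈ sSup B :=
      altProd_mem (le_sSup (hsub hK) ha) (le_sSup (hsub hM) hb) m
    have hr := hf.exists_isRankTwo (hsub hK) (hsub hM) hKM hmem (by rwa [h1]) (by rwa [h2])
    rcases hK with rfl | rfl <;> rcases hM with rfl | rfl
    · exact hKM rfl
    · exact h hr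
    · exact h (hr.imp fun m hm => hm.symm hf hL hH)
    · exact hKM rfl
  · rintro K (rfl | rfl) g hg
    · rw [ιH _ hg]; simp
    · rw [ιL _ hg]; simp
  · rw [eq_top_iff]
    intro x _
    induction x using Coprod.induction_on with
    | inl g => exact Subgroup.subset_closure ⟨H, Or.inl rfl, g, g.2, (ιH g g.2).symm⟩
    | inr g => exact Subgroup.subset_closure ⟨L, Or.inr rfl, g, g.2, (ιL g g.2).symm⟩
    | mul x y hx hy => exact mul_mem (hx trivial) (hy trivial)

theorem IsRankTwo.not_injective_lift {H L : Subgroup G} {m : ℕ} (h : IsRankTwo B f H L m)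
    (hH : H ≠ ⊥) (hL : L ≠ ⊥) : ¬ Function.Injective (Coprod.lift H.subtype L.subtype) := by
  intro hinj
  obtain ⟨a, ha, ha1⟩ := exists_ne_one_of_ne_bot hH
  obtain ⟨b, hb, hb1⟩ := exists_ne_one_of_ne_bot hL
  have e : altProd (Coprod.inl ⟨a, ha⟩ : Coprod H L) (Coprod.inr ⟨b, hb⟩) m =
      altProd (Coprod.inr ⟨b, hb⟩) (Coprod.inl ⟨a, ha⟩) m := by
    apply hinj
    simpa [map_altProd] using h.braid a ha b hb ha1 hb1
  let M : Bool → Subgroup G := fun i => if i then H else L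
  have e' := congrArg (Coprod.lift (CoprodI.of (M := fun i => M i) (i := true))
    (CoprodI.of (M := fun i => M i) (i := false))) e
  rw [map_altProd, map_altProd, Coprod.lift_apply_inl, Coprod.lift_apply_inr] at e'
  have h2 := h.two_le
  refine altProd_of_ne (M := fun i => M i) (i := true) (j := false) (by simp) ?_ ?_ (by omega) e'
  · intro h; exact ha1 (congrArg Subtype.val h)
  · intro h; exact hb1 (congrArg Subtype.val h)

theorem IsRetractionSystem.basisGraph_adj_iff (hf : IsRetractionSystem B f)
    (hnt : ∀ H ∈ B, H ≠ ⊥) (H L : B) :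
    (basisGraph B).Adj H L ↔ H ≠ L ∧ ∃ m, IsRankTwo B f H L m := by
  rw [basisGraph, SimpleGraph.fromRel_adj]
  refine and_congr_right fun hne => ?_
  have hne' : (H : Subgroup G) ≠ L := fun h => hne (Subtype.ext h)
  constructor
  · rintro (h | h)
    · by_contra hm
      exact h (hf.injective_lift H.2 L.2 hne' hm)
    · by_contra hm
      exact h (hf.injective_lift L.2 H.2 hne'.symm
        fun h => hm (h.imp fun m hm => hm.symm hf L.2 H.2))
  · rintro ⟨m, hm⟩
    exact Or.inl (hm.not_injective_lift (hnt H H.2) (hnt L L.2))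

/-- The length `m` in a braid relation is unique. -/
theorem IsRankTwo.unique {H L : Subgroup G} {m m' : ℕ} (h : IsRankTwo B f H L m)
    (h' : IsRankTwo B f H L m') (hf : IsRetractionSystem B f) (hH : H ∈ B) (hL : L ∈ B)
    (hH1 : H ≠ ⊥) (hL1 : L ≠ ⊥) : m = m' := by
  obtain ⟨a, ha, ha1⟩ := exists_ne_one_of_ne_bot hH1
  obtain ⟨b, hb, hb1⟩ := exists_ne_one_of_ne_bot hL1
  have h1 := (h.apply_altProd hf hH hL ha hb ha1 hb1).2
  have h2 := (h'.apply_altProd hf hH hL ha hb ha1 hb1).2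
  rcases lt_trichotomy m m' with hlt | rfl | hlt
  · exact absurd ((h'.apply_altProd_right a ha b hb ha1 hb1 m hlt).symm.trans h1) hb1.symm
  · rfl
  · exact absurd ((h.apply_altProd_right a ha b hb ha1 hb1 m' hlt).symm.trans h2) hb1.symm

/-- A group generated by a retraction system of non-trivial subgroups is a periagroup. -/
theorem IsRetractionSystem.isPeriagroupBasis (hf : IsRetractionSystem B f)
    (hnt : ∀ H ∈ B, H ≠ ⊥) (hgen : sSup B = ⊤) : IsPeriagroupBasis B := by
  classical
  refine ⟨hnt, ?_⟩
  have hlam : ∀ e : (basisGraph B).edgeSet, ∃ m, ∀ H L : B, e.1 = s(H, L) →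
      IsRankTwo B f H L m := by
    rintro ⟨e, he⟩
    induction e using Sym2.ind with
    | _ H L =>
      obtain ⟨-, m, hm⟩ := (hf.basisGraph_adj_iff hnt H L).mp he
      refine ⟨m, fun H' L' h => ?_⟩
      rcases Sym2.eq_iff.mp h with ⟨rfl, rfl⟩ | ⟨rfl, rfl⟩
      · exact hm
      · exact hm.symm hf H.2 L.2
  choose lam hlam using hlam
  have hl2 : ∀ H L (h : (basisGraph B).Adj H L), IsRankTwo B f H L (lam ⟨s(H, L), h⟩) :=
    fun H L h => hlam _ H L rfl
  refine ⟨lam, ⟨?_, fun H L h hlt => (hl2 H L h).card hlt⟩, ?_⟩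
  · rintro ⟨e, he⟩
    induction e using Sym2.ind with
    | _ H L => exact (hl2 H L he).two_le
  let ψ : CoprodI (fun H : B => H.1) →* G := CoprodI.lift fun H : B => H.1.subtype
  have hψ : ∀ (H : B) (h : H.1), ψ (CoprodI.of (i := H) h) = h := fun H h => by
    simp [ψ, CoprodI.lift_of]
  have hrel : Subgroup.normalClosure (periaRelators (basisGraph B) lam (fun H : B => H.1)) ≤
      ψ.ker := by
    refine Subgroup.normalClosure_le_normal ?_
    rintro r ⟨H, L, h, a, b, ha, hb, rfl⟩
    rw [SetLike.mem_coe, MonoidHom.mem_ker, map_mul, map_inv, mul_inv_eq_one, map_altProd,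
      map_altProd, hψ, hψ]
    exact (hl2 H L h).braid a a.2 b b.2 (fun e => ha (Subtype.ext e)) (fun e => hb (Subtype.ext e))
  let φ : Periagroup (basisGraph B) lam (fun H : B => H.1) →* G := QuotientGroup.lift _ ψ hrel
  have hφ : ∀ (H : B) (h : H.1), φ (QuotientGroup.mk (CoprodI.of (i := H) h)) = h := hψ
  have hsurj : Function.Surjective φ := by
    rw [← MonoidHom.range_eq_top, eq_top_iff, ← hgen, sSup_le_iff]
    intro H hH h hh
    exact ⟨_, hφ ⟨H, hH⟩ ⟨h, hh⟩⟩
  -- the copies of the members of `B` in the periagroup, with the junk value `1` elsewhere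
  let ι : Subgroup G → G → Periagroup (basisGraph B) lam (fun H : B => H.1) := fun H g =>
    if h : H ∈ B ∧ g ∈ H then QuotientGroup.mk (CoprodI.of (i := (⟨H, h.1⟩ : B)) ⟨g, h.2⟩) else 1
  have hι : ∀ (H : Subgroup G) (hH : H ∈ B) (g : G) (hg : g ∈ H),
      ι H g = QuotientGroup.mk (CoprodI.of (i := (⟨H, hH⟩ : B)) ⟨g, hg⟩) := by
    intro H hH g hg
    simp [ι, hH, hg]
  have hinj : Function.Injective φ := by
    refine hf.injective_of_braid (ι := ι) ?_ ?_ φ ?_ ?_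
    · intro H hH g hg g' hg'
      rw [hι H hH g hg, hι H hH g' hg', hι H hH _ (mul_mem hg hg'), ← QuotientGroup.mk_mul,
        ← map_mul]
      rfl
    · intro H hH L hL hne m hm a ha b hb ha1 hb1
      have hadj : (basisGraph B).Adj ⟨H, hH⟩ ⟨L, hL⟩ :=
        (hf.basisGraph_adj_iff hnt _ _).mpr ⟨fun e => hne (congrArg Subtype.val e), m, hm⟩
      obtain rfl := hm.unique (hl2 _ _ hadj) hf hH hL (hnt H hH) (hnt L hL)
      rw [hι H hH a ha, hι L hL b hb]
      have := QuotientGroup.eq_one_iff (N := Subgroup.normalClosure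
        (periaRelators (basisGraph B) lam (fun H : B => H.1))) _ |>.mpr
          (Subgroup.subset_normalClosure
          ⟨_, _, hadj, ⟨a, ha⟩, ⟨b, hb⟩, fun e => ha1 (congrArg Subtype.val e),
            fun e => hb1 (congrArg Subtype.val e), rfl⟩)
      rw [QuotientGroup.mk_mul, QuotientGroup.mk_inv, mul_inv_eq_one] at this
      have hmk := fun x y k => map_altProd (QuotientGroup.mk' (Subgroup.normalClosure
        (periaRelators (basisGraph B) lam (fun H : B => H.1)))) x y k
      simp only [QuotientGroup.mk'_apply] at hmk
      rwa [hmk, hmk] at this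
    · intro H hH h hh
      rw [hι H hH h hh, hφ]
    · rw [eq_top_iff]
      intro x _
      obtain ⟨x, rfl⟩ := QuotientGroup.mk_surjective x
      induction x using CoprodI.induction_on with
      | one => exact one_mem _
      | of H h => exact Subgroup.subset_closure ⟨H, H.2, h, h.2, (hι H H.2 h h.2).symm⟩
      | mul x y hx hy => rw [QuotientGroup.mk_mul]; exact mul_mem (hx trivial) (hy trivial)
  exact ⟨MulEquiv.ofBijective φ ⟨hinj, hsurj⟩, hφ⟩

end Presentation

/-! ### Periagroups have retraction systems -/

section SectorAction

variable {G : Type*} [Group G]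

open scoped Classical in
/-- The action of `h ∈ H` on the pairs `(K, k)`, where the pair stands for the sector with label `k`
of the wall stabilised by `K`: elements of `H` multiply the labels of the wall stabilised by `H`,
and act by conjugation on all other pairs. -/
noncomputable def sectorMap (H : Subgroup G) (h : G) (x : Subgroup G × G) : Subgroup G × G :=
  if x.1 = H then (H, h * x.2) else (conjSubgroup h x.1, h * x.2 * h⁻¹)

theorem sectorMap_self (H : Subgroup G) (h k : G) : sectorMap H h (H, k) = (H, h * k) :=
  if_pos rfl

theorem sectorMap_of_ne {H K : Subgroup G} (hne : K ≠ H) (h k : G) :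
    sectorMap H h (K, k) = (conjSubgroup h K, h * k * h⁻¹) :=
  if_neg hne

/-- The action of `H` on the sectors. -/
noncomputable def sectorHom (H : Subgroup G) : H →* Equiv.Perm (Subgroup G × G) :=
  MonoidHom.toHomPerm
    { toFun := fun h => sectorMap H h
      map_one' := by
        funext ⟨K, k⟩
        change sectorMap H (1 : G) (K, k) = (K, k)
        by_cases hK : K = H
        · rw [hK, sectorMap_self, one_mul]
        · rw [sectorMap_of_ne hK, conjSubgroup_one]; simp
      map_mul' := by
        intro h h'
        funext ⟨K, k⟩
        change sectorMap H (h * h' : G) (K, k) = sectorMap H h (sectorMap H h' (K, k))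
        by_cases hK : K = H
        · rw [hK, sectorMap_self, sectorMap_self, sectorMap_self, mul_assoc]
        · have hK' : conjSubgroup (h' : G) K ≠ H := fun e => hK (by
            apply conjSubgroup_injective (h' : G)
            rw [e, conjSubgroup_of_mem h'.2])
          rw [sectorMap_of_ne hK, sectorMap_of_ne hK, sectorMap_of_ne hK', conjSubgroup_mul]
          simp [mul_assoc] }

theorem sectorHom_self (H : Subgroup G) (h : H) (k : G) : sectorHom H h (H, k) = (H, h * k) :=
  sectorMap_self H h k

theorem sectorHom_of_ne {H K : Subgroup G} (hne : K ≠ H) (h : H) (k : G) :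
    sectorHom H h (K, k) = (conjSubgroup (h : G) K, h * k * (h : G)⁻¹) :=
  sectorMap_of_ne hne h k

theorem sectorHom_fst (H : Subgroup G) (h : H) (x : Subgroup G × G) :
    (sectorHom H h x).1 = conjSubgroup (h : G) x.1 := by
  rcases x with ⟨K, k⟩
  by_cases hK : K = H
  · rw [hK, sectorHom_self, conjSubgroup_of_mem h.2]
  · rw [sectorHom_of_ne hK]

open scoped Classical in
/-- The change of label caused by the reflection `t` at the wall stabilised by `K`. -/
noncomputable def reflectionLabel (K : Subgroup G) (t : G) : G :=
  if Subgroup.zpowers t = K then t else 1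

theorem commute_reflectionLabel (K : Subgroup G) (t t' : G) :
    Commute (reflectionLabel K t) (reflectionLabel K t') := by
  unfold reflectionLabel
  split_ifs with h h'
  · obtain ⟨n, hn⟩ : t' ∈ Subgroup.zpowers t := by
      rw [h, ← h']; exact Subgroup.mem_zpowers t'
    rw [← hn]
    exact Commute.self_zpow t n
  all_goals simp

theorem zpowers_conj (c t : G) :
    Subgroup.zpowers (c * t * c⁻¹) = conjSubgroup c (Subgroup.zpowers t) := by
  rw [conjSubgroup, MonoidHom.map_zpowers]
  simp

theorem reflectionLabel_conj (K : Subgroup G) (c t : G) :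
    reflectionLabel (conjSubgroup c K) (c * t * c⁻¹) = c * reflectionLabel K t * c⁻¹ := by
  unfold reflectionLabel
  by_cases h : Subgroup.zpowers t = K
  · rw [if_pos h, if_pos (by rw [zpowers_conj, h])]
  · rw [if_neg h, if_neg]
    · simp
    · rw [zpowers_conj]
      exact fun e => h (conjSubgroup_injective c e)

theorem sectorHom_eq_reflectionLabel {H : Subgroup G} (c : H) (hc : Subgroup.zpowers (c : G) = H)
    (K : Subgroup G) (k : G) : sectorHom H c (K, k) =
      (conjSubgroup (c : G) K, c * (k * reflectionLabel K (c : G)) * (c : G)⁻¹) := by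
  by_cases hK : K = H
  · rw [hK, sectorHom_self, conjSubgroup_of_mem c.2, reflectionLabel, if_pos hc]
    simp [mul_assoc]
  · rw [sectorHom_of_ne hK, reflectionLabel, if_neg (fun h => hK (h.symm.trans hc)), mul_one]

/-- An alternating product of two reflections changes the labels by the reflections
`(c d) ^ i c` at the walls it crosses. -/
theorem altProd_inv_apply {c d : G} (hc : c⁻¹ = c) (hd : d⁻¹ = d)
    {p q : Equiv.Perm (Subgroup G × G)} (hp : p⁻¹ = p) (hq : q⁻¹ = q)
    (hpc : ∀ K k, p (K, k) = (conjSubgroup c K, c * (k * reflectionLabel K c) * c⁻¹))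
    (hqd : ∀ K k, q (K, k) = (conjSubgroup d K, d * (k * reflectionLabel K d) * d⁻¹))
    (j : ℕ) (K : Subgroup G) (k : G) :
    (altProd p q j)⁻¹ (K, k) = (conjSubgroup (altProd c d j)⁻¹ K, (altProd c d j)⁻¹ *
      (k * ((List.range j).map fun i => reflectionLabel K ((c * d) ^ i * c)).prod) *
        altProd c d j) := by
  induction j generalizing c d p q K k with
  | zero => simp [altProd, conjSubgroup_one]
  | succ j ih =>
    have e1 : (altProd p q (j + 1))⁻¹ = (altProd q p j)⁻¹ * p := by
      rw [altProd, mul_inv_rev, hp]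
    have e2 : altProd c d (j + 1) = c⁻¹ * altProd d c j := by rw [altProd, hc]
    have e3 : ∀ i, reflectionLabel (conjSubgroup c K) ((d * c) ^ i * d) =
        MulAut.conj c (reflectionLabel K ((c * d) ^ (i + 1) * c)) := by
      intro i
      rw [MulAut.conj_apply, ← reflectionLabel_conj]
      congr 1
      have hsc : d * (c * d) ^ i = (d * c) ^ i * d :=
        (SemiconjBy.pow_right (by simp [SemiconjBy, mul_assoc] : SemiconjBy d (c * d) (d * c)) i).eq
      have hcc : c * c = 1 := by nth_rewrite 1 [← hc]; exact inv_mul_cancel c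
      rw [← hsc, pow_succ', ← one_mul (d * (c * d) ^ i), ← hcc]
      simp only [mul_assoc, mul_inv_cancel, mul_one]
    rw [e1, Equiv.Perm.mul_apply, hpc, ih hd hc hq hp hqd hpc, e2, List.range_succ_eq_map,
      List.map_cons, List.prod_cons, List.map_map]
    refine Prod.ext ?_ ?_
    · simp [conjSubgroup_mul]
    · simp only [e3]
      have : ((List.range j).map fun i =>
          MulAut.conj c (reflectionLabel K ((c * d) ^ (i + 1) * c))).prod = 
          c * ((List.range j).map ((fun i => reflectionLabel K ((c * d) ^ i * c)) ∘ Nat.succ)).prod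
            * c⁻¹ := by
        rw [← MulAut.conj_apply, map_list_prod, List.map_map]; rfl
      rw [this]
      simp [mul_assoc]

theorem altProd_mul_altProd_inv {c d : G} (hc : c⁻¹ = c) (hd : d⁻¹ = d) (k : ℕ) :
    altProd c d k * (altProd d c k)⁻¹ = (c * d) ^ k := by
  induction k generalizing c d with
  | zero => simp [altProd]
  | succ k ih =>
    have hsc : c * (d * c) ^ k = (c * d) ^ k * c :=
      (SemiconjBy.pow_right (by simp [SemiconjBy, mul_assoc] : SemiconjBy c (d * c) (c * d)) k).eq
    rw [altProd, altProd, mul_inv_rev, hd, mul_assoc, ← mul_assoc (altProd d c k), ih hd hc,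
      ← mul_assoc, hsc, pow_succ, mul_assoc]

/-- The braid relation of length `m` between reflections `c` and `d` holds in the action on the
sectors: its two sides cross the same walls, in opposite orders. -/
theorem altProd_eq_of_reflections {c d : G} (hc : c⁻¹ = c) (hd : d⁻¹ = d)
    {p q : Equiv.Perm (Subgroup G × G)} (hp : p⁻¹ = p) (hq : q⁻¹ = q)
    (hpc : ∀ K k, p (K, k) = (conjSubgroup c K, c * (k * reflectionLabel K c) * c⁻¹))
    (hqd : ∀ K k, q (K, k) = (conjSubgroup d K, d * (k * reflectionLabel K d) * d⁻¹))
    {m : ℕ} (hm : altProd c d m = altProd d c m) : altProd p q m = altProd q p m := by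
  have hpow : (c * d) ^ m = 1 := by
    rw [← altProd_mul_altProd_inv hc hd, hm, mul_inv_cancel]
  rw [← inv_inj]
  ext1 ⟨K, k⟩
  -- the lists of reflections of the two sides are the reverse of each other, because
  -- `(d c) ^ i d = (c d) ^ (m - 1 - i) c` follows from `(c d) ^ m = 1`
  rw [altProd_inv_apply hc hd hp hq hpc hqd, altProd_inv_apply hd hc hq hp hqd hpc, hm]
  have hrev : ((List.range m).map fun i => reflectionLabel K ((d * c) ^ i * d)) =
      ((List.range m).map fun i => reflectionLabel K ((c * d) ^ i * c)).reverse := by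
    refine List.ext_getElem (by simp) fun i h1 h2 => ?_
    have him : i < m := by simpa using h1
    simp only [List.getElem_map, List.getElem_range, List.getElem_reverse, List.length_map,
      List.length_range]
    congr 1
    have e1 : d * c = (c * d)⁻¹ := by rw [mul_inv_rev, hc, hd]
    have e2 : (c * d) ^ (m - 1 - i) * (c * d) ^ (i + 1) = 1 := by
      rw [← pow_add, show m - 1 - i + (i + 1) = m by omega, hpow]
    rw [eq_inv_of_mul_eq_one_left e2, e1, inv_pow, pow_succ', mul_inv_rev, mul_inv_rev, hc, hd]
    have hcc : c * c = 1 := by nth_rewrite 1 [← hc]; exact inv_mul_cancel c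
    rw [mul_assoc, mul_assoc, hcc, mul_one]
  rw [hrev, (List.reverse_perm _).prod_eq']
  rw [List.pairwise_reverse, List.pairwise_map]
  exact List.pairwise_of_forall fun i j => commute_reflectionLabel K _ _

end SectorAction

section PeriagroupRetractions

open Monoid

variable {G : Type*} [Group G] {B : Set (Subgroup G)}

theorem eq_one_or_eq_of_card_eq_two {H : Subgroup G} (hH : Nat.card H = 2) {a : G} (ha : a ∈ H)
    (ha1 : a ≠ 1) : ∀ h ∈ H, h = 1 ∨ h = a := by
  obtain ⟨x, y, hxy, huniv⟩ := Nat.card_eq_two_iff.mp hH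
  have hmem : ∀ z : H, z = x ∨ z = y := fun z => by
    have : z ∈ ({x, y} : Set H) := huniv ▸ Set.mem_univ z
    simpa using this
  intro h hh
  have h1 := hmem 1
  have h2 := hmem ⟨a, ha⟩
  have h3 := hmem ⟨h, hh⟩
  have h4 : (⟨a, ha⟩ : H) ≠ 1 := fun e => ha1 (congrArg Subtype.val e)
  have h5 : (⟨h, hh⟩ : H) = 1 ∨ (⟨h, hh⟩ : H) = ⟨a, ha⟩ := by
    rcases h1 with h1 | h1 <;> rcases h2 with h2 | h2 <;> rcases h3 with h3 | h3 <;> simp_all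
  exact h5.imp (congrArg Subtype.val) (congrArg Subtype.val)

theorem inv_eq_self_of_card_eq_two {H : Subgroup G} (hH : Nat.card H = 2) {a : G} (ha : a ∈ H)
    (ha1 : a ≠ 1) : a⁻¹ = a :=
  (eq_one_or_eq_of_card_eq_two hH ha ha1 _ (inv_mem ha)).resolve_left (by simpa using ha1)

theorem zpowers_eq_of_card_eq_two {H : Subgroup G} (hH : Nat.card H = 2) {a : G} (ha : a ∈ H)
    (ha1 : a ≠ 1) : Subgroup.zpowers a = H := by
  refine le_antisymm (by simpa using ha) fun h hh => ?_
  rcases eq_one_or_eq_of_card_eq_two hH ha ha1 h hh with rfl | rfl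
  · exact one_mem _
  · exact Subgroup.mem_zpowers _

theorem IsPeriagroupBasis.sSup_eq_top (h : IsPeriagroupBasis B) : sSup B = ⊤ := by
  obtain ⟨-, lam, -, φ, hφ⟩ := h
  rw [eq_top_iff]
  intro g _
  obtain ⟨x, rfl⟩ := φ.surjective g
  obtain ⟨x, rfl⟩ := QuotientGroup.mk_surjective x
  induction x using CoprodI.induction_on with
  | one => rw [QuotientGroup.mk_one, map_one]; exact one_mem _
  | of H h => rw [hφ]; exact le_sSup H.2 h.2
  | mul x y hx hy => rw [QuotientGroup.mk_mul, map_mul]; exact mul_mem (hx trivial) (hy trivial)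

/-- The action on the sectors of the members of `B` extends to the whole periagroup. -/
theorem IsPeriagroupBasis.exists_sectorAction (h : IsPeriagroupBasis B) :
    ∃ σ : G →* Equiv.Perm (Subgroup G × G), ∀ H ∈ B, ∀ h : H, σ h = sectorHom H h := by
  obtain ⟨hnt, lam, ⟨hlam, hcard⟩, φ, hφ⟩ := h
  let ψ : CoprodI (fun H : B => H.1) →* Equiv.Perm (Subgroup G × G) :=
    CoprodI.lift fun H : B => sectorHom H.1
  have hψ : ∀ (H : B) (h : H.1), ψ (CoprodI.of (i := H) h) = sectorHom H.1 h := fun H h => by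
    simp [ψ, CoprodI.lift_of]
  have hbraid : ∀ (H L : B) (hHL : (basisGraph B).Adj H L) (a : H.1) (b : L.1), a ≠ 1 → b ≠ 1 →
      altProd (a : G) b (lam ⟨s(H, L), hHL⟩) = altProd (b : G) a (lam ⟨s(H, L), hHL⟩) := by
    intro H L hHL a b ha hb
    have := QuotientGroup.eq_one_iff (N := Subgroup.normalClosure
      (periaRelators (basisGraph B) lam (fun H : B => H.1))) _ |>.mpr
        (Subgroup.subset_normalClosure ⟨H, L, hHL, a, b, ha, hb, rfl⟩)
    have := congrArg φ this
    rw [QuotientGroup.mk_mul, QuotientGroup.mk_inv, map_mul, map_inv, map_one,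
      mul_inv_eq_one] at this
    have hmk := fun x y k => map_altProd (φ.toMonoidHom.comp (QuotientGroup.mk'
      (Subgroup.normalClosure (periaRelators (basisGraph B) lam (fun H : B => H.1))))) x y k
    simp only [MonoidHom.comp_apply, QuotientGroup.mk'_apply, MulEquiv.coe_toMonoidHom] at hmk
    rwa [hmk, hmk, hφ, hφ] at this
  have hrel : Subgroup.normalClosure (periaRelators (basisGraph B) lam (fun H : B => H.1)) ≤
      ψ.ker := by
    refine Subgroup.normalClosure_le_normal ?_
    rintro r ⟨H, L, hHL, a, b, ha, hb, rfl⟩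
    rw [SetLike.mem_coe, MonoidHom.mem_ker, map_mul, map_inv, mul_inv_eq_one, map_altProd,
      map_altProd, hψ, hψ]
    have ha1 : (a : G) ≠ 1 := fun e => ha (Subtype.ext e)
    have hb1 : (b : G) ≠ 1 := fun e => hb (Subtype.ext e)
    have hab := hbraid H L hHL a b ha hb
    -- a label larger than two is a braid relation between reflections; for the label two, the
    -- subgroups `H` and `L` commute
    rcases (hlam ⟨s(H, L), hHL⟩).lt_or_eq with hlt | heq
    · obtain ⟨hH, hL⟩ := hcard H L hHL hlt
      have hai := inv_eq_self_of_card_eq_two hH a.2 ha1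
      have hbi := inv_eq_self_of_card_eq_two hL b.2 hb1
      refine altProd_eq_of_reflections hai hbi ?_ ?_
        (sectorHom_eq_reflectionLabel a (zpowers_eq_of_card_eq_two hH a.2 ha1))
        (sectorHom_eq_reflectionLabel b (zpowers_eq_of_card_eq_two hL b.2 hb1)) hab
      · rw [← map_inv]; congr 1; exact Subtype.ext hai
      · rw [← map_inv]; congr 1; exact Subtype.ext hbi
    · have hcomm : ∀ (a : H.1) (b : L.1), (a : G) * b = b * a := by
        intro a b
        by_cases ha : a = 1
        · simp [ha]
        by_cases hb : b = 1
        · simp [hb]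
        have := hbraid H L hHL a b ha hb
        rw [← heq] at this
        simpa [altProd] using this
      have hne : H.1 ≠ L.1 := fun e => hHL.ne (Subtype.ext e)
      have hconj : ∀ (H L : Subgroup G), (∀ (a : H) (b : L), (a : G) * b = b * a) → ∀ a : H,
          conjSubgroup (a : G) L = L := by
        intro H L hc a
        ext x
        rw [mem_conjSubgroup]
        constructor
        · intro hx
          have h1 := hc a ⟨_, hx⟩
          have h2 : x = (a : G)⁻¹ * x * a := by
            calc x = (a * ((a : G)⁻¹ * x * a)) * (a : G)⁻¹ := by group
              _ = _ := by rw [h1]; group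
          rw [h2]; exact hx
        · intro hx
          have h1 := hc a ⟨x, hx⟩
          have h2 : (a : G)⁻¹ * x * a = x := by
            rw [mul_assoc, ← h1]; group
          rwa [h2]
      have hHa := hconj H.1 L.1 hcomm a
      have hLb := hconj L.1 H.1 (fun b a => (hcomm a b).symm) b
      have hab' : (a : G) * b = b * a := hcomm a b
      rw [← heq]
      simp only [altProd, mul_one]
      ext1 ⟨K, k⟩
      rw [Equiv.Perm.mul_apply, Equiv.Perm.mul_apply]
      by_cases hKL : K = L.1
      · subst hKL
        rw [sectorHom_self, sectorHom_of_ne hne.symm, sectorHom_of_ne hne.symm, hHa,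
          sectorHom_self]
        simp only [← mul_assoc, hab']
      · by_cases hKH : K = H.1
        · subst hKH
          rw [sectorHom_self, sectorHom_of_ne hne, sectorHom_of_ne hne, hLb, sectorHom_self]
          simp only [← mul_assoc, hab']
        · have h1 : conjSubgroup (b : G) K ≠ H.1 := fun e => hKH (by
            apply conjSubgroup_injective (b : G); rw [e, hLb])
          have h2 : conjSubgroup (a : G) K ≠ L.1 := fun e => hKL (by
            apply conjSubgroup_injective (a : G); rw [e, hHa])
          rw [sectorHom_of_ne hKL, sectorHom_of_ne hKH, sectorHom_of_ne h1, sectorHom_of_ne h2,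
            ← conjSubgroup_mul, ← conjSubgroup_mul, hab']
          refine Prod.ext rfl ?_
          calc (a : G) * (b * k * (b : G)⁻¹) * (a : G)⁻¹ = (a * b) * k * ((a : G) * b)⁻¹ := by group
            _ = (b * a) * k * ((b : G) * a)⁻¹ := by rw [hab']
            _ = _ := by group
  refine ⟨(QuotientGroup.lift _ ψ hrel).comp φ.symm.toMonoidHom, fun H hH h => ?_⟩
  have e : φ.symm (h : G) = QuotientGroup.mk (CoprodI.of (i := (⟨H, hH⟩ : B)) h) := by
    rw [MulEquiv.symm_apply_eq]; exact (hφ ⟨H, hH⟩ h).symm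
  rw [MonoidHom.comp_apply, MulEquiv.coe_toMonoidHom, e]
  exact hψ ⟨H, hH⟩ h

/-- A basis of a periagroup has a retraction system: `f H x` is the label of the sector obtained by
applying `x` to the sector with label `1` of the wall stabilised by `x⁻¹ H x`. -/
theorem IsPeriagroupBasis.exists_isRetractionSystem (h : IsPeriagroupBasis B) :
    ∃ f, IsRetractionSystem B f := by
  obtain ⟨σ, hσ⟩ := h.exists_sectorAction
  have hgen := h.sSup_eq_top
  have hfst : ∀ (g : G) (x : Subgroup G × G), (σ g x).1 = conjSubgroup g x.1 := by
    intro g x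
    obtain ⟨n, hn⟩ := exists_isWord_of_mem_sSup (hgen ▸ Subgroup.mem_top g : g ∈ sSup B)
    induction hn generalizing x with
    | one => simp [conjSubgroup_one]
    | @snoc n y s L _ hL hs ih =>
      rw [map_mul, Equiv.Perm.mul_apply, ih, hσ L hL ⟨s, hs⟩, sectorHom_fst, conjSubgroup_mul]
  -- the sector of `x⁻¹ H x` which contains `1` is mapped to a sector of `H` by `x`
  let f : Subgroup G → G → G := fun H x => (σ x (conjSubgroup x⁻¹ H, 1)).2
  have hpair : ∀ H x, σ x (conjSubgroup x⁻¹ H, 1) = (H, f H x) := by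
    intro H x
    refine Prod.ext ?_ rfl
    rw [hfst, ← conjSubgroup_mul, mul_inv_cancel, conjSubgroup_one]
  have hone : ∀ H, f H 1 = 1 := fun H => by simp [f]
  have hleft : ∀ H ∈ B, ∀ h ∈ H, ∀ x, f H (h * x) = h * f H x := by
    intro H hH h hh x
    have e : conjSubgroup (h * x)⁻¹ H = conjSubgroup x⁻¹ H := by
      rw [mul_inv_rev, conjSubgroup_mul, conjSubgroup_of_mem (inv_mem hh)]
    change (σ (h * x) (conjSubgroup (h * x)⁻¹ H, 1)).2 = _
    rw [e, map_mul, Equiv.Perm.mul_apply, hpair, hσ H hH ⟨h, hh⟩, sectorHom_self]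
  have hright : ∀ H ∈ B, ∀ L ∈ B, ∀ x, ∀ l ∈ L, conjSubgroup x L ≠ H → f H (x * l) = f H x := by
    intro H hH L hL x l hl hne
    have hne' : conjSubgroup (x * l)⁻¹ H ≠ L := by
      rintro e
      apply hne
      rw [← conjSubgroup_of_mem hl, ← conjSubgroup_mul, ← e, ← conjSubgroup_mul, mul_inv_cancel,
        conjSubgroup_one]
    change (σ (x * l) (conjSubgroup (x * l)⁻¹ H, 1)).2 = _
    rw [map_mul, Equiv.Perm.mul_apply, hσ L hL ⟨l, hl⟩, sectorHom_of_ne hne',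
      ← conjSubgroup_mul, mul_inv_rev, mul_inv_cancel_left, mul_one, mul_inv_cancel]
  refine ⟨f, ?_, fun H _ => hone H, hleft, hright⟩
  intro H hH x
  obtain ⟨n, hn⟩ := exists_isWord_of_mem_sSup (hgen ▸ Subgroup.mem_top x : x ∈ sSup B)
  induction hn with
  | one => rw [hone]; exact one_mem _
  | @snoc n y s L _ hL hs ih =>
    by_cases hc : conjSubgroup y L = H
    · have hk : y * s * y⁻¹ ∈ H := by
        rw [← hc, mem_conjSubgroup]; simpa [mul_assoc] using hs
      have e : y * s = (y * s * y⁻¹) * y := by group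
      rw [e, hleft H hH _ hk]
      exact mul_mem hk ih
    · rw [hright H hH L hL y s hs hc]; exact ih

end PeriagroupRetractions

/-! ### The Cayley graph of a retraction system is a rotation system -/

section CayleyRotation

variable {G : Type*} [Group G] {B : Set (Subgroup G)} {f : Subgroup G → G → G}

theorem cayleyGraph_adj {x y : G} :
    (cayleyGraph B).Adj x y ↔ x ≠ y ∧ ∃ H ∈ B, x⁻¹ * y ∈ H := by
  rw [cayleyGraph, SimpleGraph.mulCayley_adj']
  refine and_congr_right fun _ => ?_
  constructor
  · rintro ⟨g, ⟨H, hH, hg⟩, h | h⟩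
    · exact ⟨H, hH, by rw [← h, inv_mul_cancel_left]; exact hg⟩
    · exact ⟨H, hH, by rw [h, mul_inv_rev, inv_mul_cancel_right]; exact inv_mem hg⟩
  · rintro ⟨H, hH, h⟩
    exact ⟨_, ⟨H, hH, h⟩, Or.inl (by group)⟩

theorem cayleyGraph_adj_mul {H : Subgroup G} (hH : H ∈ B) (x : G) {h : G} (hh : h ∈ H)
    (h1 : h ≠ 1) : (cayleyGraph B).Adj x (x * h) :=
  cayleyGraph_adj.mpr ⟨by simpa using h1, H, hH, by simpa using hh⟩

theorem exists_walk_of_isWord {n : ℕ} {g : G} (hg : IsWord B n g) (x : G) :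
    ∃ p : (cayleyGraph B).Walk x (x * g), p.length ≤ n := by
  induction hg with
  | one => exact ⟨SimpleGraph.Walk.nil.copy rfl (mul_one x).symm, by simp⟩
  | @snoc n y s L _ hL hs ih =>
    obtain ⟨p, hp⟩ := ih
    by_cases h1 : s = 1
    · exact ⟨p.copy rfl (by rw [h1, mul_one]), by simpa using Nat.le_succ_of_le hp⟩
    · have := cayleyGraph_adj_mul hL (x * y) hs h1
      rw [mul_assoc] at this
      exact ⟨p.concat this, by simpa using hp⟩

theorem isWord_of_walk {x y : G} (p : (cayleyGraph B).Walk x y) : IsWord B p.length (x⁻¹ * y) := by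
  induction p with
  | nil => simpa using IsWord.one
  | @cons x z y h p ih =>
    obtain ⟨-, H, hH, hs⟩ := cayleyGraph_adj.mp h
    have := ih.cons hH hs
    simpa [mul_assoc] using this

theorem cayleyGraph_connected (hgen : sSup B = ⊤) : (cayleyGraph B).Connected := by
  rw [SimpleGraph.connected_iff]
  refine ⟨fun x y => ?_, ⟨1⟩⟩
  obtain ⟨n, hn⟩ := exists_isWord_of_mem_sSup (hgen ▸ Subgroup.mem_top (x⁻¹ * y))
  obtain ⟨p, -⟩ := exists_walk_of_isWord hn x
  exact ⟨p.copy rfl (by group)⟩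

theorem cayleyGraph_dist (hgen : sSup B = ⊤) (x y : G) :
    (cayleyGraph B).dist x y = wordLength B (x⁻¹ * y) := by
  refine le_antisymm ?_ ?_
  · obtain ⟨p, hp⟩ := exists_walk_of_isWord
      (isWord_wordLength (hgen ▸ Subgroup.mem_top (x⁻¹ * y) : x⁻¹ * y ∈ sSup B)) x
    have := SimpleGraph.dist_le (p.copy rfl (mul_inv_cancel_left x y))
    rw [SimpleGraph.Walk.length_copy] at this
    exact this.trans hp
  · obtain ⟨p, hp⟩ := (cayleyGraph_connected hgen).exists_walk_length_eq_dist x y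
    rw [← hp]
    exact wordLength_le (isWord_of_walk p)

/-- The coset `x H`, as a set of vertices of the Cayley graph. -/
def cosetSet (x : G) (H : Subgroup G) : Set G := {y | x⁻¹ * y ∈ H}

theorem mem_cosetSet {x y : G} {H : Subgroup G} : y ∈ cosetSet x H ↔ x⁻¹ * y ∈ H := Iff.rfl

theorem mem_cosetSet_self (x : G) (H : Subgroup G) : x ∈ cosetSet x H := by
  simp [cosetSet, one_mem]

theorem cosetSet_isClique {H : Subgroup G} (hH : H ∈ B) (x : G) :
    (cayleyGraph B).IsClique (cosetSet x H) := by
  intro y hy z hz hne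
  refine cayleyGraph_adj.mpr ⟨hne, H, hH, ?_⟩
  have := mul_mem (inv_mem (mem_cosetSet.mp hy)) (mem_cosetSet.mp hz)
  simpa [mul_assoc] using this

/-- The vertices of a triangle lie in a single coset: the wall of an edge has to be crossed by
another edge of the triangle. -/
theorem IsRetractionSystem.mem_of_triangle (hf : IsRetractionSystem B f) {x a b : G}
    {H : Subgroup G} (hH : H ∈ B) (ha : x⁻¹ * a ∈ H) (hxa : x ≠ a)
    (hxb : (cayleyGraph B).Adj x b) (hab : (cayleyGraph B).Adj a b) : x⁻¹ * b ∈ H := by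
  obtain ⟨hxb1, K, hK, hb⟩ := cayleyGraph_adj.mp hxb
  obtain ⟨-, L, hL, hl⟩ := cayleyGraph_adj.mp hab
  have ha1 : x⁻¹ * a ≠ 1 := fun e => hxa (inv_mul_eq_one.mp e)
  have hb1 : x⁻¹ * b ≠ 1 := fun e => hxb1 (inv_mul_eq_one.mp e)
  have e : x⁻¹ * b = (x⁻¹ * a) * (a⁻¹ * b) := by group
  by_cases hLH : L = H
  · subst hLH
    rw [e]; exact mul_mem ha hl
  · by_contra hbH
    have hKH : K ≠ H := by rintro rfl; exact hbH hb
    have h1 := hf.apply_of_mem_of_ne hH hK hKH hb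
    have hc : conjSubgroup (x⁻¹ * a) L ≠ H := fun h => hLH (by
      apply conjSubgroup_injective (x⁻¹ * a)
      rw [h, conjSubgroup_of_mem ha])
    rw [e, hf.map_mul_right H hH L hL _ _ hl hc, hf.apply_of_mem hH ha] at h1
    exact ha1 h1

theorem IsRetractionSystem.isMaxClique_iff (hf : IsRetractionSystem B f) (hnt : ∀ H ∈ B, H ≠ ⊥)
    (hB : B.Nonempty) {C : Set G} :
    IsMaxClique (cayleyGraph B) C ↔ ∃ x, ∃ H ∈ B, C = cosetSet x H := by
  constructor
  · intro hC
    obtain ⟨H₀, hH₀⟩ := hB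
    have hne : C.Nonempty := by
      by_contra he
      rw [Set.not_nonempty_iff_eq_empty] at he
      have := hC.eq_of_subset (cosetSet_isClique hH₀ 1) (by simp [he])
      rw [he] at this
      exact (this ▸ mem_cosetSet_self 1 H₀ : (1 : G) ∈ (∅ : Set G))
    obtain ⟨x, hx⟩ := hne
    by_cases hsing : ∃ a ∈ C, x ≠ a
    · obtain ⟨a, ha, hxa⟩ := hsing
      obtain ⟨-, H, hH, hh⟩ := cayleyGraph_adj.mp (hC.prop hx ha hxa)
      refine ⟨x, H, hH, hC.eq_of_subset (cosetSet_isClique hH x) fun b hb => ?_⟩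
      by_cases hxb : x = b
      · subst hxb; exact mem_cosetSet_self x H
      by_cases hab : a = b
      · subst hab; exact hh
      · exact hf.mem_of_triangle hH hh hxa (hC.prop hx hb hxb) (hC.prop ha hb hab)
    · push Not at hsing
      refine ⟨x, H₀, hH₀, hC.eq_of_subset (cosetSet_isClique hH₀ x) fun b hb => ?_⟩
      rw [← hsing b hb]
      exact mem_cosetSet_self x H₀
  · rintro ⟨x, H, hH, rfl⟩
    refine ⟨cosetSet_isClique hH x, fun D hD hsub b hb => ?_⟩
    obtain ⟨h, hh, h1⟩ := exists_ne_one_of_ne_bot (hnt H hH)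
    have hx := hsub (mem_cosetSet_self x H)
    have hmem : x * h ∈ cosetSet x H := by simpa [cosetSet] using hh
    have hxh : x ≠ x * h := by simpa using h1
    by_cases hxb : x = b
    · subst hxb; exact mem_cosetSet_self x H
    by_cases hab : x * h = b
    · subst hab; exact hmem
    · exact hf.mem_of_triangle hH hmem hxh (hD hx hb hxb) (hD (hsub hmem) hb hab)

theorem actsFreelyTransitivelyOn_cosetSet_iff {x : G} {H K : Subgroup G} :
    ActsFreelyTransitivelyOn K (cosetSet x H) ↔ K = conjSubgroup x H := by
  constructor
  · rintro ⟨h1, h2⟩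
    ext k
    rw [mem_conjSubgroup]
    constructor
    · intro hk
      have := h1 k hk x (mem_cosetSet_self x H)
      simpa [cosetSet, mul_assoc] using this
    · intro hk
      obtain ⟨k', ⟨hk', e⟩, -⟩ := h2 x (mem_cosetSet_self x H) (k * x)
        (by simpa [cosetSet, mul_assoc] using hk)
      rw [smul_eq_mul] at e
      rwa [← mul_right_cancel e]
  · rintro rfl
    refine ⟨fun k hk y hy => ?_, fun y hy z hz => ⟨z * y⁻¹, ⟨?_, by simp⟩, ?_⟩⟩
    · have := mul_mem (mem_conjSubgroup.mp hk) (mem_cosetSet.mp hy)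
      simpa [cosetSet, mul_assoc] using this
    · rw [mem_conjSubgroup]
      have := mul_mem (mem_cosetSet.mp hz) (inv_mem (mem_cosetSet.mp hy))
      simpa [mul_assoc] using this
    · rintro k ⟨-, rfl⟩
      simp

theorem IsRetractionSystem.isRotationSystem (hf : IsRetractionSystem B f) (hnt : ∀ H ∈ B, H ≠ ⊥)
    (hgen : sSup B = ⊤) (hB : B.Nonempty) :
    IsRotationSystem (V := G) (cayleyGraph B) (conjugateSubgroups B) where
  connected := cayleyGraph_connected hgen
  adj_smul g x y h := by
    obtain ⟨hne, H, hH, hh⟩ := cayleyGraph_adj.mp h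
    exact cayleyGraph_adj.mpr ⟨by simpa using hne, H, hH, by simpa [mul_assoc] using hh⟩
  conj_mem := by
    rintro K ⟨x, H, hH, rfl⟩ g
    exact ⟨g * x, H, hH, (conjSubgroup_mul g x H).symm⟩
  generates := by
    rw [eq_top_iff, ← hgen]
    exact sSup_le_sSup fun H hH => ⟨1, H, hH, (conjSubgroup_one H).symm⟩
  existsUnique_rotStab C hC := by
    obtain ⟨x, H, hH, rfl⟩ := (hf.isMaxClique_iff hnt hB).mp hC
    refine ⟨conjSubgroup x H, ⟨⟨x, H, hH, rfl⟩, actsFreelyTransitivelyOn_cosetSet_iff.mpr rfl⟩, ?_⟩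
    rintro K ⟨-, hK⟩
    exact actsFreelyTransitivelyOn_cosetSet_iff.mp hK
  isRotStab := by
    rintro K ⟨x, H, hH, rfl⟩
    exact ⟨cosetSet x H, (hf.isMaxClique_iff hnt hB).mpr ⟨x, H, hH, rfl⟩,
      actsFreelyTransitivelyOn_cosetSet_iff.mpr rfl⟩
  separates := by
    intro C hC K _ hKC y hy z hz hyz hreach
    obtain ⟨x, H, hH, rfl⟩ := (hf.isMaxClique_iff hnt hB).mp hC
    obtain rfl := actsFreelyTransitivelyOn_cosetSet_iff.mp hKC
    have key : f H (x⁻¹ * y) = f H (x⁻¹ * z) := by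
      obtain ⟨p⟩ := hreach
      clear hy hz hyz
      induction p with
      | nil => rfl
      | @cons y w z h p ih =>
        rw [← ih]
        rw [SimpleGraph.deleteEdges_adj] at h
        obtain ⟨hne, L, hL, hl⟩ := cayleyGraph_adj.mp h.1
        have e : x⁻¹ * w = (x⁻¹ * y) * (y⁻¹ * w) := by group
        rw [e, hf.map_mul_right H hH L hL _ _ hl]
        intro hc
        have hc' : conjSubgroup x H = conjSubgroup y L := by
          rw [← hc, ← conjSubgroup_mul, mul_inv_cancel_left]
        exact h.2 ⟨cosetSet y L, (hf.isMaxClique_iff hnt hB).mpr ⟨y, L, hL, rfl⟩,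
          actsFreelyTransitivelyOn_cosetSet_iff.mpr hc', y, mem_cosetSet_self y L, w, hl, hne, rfl⟩
    rw [hf.apply_of_mem hH hy, hf.apply_of_mem hH hz] at key
    exact hyz (mul_left_cancel key)

end CayleyRotation

/-! ### Cycles in graphs -/

section Cycles

open SimpleGraph

variable {V : Type*} {X : SimpleGraph V}

theorem dist_getVert_le (hX : X.Connected) {u v : V} (p : X.Walk u v) (i k : ℕ) :
    X.dist (p.getVert i) (p.getVert (i + k)) ≤ k := by
  induction k with
  | zero => simp
  | succ k ih =>
    have h1 : X.dist (p.getVert (i + k)) (p.getVert (i + (k + 1))) ≤ 1 := by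
      rcases lt_or_ge (i + k) p.length with hlt | hge
      · exact (dist_eq_one_iff_adj.mpr (p.adj_getVert_succ hlt)).le
      · rw [p.getVert_of_length_le hge, p.getVert_of_length_le (by omega)]
        simp
    exact (hX.dist_triangle (v := p.getVert (i + k))).trans (by omega)

/-- Walking along a cycle, the number of steps is at least the distance from the basepoint along
the cycle. -/
theorem SimpleGraph.Walk.IsCycle.exists_getVert_of_walk {z : V} {c : X.Walk z z} (hc : c.IsCycle)
    {u v : V} (q : X.Walk u v) (hq : ∀ e ∈ q.edges, e ∈ c.edges) {k : ℕ} (hk : k ≤ c.length)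
    (hu : u = c.getVert k ∨ u = c.getVert (c.length - k)) :
    ∃ k' ≤ k + q.length, k' ≤ c.length ∧
      (v = c.getVert k' ∨ v = c.getVert (c.length - k')) := by
  induction q generalizing k with
  | nil => exact ⟨k, by simp, hk, hu⟩
  | @cons u w v h q ih =>
    have h3 := hc.three_le_length
    have hadj : w ∈ c.toSubgraph.neighborSet u :=
      Walk.adj_toSubgraph_iff_mem_edges.mpr (hq _ (by simp))
    have hstep : ∃ k' ≤ k + 1, k' ≤ c.length ∧
        (w = c.getVert k' ∨ w = c.getVert (c.length - k')) := by
      obtain ⟨i, hi, hui, hik⟩ : ∃ i ≤ c.length, u = c.getVert i ∧ (i = k ∨ i = c.length - k) := by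
        rcases hu with hu | hu
        · exact ⟨k, hk, hu, Or.inl rfl⟩
        · exact ⟨_, Nat.sub_le _ _, hu, Or.inr rfl⟩
      by_cases hend : i = 0 ∨ i = c.length
      · have huz : u = z := by
          rcases hend with rfl | rfl
          · rw [hui, Walk.getVert_zero]
          · rw [hui, Walk.getVert_length]
        subst huz
        rw [hc.neighborSet_toSubgraph_endpoint] at hadj
        exact ⟨1, by omega, by omega, hadj⟩
      · rw [hui, hc.neighborSet_toSubgraph_internal (by omega) (by omega)] at hadj
        rcases hik with rfl | rfl
        · rcases hadj with hw | hw
          · exact ⟨i - 1, by omega, by omega, Or.inl hw⟩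
          · exact ⟨i + 1, by omega, by omega, Or.inl hw⟩
        · rcases hadj with hw | hw
          · exact ⟨k + 1, by omega, by omega, Or.inr (by rw [hw]; congr 1)⟩
          · exact ⟨k - 1, by omega, by omega, Or.inr (by rw [hw]; congr 1; omega)⟩
    obtain ⟨k', hk', hk'', hw⟩ := hstep
    obtain ⟨l, hl, hl', hv⟩ := ih (fun e he => hq e (by simp [he])) hk'' hw
    exact ⟨l, by rw [Walk.length_cons]; omega, hl', hv⟩

theorem IsConvexEvenCycle.dist_opposite (hX : X.Connected) {z : V} {c : X.Walk z z}
    (h : IsConvexEvenCycle X c) : X.dist z (c.getVert (c.length / 2)) = c.length / 2 := by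
  obtain ⟨hc, heven, hconv⟩ := h
  have h3 := hc.three_le_length
  set n := c.length / 2 with hn
  have hlen : c.length = 2 * n := by have := Nat.two_mul_div_two_of_even heven; omega
  refine le_antisymm ?_ ?_
  · have := dist_getVert_le hX c 0 n
    rwa [Walk.getVert_zero, zero_add] at this
  · obtain ⟨q, hq⟩ := hX.exists_walk_length_eq_dist z (c.getVert n)
    have hle := hconv z (by simp) _ (by simp [Walk.getVert_mem_support]) q hq
    obtain ⟨k, hk, hk', hv⟩ := hc.exists_getVert_of_walk q
      (fun e he => by
        have := Subgraph.edgeSet_mono hle (q.mem_edges_toSubgraph.mpr he)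
        rwa [Walk.mem_edges_toSubgraph] at this) (k := 0) (Nat.zero_le _) (by simp)
    rw [← hq]
    by_contra hlt
    have hk0 : 1 ≤ k := by
      rcases Nat.eq_zero_or_pos k with rfl | hk0
      · have hz : c.getVert n = c.getVert 0 := by
          rcases hv with hv | hv
          · exact hv
          · rw [hv, Nat.sub_zero, Walk.getVert_length, Walk.getVert_zero]
        have := hc.getVert_injOn' (show n ≤ c.length - 1 by omega)
          (show 0 ≤ c.length - 1 by omega) hz
        omega
      · exact hk0
    rcases hv with hv | hv
    · have := hc.getVert_injOn ⟨by omega, by omega⟩ ⟨by omega, by omega⟩ hv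
      omega
    · have := hc.getVert_injOn ⟨by omega, by omega⟩ ⟨by omega, by omega⟩ hv
      omega

/-- A cycle which is contained in another one is equal to it, since both have two edges at each of
their vertices. -/
theorem toSubgraph_eq_of_isCycle {u v : V} {c : X.Walk u u} {d : X.Walk v v} (hc : c.IsCycle)
    (hd : d.IsCycle) (hle : d.toSubgraph ≤ c.toSubgraph) : d.toSubgraph = c.toSubgraph := by
  classical
  have hv : v ∈ c.support := by
    have := hle.1 d.start_mem_verts_toSubgraph
    rwa [Walk.mem_verts_toSubgraph] at this
  have hnbr : ∀ w ∈ d.support, d.toSubgraph.neighborSet w = c.toSubgraph.neighborSet w := by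
    intro w hw
    have hw' : w ∈ c.support := by
      have := hle.1 (d.mem_verts_toSubgraph.mpr hw)
      rwa [Walk.mem_verts_toSubgraph] at this
    refine Set.eq_of_subset_of_ncard_le (fun x hx => hle.2 hx) ?_ (c.finite_neighborSet_toSubgraph)
    rw [hc.ncard_neighborSet_toSubgraph_eq_two hw', hd.ncard_neighborSet_toSubgraph_eq_two hw]
  have hwalk : ∀ {x y : V} (q : X.Walk x y), x ∈ d.support → (∀ e ∈ q.edges, e ∈ c.edges) →
      ∀ e ∈ q.edges, e ∈ d.edges := by
    intro x y q
    induction q with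
    | nil => simp
    | @cons x w y h q ih =>
      intro hx hq
      have hmem : w ∈ d.toSubgraph.neighborSet x := by
        rw [hnbr x hx]
        exact Walk.adj_toSubgraph_iff_mem_edges.mpr (hq _ (by simp))
      have hw : w ∈ d.support := Walk.mem_support_of_adj_toSubgraph hmem.symm
      intro e he
      rw [Walk.edges_cons, List.mem_cons] at he
      rcases he with rfl | he
      · exact Walk.adj_toSubgraph_iff_mem_edges.mp hmem
      · exact ih hw (fun e he => hq e (by simp [he])) e he
  refine le_antisymm hle ?_
  rw [Walk.toSubgraph_le_iff hc.not_nil]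
  intro e he
  rw [Walk.mem_edges_toSubgraph]
  have hr := (c.rotate_edges v hv).mem_iff (a := e)
  exact hwalk (c.rotate v hv) d.start_mem_support
    (fun e he => (c.rotate_edges v hv).mem_iff.mp he) e (hr.mpr he)

theorem toSubgraph_eq_of_edgeSet_eq {u v : V} {c : X.Walk u u} {d : X.Walk v v} (hc : c.IsCycle)
    (hd : d.IsCycle) (h : c.toSubgraph.edgeSet = d.toSubgraph.edgeSet) :
    c.toSubgraph = d.toSubgraph := by
  refine le_antisymm ?_ ?_
  · rw [Walk.toSubgraph_le_iff hc.not_nil, ← h, Walk.edgeSet_toSubgraph]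
  · rw [Walk.toSubgraph_le_iff hd.not_nil, h, Walk.edgeSet_toSubgraph]

end Cycles

/-! ### Even cycles in the Cayley graph of a retraction system -/

section CayleyCycles

open SimpleGraph

variable {G : Type*} [Group G] {B : Set (Subgroup G)} {f : Subgroup G → G → G}
  {H L : Subgroup G} {m : ℕ} {a b x : G}

/-- The vertices of the cycle through `x`, `x a` and `x b` given by the two sides of the braid
relation of length `m` between `a` and `b`. -/
def cycleVerts (x a b : G) (m : ℕ) : Set G :=
  {v | ∃ i ≤ m, v = x * altProd a b i ∨ v = x * altProd b a i}

/-- The edges of the cycle through `x`, `x a` and `x b` given by the two sides of the braid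
relation of length `m` between `a` and `b`. -/
def cycleEdges (x a b : G) (m : ℕ) : Set (Sym2 G) :=
  {e | ∃ i < m, e = s(x * altProd a b i, x * altProd a b (i + 1)) ∨
    e = s(x * altProd b a i, x * altProd b a (i + 1))}

theorem cycleVerts_comm (x a b : G) (m : ℕ) : cycleVerts x a b m = cycleVerts x b a m := by
  simp only [cycleVerts, or_comm]

theorem cycleEdges_comm (x a b : G) (m : ℕ) : cycleEdges x a b m = cycleEdges x b a m := by
  simp only [cycleEdges, or_comm]

theorem mem_cycleVerts_of_mem_cycleEdges {e : Sym2 G} (he : e ∈ cycleEdges x a b m) {v : G}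
    (hv : v ∈ e) : v ∈ cycleVerts x a b m := by
  obtain ⟨i, hi, rfl | rfl⟩ := he <;> rcases Sym2.mem_iff.mp hv with rfl | rfl
  · exact ⟨i, hi.le, Or.inl rfl⟩
  · exact ⟨i + 1, hi, Or.inl rfl⟩
  · exact ⟨i, hi.le, Or.inr rfl⟩
  · exact ⟨i + 1, hi, Or.inr rfl⟩

theorem exists_altProd_walk (hH : H ∈ B) (hL : L ∈ B) (ha : a ∈ H) (hb : b ∈ L) (ha1 : a ≠ 1)
    (hb1 : b ≠ 1) (x : G) (k : ℕ) :
    ∃ p : (cayleyGraph B).Walk x (x * altProd a b k), p.length = k ∧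
      (∀ v, v ∈ p.support ↔ ∃ i ≤ k, v = x * altProd a b i) ∧
      ∀ e, e ∈ p.edges ↔ ∃ i < k, e = s(x * altProd a b i, x * altProd a b (i + 1)) := by
  induction k generalizing x a b H L with
  | zero => exact ⟨Walk.nil.copy rfl (by simp [altProd]), by simp,
    fun v => by rw [Walk.support_copy]; simp [altProd], by simp⟩
  | succ k ih =>
    obtain ⟨p, hp, hs, he⟩ := ih hL hH hb ha hb1 ha1 (x * a)
    have hassoc : ∀ i, x * a * altProd b a i = x * altProd a b (i + 1) := fun i => by
      rw [altProd, mul_assoc]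
    refine ⟨(Walk.cons (cayleyGraph_adj_mul hH x ha ha1) p).copy rfl (hassoc k), by simp [hp],
      fun v => ?_, fun e => ?_⟩
    · rw [Walk.support_copy, Walk.support_cons, List.mem_cons, hs]
      constructor
      · rintro (rfl | ⟨i, hi, rfl⟩)
        · exact ⟨0, by omega, by simp [altProd]⟩
        · exact ⟨i + 1, by omega, hassoc i⟩
      · rintro ⟨i, hi, rfl⟩
        rcases i with _ | i
        · exact Or.inl (by simp [altProd])
        · exact Or.inr ⟨i, by omega, (hassoc i).symm⟩
    · rw [Walk.edges_copy, Walk.edges_cons, List.mem_cons, he]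
      have h0 : s(x, x * a) = s(x * altProd a b 0, x * altProd a b (0 + 1)) := by simp [altProd]
      constructor
      · rintro (rfl | ⟨i, hi, rfl⟩)
        · exact ⟨0, by omega, h0⟩
        · exact ⟨i + 1, by omega, by rw [hassoc, hassoc]⟩
      · rintro ⟨i, hi, rfl⟩
        rcases i with _ | i
        · exact Or.inl h0.symm
        · exact Or.inr ⟨i, by omega, by rw [hassoc, hassoc]⟩

/-- Alternating products over a braid relation cross each wall once. -/
theorem IsRetractionSystem.wordLength_altProd_mul (hf : IsRetractionSystem B f) (hH : H ∈ B)
    (hL : L ∈ B) (ha : a ∈ H) (hb : b ∈ L) (ha1 : a ≠ 1) (hb1 : b ≠ 1) {u : G} (hu : u ∈ sSup B)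
    {k : ℕ} (hk : ∀ j < k, f H (altProd b a j * u) = 1 ∧ f L (altProd a b j * u) = 1) :
    wordLength B (altProd a b k * u) = k + wordLength B u := by
  induction k generalizing a b H L with
  | zero => simp [altProd]
  | succ k ih =>
    have := ih hL hH hb ha hb1 ha1 (fun j hj => (hk j (by omega)).symm)
    rw [altProd, mul_assoc, hf.wordLength_mul_of_apply_eq_one hH
      (mul_mem (altProd_mem (le_sSup hL hb) (le_sSup hH ha) k) hu) ha ha1 (hk k (by omega)).1, this]
    omega

namespace IsRankTwo

theorem wordLength_altProd (h : IsRankTwo B f H L m) (hf : IsRetractionSystem B f) (hH : H ∈ B)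
    (hL : L ∈ B) (ha : a ∈ H) (hb : b ∈ L) (ha1 : a ≠ 1) (hb1 : b ≠ 1) {k : ℕ} (hk : k ≤ m) :
    wordLength B (altProd a b k) = k := by
  have := hf.wordLength_altProd_mul hH hL ha hb ha1 hb1 (one_mem _) (k := k) (fun j hj => by
    rw [mul_one, mul_one]
    exact ⟨h.apply_altProd_left a ha b hb ha1 hb1 j (by omega),
      h.apply_altProd_right a ha b hb ha1 hb1 j (by omega)⟩)
  have h1 : wordLength B (1 : G) = 0 := Nat.le_zero.mp (wordLength_le IsWord.one)
  rwa [mul_one, h1, add_zero] at this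

theorem apply_altProd_of_pos (h : IsRankTwo B f H L m) (hf : IsRetractionSystem B f) (hH : H ∈ B)
    (ha : a ∈ H) (hb : b ∈ L) (ha1 : a ≠ 1) (hb1 : b ≠ 1) {k : ℕ} (hk : k < m) :
    f H (altProd a b (k + 1)) = a := by
  rw [altProd, hf.map_mul_left H hH a ha, h.apply_altProd_left a ha b hb ha1 hb1 k hk, mul_one]

/-- The two sides of the braid relation bound a cycle. -/
theorem exists_isCycle (h : IsRankTwo B f H L m) (hf : IsRetractionSystem B f)
    (hgen : sSup B = ⊤) (hH : H ∈ B) (hL : L ∈ B) (ha : a ∈ H) (hb : b ∈ L) (ha1 : a ≠ 1)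
    (hb1 : b ≠ 1) (x : G) :
    ∃ c : (cayleyGraph B).Walk x x, c.IsCycle ∧ c.length = 2 * m ∧
      c.getVert m = x * altProd a b m ∧ (∀ v, v ∈ c.support ↔ v ∈ cycleVerts x a b m) ∧
      ∀ e, e ∈ c.edges ↔ e ∈ cycleEdges x a b m := by
  have hm := h.two_le
  obtain ⟨p, hp, hps, hpe⟩ := exists_altProd_walk hH hL ha hb ha1 hb1 x m
  obtain ⟨q, hq, hqs, hqe⟩ := exists_altProd_walk hL hH hb ha hb1 ha1 x m
  have hbraid := h.braid a ha b hb ha1 hb1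
  have hpath : p.IsPath := p.isPath_of_length_eq_dist (by
    rw [hp, cayleyGraph_dist hgen, inv_mul_cancel_left,
      h.wordLength_altProd hf hH hL ha hb ha1 hb1 le_rfl])
  have hqath : q.IsPath := q.isPath_of_length_eq_dist (by
    rw [hq, cayleyGraph_dist hgen, inv_mul_cancel_left,
      (h.symm hf hH hL).wordLength_altProd hf hL hH hb ha hb1 ha1 le_rfl])
  have hvert : x * altProd a b m = x * altProd b a m := by rw [hbraid]
  have hr : (q.reverse.copy hvert.symm rfl).IsPath := by simpa using hqath
  refine ⟨p.append (q.reverse.copy hvert.symm rfl), ?_, ?_, ?_, ?_, ?_⟩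
  · refine hpath.isCycle_append hr ?_ (Or.inl (by omega))
    rw [List.disjoint_left]
    intro v hv hv'
    have hvx : v ≠ x := by
      rintro rfl
      have := hpath.support_nodup
      rw [← Walk.cons_tail_support] at this
      exact (List.nodup_cons.mp this).1 hv
    have hvo : v ≠ x * altProd a b m := by
      rintro rfl
      have := hr.support_nodup
      rw [← Walk.cons_tail_support] at this
      exact (List.nodup_cons.mp this).1 hv'
    obtain ⟨i, hi, rfl⟩ := (hps v).mp (List.mem_of_mem_tail hv)
    have hv'' := List.mem_of_mem_tail hv'
    rw [Walk.support_copy, Walk.support_reverse, List.mem_reverse, hqs] at hv''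
    obtain ⟨j, hj, e⟩ := hv''
    have e := mul_left_cancel e
    rcases i with _ | i
    · simp [altProd] at hvx
    rcases j with _ | j
    · rw [e] at hvx; simp [altProd] at hvx
    have hi' : i + 1 < m := lt_of_le_of_ne hi (fun h => hvo (by rw [h]))
    -- the wall `L` separates the inner vertices of the two sides
    have h1 := (h.symm hf hH hL).apply_altProd_of_pos hf hL hb ha hb1 ha1 (k := j) (by omega)
    rw [← e, h.apply_altProd_right a ha b hb ha1 hb1 _ hi'] at h1
    exact hb1 h1.symm
  · simp [hp, hq]; omega
  · rw [Walk.getVert_append, if_neg (by omega), hp, Nat.sub_self, Walk.getVert_zero]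
  · intro v
    rw [Walk.mem_support_append_iff, hps, Walk.support_copy, Walk.support_reverse,
      List.mem_reverse, hqs]
    constructor
    · rintro (⟨i, hi, e⟩ | ⟨i, hi, e⟩)
      · exact ⟨i, hi, Or.inl e⟩
      · exact ⟨i, hi, Or.inr e⟩
    · rintro ⟨i, hi, e | e⟩
      · exact Or.inl ⟨i, hi, e⟩
      · exact Or.inr ⟨i, hi, e⟩
  · intro v
    rw [Walk.edges_append, List.mem_append, hpe, Walk.edges_copy, Walk.edges_reverse,
      List.mem_reverse, hqe]
    constructor
    · rintro (⟨i, hi, e⟩ | ⟨i, hi, e⟩)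
      · exact ⟨i, hi, Or.inl e⟩
      · exact ⟨i, hi, Or.inr e⟩
    · rintro ⟨i, hi, e | e⟩
      · exact Or.inl ⟨i, hi, e⟩
      · exact Or.inr ⟨i, hi, e⟩

/-- Replacing `a` with `a⁻¹` changes nothing: either `a` is an involution, or `m = 2` and `a` does
not occur in `altProd b a i`. -/
theorem altProd_inv_right (h : IsRankTwo B f H L m) (ha : a ∈ H) (ha1 : a ≠ 1) {i : ℕ}
    (hi : i < m) : altProd b a⁻¹ i = altProd b a i := by
  rcases h.two_le.lt_or_eq with hlt | rfl
  · rw [inv_eq_self_of_card_eq_two (h.card hlt).1 ha ha1]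
  · interval_cases i <;> simp [altProd]

theorem altProd_inv_left_succ (h : IsRankTwo B f H L m) (ha : a ∈ H) (ha1 : a ≠ 1) {i : ℕ}
    (hi : i < m) : x * a * altProd a⁻¹ b (i + 1) = x * altProd b a i := by
  rw [altProd, h.altProd_inv_right ha ha1 hi]; group

theorem altProd_inv_right_of_lt (h : IsRankTwo B f H L m) (ha : a ∈ H) (ha1 : a ≠ 1) {i : ℕ}
    (hi : i < m) : x * a * altProd b a⁻¹ i = x * altProd a b (i + 1) := by
  rw [h.altProd_inv_right ha ha1 hi, altProd, mul_assoc]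

theorem altProd_inv_right_self (h : IsRankTwo B f H L (m + 1)) (ha : a ∈ H) (hb : b ∈ L)
    (ha1 : a ≠ 1) (hb1 : b ≠ 1) :
    x * a * altProd b a⁻¹ (m + 1) = x * altProd b a m := by
  rw [← h.braid a⁻¹ (inv_mem ha) b hb (by simpa using ha1) hb1,
    h.altProd_inv_left_succ ha ha1 (Nat.lt_succ_self m)]

theorem cycleVerts_subset (h : IsRankTwo B f H L m) (ha : a ∈ H) (hb : b ∈ L) (ha1 : a ≠ 1)
    (hb1 : b ≠ 1) (x : G) : cycleVerts x a b m ⊆ cycleVerts (x * a) a⁻¹ b m := by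
  have hm := h.two_le
  obtain ⟨m, rfl⟩ : ∃ m', m = m' + 1 := ⟨m - 1, by omega⟩
  rintro v ⟨i, hi, rfl | rfl⟩
  · rcases i with _ | i
    · exact ⟨1, by omega, Or.inl (by simp [altProd])⟩
    · exact ⟨i, by omega, Or.inr (h.altProd_inv_right_of_lt ha ha1 (by omega)).symm⟩
  · rcases hi.lt_or_eq with hlt | rfl
    · exact ⟨i + 1, by omega, Or.inl (h.altProd_inv_left_succ ha ha1 hlt).symm⟩
    · exact ⟨m, by omega, Or.inr (by
        rw [h.altProd_inv_right_of_lt ha ha1 (by omega), h.braid a ha b hb ha1 hb1])⟩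

theorem cycleEdges_subset (h : IsRankTwo B f H L m) (ha : a ∈ H) (hb : b ∈ L) (ha1 : a ≠ 1)
    (hb1 : b ≠ 1) (x : G) : cycleEdges (x * a) a⁻¹ b m ⊆ cycleEdges x a b m := by
  have hm := h.two_le
  obtain ⟨m, rfl⟩ : ∃ m', m = m' + 1 := ⟨m - 1, by omega⟩
  rintro e ⟨i, hi, rfl | rfl⟩
  · rcases i with _ | i
    · exact ⟨0, by omega, Or.inl (by simp [altProd, Sym2.eq_swap])⟩
    · refine ⟨i, by omega, Or.inr ?_⟩
      rw [h.altProd_inv_left_succ ha ha1 (by omega), h.altProd_inv_left_succ ha ha1 (by omega)]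
  · rcases (Nat.lt_succ_iff.mp hi).lt_or_eq with hlt | rfl
    · refine ⟨i + 1, by omega, Or.inl ?_⟩
      rw [h.altProd_inv_right_of_lt ha ha1 (by omega), h.altProd_inv_right_of_lt ha ha1 (by omega)]
    · refine ⟨i, by omega, Or.inr ?_⟩
      rw [h.altProd_inv_right_of_lt ha ha1 (by omega), h.altProd_inv_right_self ha hb ha1 hb1,
        h.braid a ha b hb ha1 hb1, Sym2.eq_swap]

theorem exists_base (h : IsRankTwo B f H L m) (hf : IsRetractionSystem B f) (hH : H ∈ B)
    (hL : L ∈ B) (ha : a ∈ H) (hb : b ∈ L) (ha1 : a ≠ 1) (hb1 : b ≠ 1) (x : G) {i : ℕ}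
    (hi : i ≤ m) :
    ∃ a' ∈ H, ∃ b' ∈ L, a' ≠ 1 ∧ b' ≠ 1 ∧
      cycleVerts x a b m ⊆ cycleVerts (x * altProd a b i) a' b' m ∧
      cycleEdges (x * altProd a b i) a' b' m ⊆ cycleEdges x a b m := by
  induction i generalizing x a b H L with
  | zero => exact ⟨a, ha, b, hb, ha1, hb1, by simp [altProd], by simp [altProd]⟩
  | succ i ih =>
    have ha1' : a⁻¹ ≠ 1 := by simpa using ha1
    obtain ⟨b', hb', a', ha', hb1', ha1'', h1, h2⟩ := ih (h.symm hf hH hL) hL hH hb (inv_mem ha) hb1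
      ha1' (x * a) (by omega)
    rw [h.altProd_inv_right_of_lt ha ha1 (by omega), cycleVerts_comm, cycleVerts_comm _ b' a'] at h1
    rw [h.altProd_inv_right_of_lt ha ha1 (by omega), cycleEdges_comm, cycleEdges_comm _ b a⁻¹] at h2
    exact ⟨a', ha', b', hb', ha1'', hb1', (h.cycleVerts_subset ha hb ha1 hb1 x).trans h1,
      h2.trans (h.cycleEdges_subset ha hb ha1 hb1 x)⟩

/-- On the cycle based at `1`, a vertex lies on the side of `1` or of `a` of the wall `H`. -/
theorem apply_eq_of_mem_cycleVerts (h : IsRankTwo B f H L m) (hf : IsRetractionSystem B f)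
    (hH : H ∈ B) (hL : L ∈ B) (ha : a ∈ H) (hb : b ∈ L) (ha1 : a ≠ 1) (hb1 : b ≠ 1) {q : G}
    (hq : x * q ∈ cycleVerts x a b m) (hne : f H q ≠ 1) : f H q = a := by
  obtain ⟨i, hi, e⟩ := hq
  rw [mul_right_inj, mul_right_inj] at e
  rcases e with rfl | rfl
  · rcases i with _ | i
    · exact absurd (hf.map_one H hH) hne
    · exact h.apply_altProd_of_pos hf hH ha hb ha1 hb1 (by omega)
  · rcases hi.lt_or_eq with hlt | rfl
    · exact absurd (h.apply_altProd_left a ha b hb ha1 hb1 i hlt) hne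
    · rw [← h.braid a ha b hb ha1 hb1]
      exact (h.apply_altProd hf hH hL ha hb ha1 hb1).1

theorem mem_sSup_of_mem_cycleVerts (ha : a ∈ H) (hb : b ∈ L) {q : G}
    (hq : x * q ∈ cycleVerts x a b m) : q ∈ sSup ({H, L} : Set (Subgroup G)) := by
  obtain ⟨i, hi, e⟩ := hq
  rw [mul_right_inj, mul_right_inj] at e
  have ha' : a ∈ sSup ({H, L} : Set (Subgroup G)) := Subgroup.mem_sSup_of_mem (Or.inl rfl) ha
  have hb' : b ∈ sSup ({H, L} : Set (Subgroup G)) := Subgroup.mem_sSup_of_mem (Or.inr rfl) hb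
  rcases e with rfl | rfl
  · exact altProd_mem ha' hb' i
  · exact altProd_mem hb' ha' i

/-- A geodesic between two vertices of the cycle has its first edge, hence all its edges, in the
cycle: its first letter is a descent of the difference of the endpoints. -/
theorem edges_subset_cycleEdges (h : IsRankTwo B f H L m) (hf : IsRetractionSystem B f)
    (hgen : sSup B = ⊤) (hH : H ∈ B) (hL : L ∈ B) (ha : a ∈ H) (hb : b ∈ L) (ha1 : a ≠ 1)
    (hb1 : b ≠ 1) {q : G} (p : (cayleyGraph B).Walk x q) (hp : p.length = (cayleyGraph B).dist x q)
    (hq : q ∈ cycleVerts x a b m) : ∀ e ∈ p.edges, e ∈ cycleEdges x a b m := by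
  induction p generalizing a b with
  | nil => simp
  | @cons x w q hadj p ih =>
    have hm := h.two_le
    have hX := cayleyGraph_connected hgen
    have htop : ∀ g : G, g ∈ sSup B := fun g => hgen ▸ Subgroup.mem_top g
    obtain ⟨hne, M, hM, hs⟩ := cayleyGraph_adj.mp hadj
    have hpw : p.length = (cayleyGraph B).dist w q := by
      have h1 := hX.dist_triangle (u := x) (v := w) (w := q)
      have h2 := dist_le p
      rw [dist_eq_one_iff_adj.mpr hadj] at h1
      rw [Walk.length_cons] at hp
      omega
    have hs1 : x⁻¹ * w ≠ 1 := fun e => hne (inv_mul_eq_one.mp e)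
    have hlt : f M (x⁻¹ * q) = x⁻¹ * w := by
      rw [← hf.wordLength_lt_iff hM (htop _) hs hs1]
      rw [Walk.length_cons, hpw, cayleyGraph_dist hgen, cayleyGraph_dist hgen] at hp
      have : (x⁻¹ * w)⁻¹ * (x⁻¹ * q) = w⁻¹ * q := by group
      rw [this]
      omega
    have hsub : ({H, L} : Set (Subgroup G)) ⊆ B := by
      rintro M (rfl | rfl)
      · exact hH
      · exact hL
    have hxq : x * (x⁻¹ * q) ∈ cycleVerts x a b m := by rwa [mul_inv_cancel_left]
    -- the first edge of the geodesic crosses a wall which separates `x` and `q`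
    have hMmem : M ∈ ({H, L} : Set (Subgroup G)) := by
      by_contra hM'
      exact hs1 (hlt.symm.trans (hf.apply_eq_one_of_mem_sSup hsub hM hM'
        (mem_sSup_of_mem_cycleVerts ha hb hxq)))
    have hne1 : f M (x⁻¹ * q) ≠ 1 := by rwa [hlt]
    intro e he
    rw [Walk.edges_cons, List.mem_cons] at he
    rcases hMmem with rfl | rfl
    · have hw : w = x * a := by
        rw [h.apply_eq_of_mem_cycleVerts hf hH hL ha hb ha1 hb1 hxq hne1] at hlt
        rw [hlt, mul_inv_cancel_left]
      subst hw
      rcases he with rfl | he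
      · exact ⟨0, by omega, Or.inl (by simp [altProd])⟩
      · exact h.cycleEdges_subset ha hb ha1 hb1 x (ih (inv_mem ha) hb (by simpa using ha1) hb1 hpw
          (h.cycleVerts_subset ha hb ha1 hb1 x hq) e he)
    · have h' := h.symm hf hH hL
      rw [cycleVerts_comm] at hxq hq
      have hw : w = x * b := by
        rw [h'.apply_eq_of_mem_cycleVerts hf hL hH hb ha hb1 ha1 hxq hne1] at hlt
        rw [hlt, mul_inv_cancel_left]
      subst hw
      rcases he with rfl | he
      · exact ⟨0, by omega, Or.inr (by simp [altProd])⟩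
      · rw [cycleEdges_comm]
        refine h'.cycleEdges_subset hb ha hb1 ha1 x ?_
        rw [cycleEdges_comm]
        refine ih ha (inv_mem hb) ha1 (by simpa using hb1) hpw ?_ e he
        rw [cycleVerts_comm]
        exact h'.cycleVerts_subset hb ha hb1 ha1 x hq

/-- The cycle given by a braid relation is convex. -/
theorem isConvexEvenCycle (h : IsRankTwo B f H L m) (hf : IsRetractionSystem B f)
    (hgen : sSup B = ⊤) (hH : H ∈ B) (hL : L ∈ B) (ha : a ∈ H) (hb : b ∈ L) (ha1 : a ≠ 1)
    (hb1 : b ≠ 1) {c : (cayleyGraph B).Walk x x} (hc : c.IsCycle) (hlen : c.length = 2 * m)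
    (hcs : ∀ v, v ∈ c.support ↔ v ∈ cycleVerts x a b m)
    (hce : ∀ e, e ∈ c.edges ↔ e ∈ cycleEdges x a b m) :
    IsConvexEvenCycle (cayleyGraph B) c := by
  refine ⟨hc, by rw [hlen]; exact even_two_mul m, ?_⟩
  intro v hv q hq p hp
  rw [Walk.mem_verts_toSubgraph] at hv hq
  by_cases hnil : p.Nil
  · obtain rfl := hnil.eq
    rw [Walk.eq_nil_iff_nil.mpr hnil]
    simpa using hv
  rw [Walk.toSubgraph_le_iff hnil]
  have hq' := (hcs q).mp hq
  have key : ∃ a' ∈ H, ∃ b' ∈ L, a' ≠ 1 ∧ b' ≠ 1 ∧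
      cycleVerts x a b m ⊆ cycleVerts v a' b' m ∧ cycleEdges v a' b' m ⊆ cycleEdges x a b m := by
    obtain ⟨i, hi, rfl | rfl⟩ := (hcs v).mp hv
    · exact h.exists_base hf hH hL ha hb ha1 hb1 x hi
    · obtain ⟨b', hb', a', ha', hb1', ha1', h1, h2⟩ :=
        (h.symm hf hH hL).exists_base hf hL hH hb ha hb1 ha1 x hi
      rw [cycleVerts_comm, cycleVerts_comm _ b'] at h1
      rw [cycleEdges_comm, cycleEdges_comm _ b] at h2
      exact ⟨a', ha', b', hb', ha1', hb1', h1, h2⟩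
  obtain ⟨a', ha', b', hb', ha1', hb1', h1, h2⟩ := key
  intro e he
  rw [Walk.mem_edges_toSubgraph, hce]
  exact h2 (h.edges_subset_cycleEdges hf hgen hH hL ha' hb' ha1' hb1' p hp (h1 hq') e he)

end IsRankTwo

end CayleyCycles

/-! ### The Cayley graph of a retraction system is mediangle -/

section CayleyMediangle

open SimpleGraph

variable {G : Type*} [Group G] {B : Set (Subgroup G)} {f : Subgroup G → G → G}

namespace IsRetractionSystem

/-- If `z a` and `z b` are distinct neighbours of `z` which are closer to `o` than `z`, then the
cycle based at `z` through `z a` and `z b` given by a braid relation has its opposite vertex on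
geodesics from `z` to `o`. -/
theorem exists_isRankTwo_of_dist (hf : IsRetractionSystem B f) (hgen : sSup B = ⊤) {o x y z : G}
    (hxy : x ≠ y) (hx : (cayleyGraph B).dist o z = (cayleyGraph B).dist o x + 1)
    (hy : (cayleyGraph B).dist o z = (cayleyGraph B).dist o y + 1)
    (hzx : (cayleyGraph B).Adj z x) (hzy : (cayleyGraph B).Adj z y) :
    ∃ H ∈ B, ∃ L ∈ B, H ≠ L ∧ ∃ m, IsRankTwo B f H L m ∧ z⁻¹ * x ∈ H ∧ z⁻¹ * y ∈ L ∧
      z⁻¹ * x ≠ 1 ∧ z⁻¹ * y ≠ 1 ∧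
      (cayleyGraph B).dist o z = m +
        (cayleyGraph B).dist (z * altProd (z⁻¹ * x) (z⁻¹ * y) m) o := by
  have htop : ∀ g : G, g ∈ sSup B := fun g => hgen ▸ Subgroup.mem_top g
  obtain ⟨hzx', H, hH, ha⟩ := cayleyGraph_adj.mp hzx
  obtain ⟨hzy', L, hL, hb⟩ := cayleyGraph_adj.mp hzy
  have ha1 : z⁻¹ * x ≠ 1 := fun e => hzx' (inv_mul_eq_one.mp e)
  have hb1 : z⁻¹ * y ≠ 1 := fun e => hzy' (inv_mul_eq_one.mp e)
  rw [SimpleGraph.dist_comm, SimpleGraph.dist_comm (u := o), cayleyGraph_dist hgen,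
    cayleyGraph_dist hgen] at hx hy
  have hfa : f H (z⁻¹ * o) = z⁻¹ * x := by
    rw [← hf.wordLength_lt_iff hH (htop _) ha ha1,
      show (z⁻¹ * x)⁻¹ * (z⁻¹ * o) = x⁻¹ * o by group]
    omega
  have hfb : f L (z⁻¹ * o) = z⁻¹ * y := by
    rw [← hf.wordLength_lt_iff hL (htop _) hb hb1,
      show (z⁻¹ * y)⁻¹ * (z⁻¹ * o) = y⁻¹ * o by group]
    omega
  have hne : H ≠ L := by
    rintro rfl
    exact hxy (mul_left_cancel (hfa.symm.trans hfb))
  obtain ⟨m, hm⟩ := hf.exists_isRankTwo hH hL hne (htop (z⁻¹ * o)) (by rwa [hfa]) (by rwa [hfb])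
  obtain ⟨u, hu, e, hk⟩ := hm.factor _ (htop (z⁻¹ * o)) (by rwa [hfa]) (by rwa [hfb])
  rw [hfa, hfb] at e hk
  refine ⟨H, hH, L, hL, hne, m, hm, ha, hb, ha1, hb1, ?_⟩
  rw [SimpleGraph.dist_comm, cayleyGraph_dist hgen, cayleyGraph_dist hgen, mul_inv_rev, mul_assoc,
    e, inv_mul_cancel_left]
  exact hf.wordLength_altProd_mul hH hL ha hb ha1 hb1 hu hk

/-- Every convex even cycle is given by a braid relation: the two geodesics from its basepoint to
the opposite vertex start with the two sides of a braid relation, which close up to a cycle. -/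
theorem edgeSet_eq_cycleEdges_of_snd (hf : IsRetractionSystem B f) (hgen : sSup B = ⊤) {z : G}
    {c : (cayleyGraph B).Walk z z} (h : IsConvexEvenCycle (cayleyGraph B) c) :
    ∃ H ∈ B, ∃ L ∈ B, H ≠ L ∧ ∃ m, IsRankTwo B f H L m ∧ ∃ a ∈ H, ∃ b ∈ L, a ≠ 1 ∧ b ≠ 1 ∧
      c.snd = z * a ∧ c.toSubgraph.edgeSet = cycleEdges z a b m := by
  have hX := cayleyGraph_connected hgen
  have hopp := h.dist_opposite hX
  obtain ⟨hc, heven, hconv⟩ := h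
  have h3 := hc.three_le_length
  set n := c.length / 2 with hn
  have hlen : c.length = 2 * n := by have := Nat.two_mul_div_two_of_even heven; omega
  set o := c.getVert n with ho
  have hzx : (cayleyGraph B).Adj z c.snd := c.adj_snd hc.not_nil
  have hzy : (cayleyGraph B).Adj z c.penultimate := (c.adj_penultimate hc.not_nil).symm
  have hx : (cayleyGraph B).dist o z = (cayleyGraph B).dist o c.snd + 1 := by
    have h1 := dist_getVert_le hX c 1 (n - 1)
    rw [show 1 + (n - 1) = n by omega, SimpleGraph.dist_comm] at h1
    have h2 := hX.dist_triangle (u := o) (v := c.snd) (w := z)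
    rw [dist_eq_one_iff_adj.mpr hzx.symm] at h2
    rw [SimpleGraph.dist_comm] at hopp
    change (cayleyGraph B).dist o c.snd ≤ n - 1 at h1
    omega
  have hy : (cayleyGraph B).dist o z = (cayleyGraph B).dist o c.penultimate + 1 := by
    have h1 := dist_getVert_le hX c n (n - 1)
    rw [show n + (n - 1) = c.length - 1 by omega] at h1
    have h2 := hX.dist_triangle (u := o) (v := c.penultimate) (w := z)
    rw [dist_eq_one_iff_adj.mpr hzy.symm] at h2
    rw [SimpleGraph.dist_comm] at hopp
    change (cayleyGraph B).dist o c.penultimate ≤ n - 1 at h1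
    omega
  obtain ⟨H, hH, L, hL, hne, m, hm, ha, hb, ha1, hb1, hd⟩ :=
    hf.exists_isRankTwo_of_dist hgen hc.snd_ne_penultimate hx hy hzx hzy
  refine ⟨H, hH, L, hL, hne, m, hm, _, ha, _, hb, ha1, hb1, (mul_inv_cancel_left _ _).symm, ?_⟩
  generalize z⁻¹ * c.snd = a at *
  generalize z⁻¹ * c.penultimate = b at *
  -- both sides of the braid relation extend by `r` to geodesics from `z` to `o`, which lie in the
  -- cycle by convexity
  obtain ⟨r, hr⟩ := hX.exists_walk_length_eq_dist (z * altProd a b m) o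
  have hgeod : ∀ p : (cayleyGraph B).Walk z (z * altProd a b m), p.length = m →
      ∀ e ∈ p.edges, e ∈ c.toSubgraph.edgeSet := by
    intro p hp e he
    have hle := hconv z (by simp) o (by simp [ho, Walk.getVert_mem_support]) (p.append r) (by
      rw [Walk.length_append, hp, hr, SimpleGraph.dist_comm (u := z), hd])
    refine Subgraph.edgeSet_mono hle ?_
    rw [Walk.mem_edges_toSubgraph, Walk.edges_append]
    exact List.mem_append_left _ he
  obtain ⟨p, hp, -, hpe⟩ := exists_altProd_walk hH hL ha hb ha1 hb1 z m
  obtain ⟨q, hq, -, hqe⟩ := exists_altProd_walk hL hH hb ha hb1 ha1 z m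
  have hq' := hgeod (q.copy rfl (by rw [hm.braid a ha b hb ha1 hb1])) (by simpa using hq)
  obtain ⟨d, hd, -, -, -, hde⟩ := hm.exists_isCycle hf hgen hH hL ha hb ha1 hb1 z
  have hdc : d.toSubgraph ≤ c.toSubgraph := by
    rw [Walk.toSubgraph_le_iff hd.not_nil]
    intro e he
    obtain ⟨i, hi, he | he⟩ := (hde e).mp he
    · exact hgeod p hp e ((hpe e).mpr ⟨i, hi, he⟩)
    · exact hq' e (by rw [Walk.edges_copy]; exact (hqe e).mpr ⟨i, hi, he⟩)
  rw [← toSubgraph_eq_of_isCycle hc hd hdc]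
  ext e
  rw [Walk.mem_edges_toSubgraph, hde]

theorem edgeSet_eq_cycleEdges (hf : IsRetractionSystem B f) (hgen : sSup B = ⊤) {u z x : G}
    {c : (cayleyGraph B).Walk u u} (h : IsConvexEvenCycle (cayleyGraph B) c)
    (hzx : s(z, x) ∈ c.toSubgraph.edgeSet) :
    ∃ H ∈ B, ∃ L ∈ B, H ≠ L ∧ ∃ m, IsRankTwo B f H L m ∧ ∃ a ∈ H, ∃ b ∈ L, a ≠ 1 ∧ b ≠ 1 ∧
      x = z * a ∧ c.toSubgraph.edgeSet = cycleEdges z a b m := by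
  classical
  have hz : z ∈ c.support := Walk.mem_support_of_adj_toSubgraph hzx
  have h1 : IsConvexEvenCycle (cayleyGraph B) (c.rotate z hz) :=
    ⟨h.1.rotate hz, by rw [Walk.length_rotate]; exact h.2.1, by
      rw [Walk.toSubgraph_rotate]; exact h.2.2⟩
  have h2 : IsConvexEvenCycle (cayleyGraph B) (c.rotate z hz).reverse :=
    ⟨h1.1.reverse, by rw [Walk.length_reverse]; exact h1.2.1, by
      rw [Walk.toSubgraph_reverse]; exact h1.2.2⟩
  have hx : x ∈ (c.rotate z hz).toSubgraph.neighborSet z := by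
    rw [Walk.toSubgraph_rotate]; exact hzx
  rw [h1.1.neighborSet_toSubgraph_endpoint] at hx
  rcases hx with hx | hx
  · have := hf.edgeSet_eq_cycleEdges_of_snd hgen h1
    rwa [Walk.toSubgraph_rotate, ← hx] at this
  · have := hf.edgeSet_eq_cycleEdges_of_snd hgen h2
    rw [Walk.toSubgraph_reverse, Walk.toSubgraph_rotate, Walk.snd_reverse] at this
    rwa [show x = (c.rotate z hz).penultimate from hx]

/-- Two cycles given by braid relations which share their first edge and another vertex have the
same second letter. -/
theorem eq_of_mem_cycleVerts (hf : IsRetractionSystem B f) {H L L' : Subgroup G} (hH : H ∈ B)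
    (hL : L ∈ B) (hL' : L' ∈ B) (hHL : H ≠ L) (hHL' : H ≠ L') {m m' : ℕ}
    (hm : IsRankTwo B f H L m) (hm' : IsRankTwo B f H L' m') {a b b' x q : G} (ha : a ∈ H)
    (hb : b ∈ L) (hb' : b' ∈ L') (ha1 : a ≠ 1) (hb1 : b ≠ 1) (hb1' : b' ≠ 1) (hq1 : q ≠ 1)
    (hqa : q ≠ a) (hq : x * q ∈ cycleVerts x a b m) (hq' : x * q ∈ cycleVerts x a b' m') :
    L = L' ∧ b = b' := by
  have hsub : ({H, L'} : Set (Subgroup G)) ⊆ B := by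
    rintro M (rfl | rfl)
    · exact hH
    · exact hL'
  have hLL : L = L' := by
    by_contra hne
    have hLmem : L ∉ ({H, L'} : Set (Subgroup G)) := by
      rintro (e | e)
      · exact hHL e.symm
      · exact hne e
    have hP := IsRankTwo.mem_sSup_of_mem_cycleVerts ha hb' hq'
    have haP : a ∈ sSup ({H, L'} : Set (Subgroup G)) := Subgroup.mem_sSup_of_mem (Or.inl rfl) ha
    have h1 := hf.apply_eq_one_of_mem_sSup hsub hL hLmem hP
    have h2 := hf.apply_eq_one_of_mem_sSup hsub hL hLmem (mul_mem (inv_mem haP) hP)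
    obtain ⟨i, hi, e⟩ := hq
    rw [mul_right_inj, mul_right_inj] at e
    have hms := hm.symm hf hH hL
    rcases i with _ | i
    · simp [altProd, hq1] at e
    rcases e with rfl | rfl
    · rcases i with _ | i
      · simp [altProd] at hqa
      · rw [altProd, inv_mul_cancel_left, hms.apply_altProd_of_pos hf hL hb ha hb1 ha1 (by omega)]
          at h2
        exact hb1 h2
    · rw [hms.apply_altProd_of_pos hf hL hb ha hb1 ha1 (by omega)] at h1
      exact hb1 h1
  subst hLL
  refine ⟨rfl, ?_⟩
  obtain rfl := hm.unique hm' hf hH hL (fun e => ha1 (by rwa [e, Subgroup.mem_bot] at ha))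
    (fun e => hb1 (by rwa [e, Subgroup.mem_bot] at hb))
  rcases hm.two_le.lt_or_eq with hlt | rfl
  · exact ((eq_one_or_eq_of_card_eq_two (hm.card hlt).2 hb' hb1' b hb).resolve_left hb1)
  · -- here the vertex is `x b` or `x a b`, on the side of `x b` of the wall `L`
    have key : ∀ {b}, b ∈ L → b ≠ 1 → x * q ∈ cycleVerts x a b 2 → f L q = b := by
      intro b hb hb1 hq
      have h2 := (hm.apply_altProd hf hH hL ha hb ha1 hb1).2
      obtain ⟨i, hi, e⟩ := hq
      rw [mul_right_inj, mul_right_inj] at e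
      interval_cases i
      · simp [altProd, hq1] at e
      · simp only [altProd, mul_one] at e
        rcases e with rfl | rfl
        · exact absurd rfl hqa
        · exact hf.apply_of_mem hL hb
      · rcases e with rfl | rfl
        · exact h2
        · rw [← hm.braid a ha b hb ha1 hb1]; exact h2
    rw [← key hb hb1 hq, key hb' hb1' hq']

theorem even_cycles (hf : IsRetractionSystem B f) (hgen : sSup B = ⊤) {u v : G}
    {c : (cayleyGraph B).Walk u u} {d : (cayleyGraph B).Walk v v}
    (hc : IsConvexEvenCycle (cayleyGraph B) c) (hd : IsConvexEvenCycle (cayleyGraph B) d)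
    (hne : c.toSubgraph ≠ d.toSubgraph) :
    (c.toSubgraph.edgeSet ∩ d.toSubgraph.edgeSet).Subsingleton := by
  rintro e ⟨hec, hed⟩ e' ⟨hec', hed'⟩
  by_contra hee
  apply hne
  refine toSubgraph_eq_of_edgeSet_eq hc.1 hd.1 ?_
  induction e using Sym2.ind with
  | _ z x =>
    obtain ⟨H, hH, L, hL, hHL, m, hm, a, ha, b, hb, ha1, hb1, hxa, hcE⟩ :=
      hf.edgeSet_eq_cycleEdges hgen hc hec
    obtain ⟨H', hH', L', hL', hHL', m', hm', a', ha', b', hb', ha1', hb1', hxa', hdE⟩ :=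
      hf.edgeSet_eq_cycleEdges hgen hd hed
    obtain rfl : a = a' := mul_left_cancel (hxa.symm.trans hxa')
    obtain rfl : H = H' := by
      by_contra h
      exact ha1 (hf.eq_one_of_mem_of_mem hH hH' (Ne.symm h) ha' ha)
    rw [hcE] at hec' ⊢
    rw [hdE] at hed' ⊢
    -- the second common edge provides a common vertex which is not on the first one
    obtain ⟨w, hw, hwz, hwx⟩ : ∃ w ∈ e', w ≠ z ∧ w ≠ x := by
      by_contra! h
      apply hee
      have hE' : e' ∈ c.toSubgraph.edgeSet := by rw [hcE]; exact hec'
      induction e' using Sym2.ind with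
      | _ p q =>
        have hpq : p ≠ q := (c.toSubgraph.adj_sub hE').ne
        have hp := h p (Sym2.mem_mk_left p q)
        have hq := h q (Sym2.mem_mk_right p q)
        by_cases hpz : p = z
        · subst hpz
          rw [hq hpq.symm]
        · obtain rfl := hp hpz
          by_cases hqz : q = z
          · rw [hqz, Sym2.eq_swap]
          · exact absurd (hq hqz).symm hpq
    have hwe : w = z * (z⁻¹ * w) := by group
    have hw1 : z⁻¹ * w ≠ 1 := fun e => hwz (inv_mul_eq_one.mp e).symm
    have hwa : z⁻¹ * w ≠ a := fun e => hwx (by rw [hxa, ← e, ← hwe])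
    obtain ⟨rfl, rfl⟩ := hf.eq_of_mem_cycleVerts hH hL hL' hHL hHL' hm hm' ha hb hb' ha1 hb1 hb1'
      hw1 hwa (by rw [← hwe]; exact mem_cycleVerts_of_mem_cycleEdges hec' hw)
      (by rw [← hwe]; exact mem_cycleVerts_of_mem_cycleEdges hed' hw)
    rw [hm.unique hm' hf hH hL (fun e => ha1 (by rwa [e, Subgroup.mem_bot] at ha))
      (fun e => hb1 (by rwa [e, Subgroup.mem_bot] at hb))]

theorem isMediangle (hf : IsRetractionSystem B f) (hgen : sSup B = ⊤) :
    IsMediangle (cayleyGraph B) where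
  connected := cayleyGraph_connected hgen
  triangle_condition o x y hd hxy := by
    have htop : ∀ g : G, g ∈ sSup B := fun g => hgen ▸ Subgroup.mem_top g
    obtain ⟨hne, H, hH, hh⟩ := cayleyGraph_adj.mp hxy
    have hh1 : x⁻¹ * y ≠ 1 := fun e => hne (inv_mul_eq_one.mp e)
    have hX := cayleyGraph_connected hgen
    rw [SimpleGraph.dist_comm, SimpleGraph.dist_comm (u := o), cayleyGraph_dist hgen,
    cayleyGraph_dist hgen] at hd
    have e1 : (x⁻¹ * y)⁻¹ * (x⁻¹ * o) = y⁻¹ * o := by group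
    have hk := hf.mem H hH (x⁻¹ * o)
    have hk1 : f H (x⁻¹ * o) ≠ 1 := by
      intro h1
      have := hf.wordLength_mul_of_apply_eq_one hH (htop _) (inv_mem hh) (inv_ne_one.mpr hh1) h1
      rw [e1] at this
      omega
    have hk2 : f H (x⁻¹ * o) ≠ x⁻¹ * y := by
      intro h1
      have := (hf.wordLength_lt_iff hH (htop _) hh hh1).mpr h1
      rw [e1] at this
      omega
    have hlen := hf.wordLength_inv_mul hH (htop _) hk1
    -- the third vertex `x k` is the point of the coset `x H` closest to `o`
    set k := f H (x⁻¹ * o)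
    have hxz : (cayleyGraph B).Adj x (x * k) := cayleyGraph_adj_mul hH x hk hk1
    have hyz : (cayleyGraph B).Adj y (x * k) := by
      refine cayleyGraph_adj.mpr ⟨fun e => hk2 (by rw [e, inv_mul_cancel_left]), H, hH, ?_⟩
      have := mul_mem (inv_mem hh) hk
      rwa [show (x⁻¹ * y)⁻¹ * k = y⁻¹ * (x * k) by group] at this
    have hlen' : (cayleyGraph B).dist o x = (cayleyGraph B).dist o (x * k) + 1 := by
      rw [SimpleGraph.dist_comm, SimpleGraph.dist_comm (u := o), cayleyGraph_dist hgen,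
        cayleyGraph_dist hgen, hlen]
      congr 2; group
    refine ⟨x * k, hxz, hyz, ?_, ?_⟩
    · change (cayleyGraph B).dist o x = _
      rw [dist_eq_one_iff_adj.mpr hxz.symm, hlen']
    · change (cayleyGraph B).dist o y = _
      rw [dist_eq_one_iff_adj.mpr hyz.symm, ← hlen', SimpleGraph.dist_comm,
        SimpleGraph.dist_comm (u := o), cayleyGraph_dist hgen, cayleyGraph_dist hgen, hd]
  no_K4_minus a b c d hab hac hbc had hbd hcd := by
    obtain ⟨hne, H, hH, hb⟩ := cayleyGraph_adj.mp hab
    have hc := hf.mem_of_triangle hH hb hne hac hbc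
    have hd := hf.mem_of_triangle hH hb hne had hbd
    exact cosetSet_isClique hH a hc hd hcd
  cycle_condition o x y z hxy hx hy hzx hzy := by
    obtain ⟨H, hH, L, hL, hne, m, hm, ha, hb, ha1, hb1, hd⟩ :=
      hf.exists_isRankTwo_of_dist hgen hxy hx hy hzx.symm hzy.symm
    obtain ⟨c, hc, hlen, hvert, hcs, hce⟩ := hm.exists_isCycle hf hgen hH hL ha hb ha1 hb1 z
    have h2 := hm.two_le
    have hhalf : c.length / 2 = m := by omega
    have hmid : (cayleyGraph B).dist (z * altProd (z⁻¹ * x) (z⁻¹ * y) m) x = m - 1 := by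
      obtain ⟨m, rfl⟩ : ∃ m', m = m' + 1 := ⟨m - 1, by omega⟩
      rw [SimpleGraph.dist_comm, cayleyGraph_dist hgen, altProd,
        show x⁻¹ * (z * (z⁻¹ * x * altProd (z⁻¹ * y) (z⁻¹ * x) m)) =
          altProd (z⁻¹ * y) (z⁻¹ * x) m by group]
      exact (hm.symm hf hH hL).wordLength_altProd hf hL hH hb ha hb1 ha1 (by omega)
    have hmid' : (cayleyGraph B).dist (z * altProd (z⁻¹ * x) (z⁻¹ * y) m) y = m - 1 := by
      rw [hm.braid _ ha _ hb ha1 hb1]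
      obtain ⟨m, rfl⟩ : ∃ m', m = m' + 1 := ⟨m - 1, by omega⟩
      rw [SimpleGraph.dist_comm, cayleyGraph_dist hgen, altProd,
        show y⁻¹ * (z * (z⁻¹ * y * altProd (z⁻¹ * x) (z⁻¹ * y) m)) =
          altProd (z⁻¹ * x) (z⁻¹ * y) m by group]
      exact hm.wordLength_altProd hf hH hL ha hb ha1 hb1 (by omega)
    refine ⟨c, hm.isConvexEvenCycle hf hgen hH hL ha hb ha1 hb1 hc hlen hcs hce, ?_, ?_, ?_, ?_⟩
    · exact (hce _).mpr ⟨0, by omega, Or.inl (by simp [altProd])⟩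
    · exact (hce _).mpr ⟨0, by omega, Or.inr (by simp [altProd])⟩
    · rw [hhalf, hvert]
      change (cayleyGraph B).dist o x = _
      rw [hmid, SimpleGraph.dist_comm (u := o) (v := _ * _)]
      omega
    · rw [hhalf, hvert]
      change (cayleyGraph B).dist o y = _
      rw [hmid', SimpleGraph.dist_comm (u := o) (v := _ * _)]
      omega
  even_cycles _ _ _ _ hc hd hne := hf.even_cycles hgen hc hd hne

end IsRetractionSystem

end CayleyMediangle

/-! ### Rotation systems yield retraction systems -/

section RotationRetraction

open SimpleGraph
open scoped Pointwise

theorem exists_isMaxClique_of_isClique {V : Type*} {X : SimpleGraph V} {s : Set V}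
    (hs : X.IsClique s) : ∃ C, s ⊆ C ∧ IsMaxClique X C :=
  zorn_subset_nonempty {t | X.IsClique t} (fun c hc hchain _ =>
    ⟨⋃₀ c, (isClique_sUnion hchain.directedOn).mpr hc, fun _ ht => Set.subset_sUnion_of_mem ht⟩)
    s hs

variable {G V : Type*} [Group G] [MulAction G V] {X : SimpleGraph V} {R : Set (Subgroup G)}

theorem ActsFreelyTransitivelyOn.conj {H : Subgroup G} {C : Set V}
    (h : ActsFreelyTransitivelyOn H C) (g : G) :
    ActsFreelyTransitivelyOn (conjSubgroup g H) (g • C) := by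
  constructor
  · intro k hk x hx
    rw [Set.mem_smul_set_iff_inv_smul_mem] at hx ⊢
    have := h.1 _ (mem_conjSubgroup.mp hk) _ hx
    simpa [mul_smul] using this
  · intro x hx y hy
    rw [Set.mem_smul_set_iff_inv_smul_mem] at hx hy
    obtain ⟨k, ⟨hk, hkx⟩, huniq⟩ := h.2 _ hx _ hy
    refine ⟨g * k * g⁻¹, ⟨?_, ?_⟩, ?_⟩
    · rw [mem_conjSubgroup]
      simpa [mul_assoc] using hk
    · rw [mul_smul, mul_smul, hkx, smul_inv_smul]
    · rintro l ⟨hl, rfl⟩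
      rw [← huniq (g⁻¹ * l * g) ⟨mem_conjSubgroup.mp hl, by simp [mul_smul]⟩]
      group

theorem exists_smul_eq_of_mem_barrier {H : Subgroup G} {x y : V} (h : s(x, y) ∈ barrier X H) :
    ∃ k ∈ H, k • x = y := by
  obtain ⟨C, -, hHC, a, ha, b, hb, -, he⟩ := h
  rw [Sym2.eq_iff] at he
  rcases he with ⟨rfl, rfl⟩ | ⟨rfl, rfl⟩
  · obtain ⟨k, hk, -⟩ := hHC.2 _ ha _ hb
    exact ⟨k, hk⟩
  · obtain ⟨k, hk, -⟩ := hHC.2 _ hb _ ha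
    exact ⟨k, hk⟩

namespace IsRotationSystem

theorem adj_smul_iff (hR : IsRotationSystem X R) (g : G) {x y : V} :
    X.Adj (g • x) (g • y) ↔ X.Adj x y :=
  ⟨fun h => by simpa using hR.adj_smul g⁻¹ _ _ h, hR.adj_smul g x y⟩

theorem isMaxClique_smul (hR : IsRotationSystem X R) {C : Set V} (hC : IsMaxClique X C) (g : G) :
    IsMaxClique X (g • C) := by
  have key : ∀ (k : G) {D : Set V}, X.IsClique D → X.IsClique (k • D) := by
    rintro k D hD _ ⟨x, hx, rfl⟩ _ ⟨y, hy, rfl⟩ hne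
    exact hR.adj_smul k x y (hD hx hy fun e => hne (by rw [e]))
  refine ⟨key g hC.prop, fun D hD hsub => ?_⟩
  rw [Set.subset_smul_set_iff]
  refine hC.le_of_ge (key g⁻¹ hD) ?_
  rw [← Set.smul_set_subset_iff_subset_inv_smul_set]
  exact hsub

theorem smul_mem_barrier (hR : IsRotationSystem X R) {H : Subgroup G} {k : G} (hk : k ∈ H)
    {x y : V} (h : s(x, y) ∈ barrier X H) : s(k • x, k • y) ∈ barrier X H := by
  obtain ⟨C, hC, hHC, a, ha, b, hb, hne, he⟩ := h
  refine ⟨k • C, hR.isMaxClique_smul hC k, ?_, k • a, Set.smul_mem_smul_set ha, k • b,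
    Set.smul_mem_smul_set hb, by simpa using hne, ?_⟩
  · simpa [conjSubgroup_of_mem hk] using hHC.conj k
  · exact congrArg (Sym2.map (k • ·)) he

theorem reachable_smul (hR : IsRotationSystem X R) {H : Subgroup G} {k : G} (hk : k ∈ H) {x y : V}
    (h : (X.deleteEdges (barrier X H)).Reachable x y) :
    (X.deleteEdges (barrier X H)).Reachable (k • x) (k • y) := by
  refine h.map (⟨(k • ·), fun {a b} hab => ?_⟩ :
    X.deleteEdges (barrier X H) →g X.deleteEdges (barrier X H))
  rw [deleteEdges_adj] at hab ⊢
  exact ⟨hR.adj_smul k a b hab.1, fun hb => hab.2 (by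
    simpa using hR.smul_mem_barrier (inv_mem hk) hb)⟩

/-- Two cliques with a common edge coincide: a triangle on that edge has to cross the barrier of the
first clique a second time, and the rotations of the first clique carry one end of the second
crossing to the other. -/
theorem eq_of_mem_of_mem (hR : IsRotationSystem X R) {C D : Set V} (hC : IsMaxClique X C)
    (hD : IsMaxClique X D) {x y : V} (hne : x ≠ y) (hx : x ∈ C) (hy : y ∈ C) (hx' : x ∈ D)
    (hy' : y ∈ D) : C = D := by
  obtain ⟨H, ⟨hH, hHC⟩, -⟩ := hR.existsUnique_rotStab C hC
  refine (hD.eq_of_subset hC.prop fun c hc => ?_).symm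
  by_cases hcx : c = x
  · rwa [hcx]
  by_cases hcy : c = y
  · rwa [hcy]
  have key : ∀ {a}, a ∈ C → s(a, c) ∈ barrier X H → c ∈ C := by
    intro a ha h
    obtain ⟨k, hk, rfl⟩ := exists_smul_eq_of_mem_barrier h
    exact hHC.1 k hk a ha
  by_contra hcC
  have hadj : ∀ {a}, a ∈ C → a ∈ D → a ≠ c → (X.deleteEdges (barrier X H)).Adj a c :=
    fun ha ha' hac => deleteEdges_adj.mpr ⟨hD.prop ha' hc hac, fun h => hcC (key ha h)⟩
  exact hR.separates C hC H hH hHC x hx y hy hne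
    ((hadj hx hx' (Ne.symm hcx)).reachable.trans (hadj hy hy' (Ne.symm hcy)).symm.reachable)

theorem exists_rotStab_of_adj (hR : IsRotationSystem X R) {x y : V} (h : X.Adj x y) :
    ∃ C, IsMaxClique X C ∧ x ∈ C ∧ y ∈ C ∧ ∃ H ∈ R, ActsFreelyTransitivelyOn H C := by
  obtain ⟨C, hsub, hC⟩ := exists_isMaxClique_of_isClique (isClique_pair.mpr fun _ => h)
  obtain ⟨H, ⟨hH, hHC⟩, -⟩ := hR.existsUnique_rotStab C hC
  exact ⟨C, hC, hsub (Set.mem_insert _ _), hsub (Set.mem_insert_of_mem _ rfl), H, hH, hHC⟩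

theorem conj_inv_mem_rotStabsAt (hR : IsRotationSystem X R) {o : V} {g : G} {H : Subgroup G}
    (hH : H ∈ R) {C : Set V} (hC : IsMaxClique X C) (hg : g • o ∈ C)
    (hHC : ActsFreelyTransitivelyOn H C) : conjSubgroup g⁻¹ H ∈ rotStabsAt X R o :=
  ⟨hR.conj_mem H hH g⁻¹, g⁻¹ • C, hR.isMaxClique_smul hC g⁻¹,
    by simpa [Set.mem_smul_set_iff_inv_smul_mem] using hg, hHC.conj g⁻¹⟩

theorem exists_mem_sSup_smul_eq (hR : IsRotationSystem X R) (o v : V) :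
    ∃ g ∈ sSup (rotStabsAt X R o), g • o = v := by
  have h := hR.connected o v
  rw [reachable_iff_reflTransGen] at h
  induction h with
  | refl => exact ⟨1, one_mem _, one_smul G o⟩
  | @tail u v _ huv ih =>
    obtain ⟨g, hg, rfl⟩ := ih
    obtain ⟨C, hC, hu, hv, H, hH, hHC⟩ := hR.exists_rotStab_of_adj huv
    obtain ⟨k, ⟨hk, hkv⟩, -⟩ := hHC.2 _ hu _ hv
    have hmem : g⁻¹ * k * g ∈ sSup (rotStabsAt X R o) :=
      le_sSup (hR.conj_inv_mem_rotStabsAt hH hC hu hHC) (mem_conjSubgroup.mpr (by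
        simpa [mul_assoc] using hk))
    refine ⟨g * (g⁻¹ * k * g), mul_mem hg hmem, ?_⟩
    rw [← hkv, ← mul_smul]
    congr 1
    group

theorem sSup_rotStabsAt (hR : IsRotationSystem X R) (o : V) : sSup (rotStabsAt X R o) = ⊤ := by
  rw [eq_top_iff, ← hR.generates]
  refine sSup_le fun K hK => ?_
  obtain ⟨C, hC, hKC⟩ := hR.isRotStab K hK
  have hne : C.Nonempty := by
    by_contra he
    rw [Set.not_nonempty_iff_eq_empty] at he
    have := hC.eq_of_subset (isClique_singleton (G := X) o) (by simp [he])
    rw [he] at this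
    exact Set.singleton_ne_empty o this.symm
  obtain ⟨v, hv⟩ := hne
  obtain ⟨g, hg, rfl⟩ := hR.exists_mem_sSup_smul_eq o v
  intro k hk
  have hmem : g⁻¹ * k * g ∈ sSup (rotStabsAt X R o) :=
    le_sSup (hR.conj_inv_mem_rotStabsAt hK hC hv hKC) (mem_conjSubgroup.mpr (by
      simpa [mul_assoc] using hk))
  have := mul_mem (mul_mem hg hmem) (inv_mem hg)
  simpa [mul_assoc] using this

theorem ne_bot_of_mem_rotStabsAt [Nontrivial V] (hR : IsRotationSystem X R) {o : V}
    {H : Subgroup G} (hH : H ∈ rotStabsAt X R o) : H ≠ ⊥ := by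
  rintro rfl
  obtain ⟨-, C, hC, ho, hHC⟩ := hH
  obtain ⟨w, hw⟩ := hR.connected.preconnected.exists_adj_of_nontrivial o
  have hsub : C ⊆ {o} := by
    intro y hy
    obtain ⟨k, ⟨hk, hky⟩, -⟩ := hHC.2 _ ho _ hy
    rw [Subgroup.mem_bot] at hk
    rw [← hky, hk, one_smul, Set.mem_singleton_iff]
  have hpair : X.IsClique {o, w} := isClique_pair.mpr fun _ => hw
  have := hC.eq_of_subset hpair (hsub.trans (by simp))
  have hwC : w ∈ C := by rw [this]; simp
  exact hw.ne (hsub hwC).symm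

/-- The component of `v` in the complement of the barrier of `H` is the rotation by an element of
`H` of the component of `o`. -/
theorem exists_mem_reachable (hR : IsRotationSystem X R) (H : Subgroup G) (o v : V) :
    ∃ h ∈ H, (X.deleteEdges (barrier X H)).Reachable (h • o) v := by
  have h := hR.connected o v
  rw [reachable_iff_reflTransGen] at h
  induction h with
  | refl => exact ⟨1, one_mem _, by rw [one_smul]⟩
  | @tail u v _ huv ih =>
    obtain ⟨h, hh, hr⟩ := ih
    by_cases hb : s(u, v) ∈ barrier X H
    · obtain ⟨k, hk, rfl⟩ := exists_smul_eq_of_mem_barrier hb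
      exact ⟨k * h, mul_mem hk hh, by rw [mul_smul]; exact hR.reachable_smul hk hr⟩
    · exact ⟨h, hh, hr.trans (Adj.reachable (deleteEdges_adj.mpr ⟨huv, hb⟩))⟩

theorem eq_of_reachable_smul (hR : IsRotationSystem X R) {o : V} {H : Subgroup G}
    (hH : H ∈ rotStabsAt X R o) {h k : G} (hh : h ∈ H) (hk : k ∈ H)
    (hr : (X.deleteEdges (barrier X H)).Reachable (h • o) (k • o)) : h = k := by
  obtain ⟨hH, C, hC, ho, hHC⟩ := hH
  have e : h • o = k • o := by
    by_contra hne
    exact hR.separates C hC H hH hHC _ (hHC.1 h hh o ho) _ (hHC.1 k hk o ho) hne hr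
  exact (hHC.2 o ho _ (hHC.1 k hk o ho)).unique ⟨hh, e⟩ ⟨hk, rfl⟩

/-- The retraction `f H` labels the components of the complement of the barrier of `H`: the
component of `g • o` is the translate by `f H g` of the component of `o`. In particular `f H g` only
depends on `g • o`. -/
theorem exists_isRetractionSystem (hR : IsRotationSystem X R) (o : V) :
    ∃ f, IsRetractionSystem (rotStabsAt X R o) f ∧
      ∀ H ∈ rotStabsAt X R o, ∀ g : G, g • o = o → f H g = 1 := by
  choose f hmem hf using fun (H : Subgroup G) (g : G) => hR.exists_mem_reachable H o (g • o)
  have hfix : ∀ H ∈ rotStabsAt X R o, ∀ g : G, g • o = o → f H g = 1 := by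
    intro H hH g hg
    refine hR.eq_of_reachable_smul hH (hmem H g) (one_mem H) ?_
    simpa [hg] using hf H g
  refine ⟨f, ⟨fun H _ g => hmem H g, fun H hH => hfix H hH 1 (one_smul G o), ?_, ?_⟩, hfix⟩
  · intro H hH h hh x
    refine hR.eq_of_reachable_smul hH (hmem H _) (mul_mem hh (hmem H x)) ((hf H (h * x)).trans ?_)
    rw [mul_smul, mul_smul]
    exact (hR.reachable_smul hh (hf H x)).symm
  · intro H hH L hL x l hl hne
    refine hR.eq_of_reachable_smul hH (hmem H _) (hmem H x)
      ((hf H (x * l)).trans (Reachable.trans ?_ (hf H x).symm))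
    obtain ⟨hLR, D, hD, ho, hLD⟩ := hL
    by_cases hlo : l • o = o
    · rw [mul_smul, hlo]
    have hlD := hLD.1 l hl o ho
    refine Adj.reachable (deleteEdges_adj.mpr ⟨?_, fun hb => hne ?_⟩)
    · rw [mul_smul, hR.adj_smul_iff]
      exact hD.prop hlD ho hlo
    · obtain ⟨C, hC, hHC, a, ha, b, hb, hab, he⟩ := hb
      have hx : x • o ∈ x • D := Set.smul_mem_smul_set ho
      have hxl : (x * l) • o ∈ x • D := by
        rw [mul_smul]; exact Set.smul_mem_smul_set hlD
      have hCD : C = x • D := by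
        rw [Sym2.eq_iff] at he
        rcases he with ⟨rfl, rfl⟩ | ⟨rfl, rfl⟩
        · exact hR.eq_of_mem_of_mem hC (hR.isMaxClique_smul hD x) hab ha hb hxl hx
        · exact hR.eq_of_mem_of_mem hC (hR.isMaxClique_smul hD x) hab ha hb hx hxl
      exact (hR.existsUnique_rotStab C hC).unique
        ⟨hR.conj_mem L hLR x, hCD ▸ hLD.conj x⟩ ⟨hH.1, hHC⟩

theorem eq_one_of_smul_eq (hR : IsRotationSystem X R) {o : V} {g : G} (hg : g • o = o) : g = 1 := by
  obtain ⟨f, hf, hfix⟩ := hR.exists_isRetractionSystem o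
  by_contra h1
  obtain ⟨H, hH, hne⟩ := hf.exists_apply_ne_one (hR.sSup_rotStabsAt o ▸ Subgroup.mem_top g) h1
  exact hne (hfix H hH g hg)

theorem smul_injective (hR : IsRotationSystem X R) (o : V) :
    Function.Injective fun g : G => g • o := by
  intro g h e
  have : (g⁻¹ * h) • o = o := by
    rw [mul_smul, ← show g • o = h • o from e, inv_smul_smul]
  exact inv_mul_eq_one.mp (hR.eq_one_of_smul_eq this)

theorem cayleyGraph_adj_iff (hR : IsRotationSystem X R) {o : V} {g h : G} :
    X.Adj (g • o) (h • o) ↔ (cayleyGraph (rotStabsAt X R o)).Adj g h := by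
  have e : X.Adj (g • o) (h • o) ↔ X.Adj o ((g⁻¹ * h) • o) := by
    rw [← hR.adj_smul_iff g (x := o), mul_smul, smul_inv_smul]
  rw [e, cayleyGraph_adj]
  constructor
  · intro hadj
    refine ⟨fun he => hadj.ne (by rw [he, inv_mul_cancel, one_smul]), ?_⟩
    obtain ⟨C, hC, ho, hv, H, hH, hHC⟩ := hR.exists_rotStab_of_adj hadj
    obtain ⟨k, ⟨hk, hkv⟩, -⟩ := hHC.2 _ ho _ hv
    exact ⟨H, ⟨hH, C, hC, ho, hHC⟩, hR.smul_injective o hkv ▸ hk⟩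
  · rintro ⟨hne, H, ⟨-, C, hC, ho, hHC⟩, hk⟩
    refine hC.prop ho (hHC.1 _ hk o ho) fun he => hne ?_
    exact inv_mul_eq_one.mp (hR.eq_one_of_smul_eq he.symm)

theorem exists_iso (hR : IsRotationSystem X R) (o : V) :
    ∃ φ : cayleyGraph (rotStabsAt X R o) ≃g X, ∀ g : G, φ g = g • o :=
  ⟨⟨Equiv.ofBijective (fun g : G => g • o) ⟨hR.smul_injective o, fun v =>
      let ⟨g, _, hg⟩ := hR.exists_mem_sSup_smul_eq o v; ⟨g, hg⟩⟩, hR.cayleyGraph_adj_iff⟩,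
    fun _ => rfl⟩

end IsRotationSystem

end RotationRetraction

/-! ### Invariance of mediangle graphs under isomorphisms -/

section MediangleIso

open SimpleGraph

variable {V W : Type*} {X : SimpleGraph V} {Y : SimpleGraph W}

theorem SimpleGraph.Iso.dist_le_of_reachable (φ : X ≃g Y) {x y : V} (h : X.Reachable x y) :
    Y.dist (φ x) (φ y) ≤ X.dist x y := by
  obtain ⟨p, hp⟩ := h.exists_walk_length_eq_dist
  rw [← hp, ← Walk.length_map φ.toHom]
  exact SimpleGraph.dist_le _

theorem SimpleGraph.Iso.dist_eq (φ : X ≃g Y) (hX : X.Connected) (x y : V) :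
    Y.dist (φ x) (φ y) = X.dist x y := by
  refine le_antisymm (φ.dist_le_of_reachable (hX x y)) ?_
  have := φ.symm.dist_le_of_reachable (φ.connected_iff.mp hX (φ x) (φ y))
  simpa using this

theorem SimpleGraph.Subgraph.map_symm_map (φ : X ≃g Y) (H : Y.Subgraph) :
    (H.map φ.symm.toHom).map φ.toHom = H := by
  rw [← Subgraph.map_comp, show φ.toHom.comp φ.symm.toHom = Hom.id from
    RelHom.ext fun y => φ.apply_symm_apply y, Subgraph.map_id]

theorem IsConvexSubgraph.map (φ : X ≃g Y) (hX : X.Connected) {H : X.Subgraph}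
    (h : IsConvexSubgraph X H) : IsConvexSubgraph Y (H.map φ.toHom) := by
  rintro _ ⟨x, hx, rfl⟩ _ ⟨y, hy, rfl⟩ p hp
  have hmem : ∀ {v}, v ∈ H.verts → φ.symm (φ v) ∈ H.verts := fun hv => by
    rwa [φ.symm_apply_apply]
  have key := h _ (hmem hx) _ (hmem hy) (p.map φ.symm.toHom) (by
    rw [Walk.length_map, hp]
    exact (φ.symm.dist_eq (φ.connected_iff.mp hX) _ _).symm)
  rw [Walk.toSubgraph_map] at key
  have := Subgraph.map_mono (f := φ.toHom) key
  rwa [Subgraph.map_symm_map] at this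

theorem IsConvexEvenCycle.map (φ : X ≃g Y) (hX : X.Connected) {z : V} {c : X.Walk z z}
    (h : IsConvexEvenCycle X c) : IsConvexEvenCycle Y (c.map φ.toHom) := by
  refine ⟨(Walk.isCycle_map_iff_of_injective φ.injective).mpr h.1, ?_, ?_⟩
  · rw [Walk.length_map]; exact h.2.1
  · rw [Walk.toSubgraph_map]; exact h.2.2.map φ hX

theorem IsMediangle.of_iso (φ : X ≃g Y) (h : IsMediangle X) : IsMediangle Y := by
  have hX := h.connected
  have hY := φ.connected_iff.mp hX
  have hint : ∀ {o x z : V}, z ∈ GInterval X o x → φ z ∈ GInterval Y (φ o) (φ x) := by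
    intro o x z hz
    change Y.dist _ _ = Y.dist _ _ + Y.dist _ _
    rw [φ.dist_eq hX, φ.dist_eq hX, φ.dist_eq hX]
    exact hz
  refine ⟨hY, fun o x y hd hxy => ?_, fun a b c d => ?_, fun o x y z hne hx hy hxz hyz => ?_,
    fun u v c d hc hd hne => ?_⟩
  · obtain ⟨o, rfl⟩ := φ.surjective o
    obtain ⟨x, rfl⟩ := φ.surjective x
    obtain ⟨y, rfl⟩ := φ.surjective y
    rw [φ.dist_eq hX, φ.dist_eq hX] at hd
    obtain ⟨z, h1, h2, h3, h4⟩ := h.triangle_condition o x y hd (φ.map_adj_iff.mp hxy)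
    exact ⟨φ z, φ.map_adj_iff.mpr h1, φ.map_adj_iff.mpr h2, hint h3, hint h4⟩
  · obtain ⟨a, rfl⟩ := φ.surjective a
    obtain ⟨b, rfl⟩ := φ.surjective b
    obtain ⟨c, rfl⟩ := φ.surjective c
    obtain ⟨d, rfl⟩ := φ.surjective d
    simpa only [φ.map_adj_iff, φ.injective.ne_iff] using h.no_K4_minus a b c d
  · obtain ⟨o, rfl⟩ := φ.surjective o
    obtain ⟨x, rfl⟩ := φ.surjective x
    obtain ⟨y, rfl⟩ := φ.surjective y
    obtain ⟨z, rfl⟩ := φ.surjective z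
    rw [φ.dist_eq hX, φ.dist_eq hX] at hx hy
    obtain ⟨c, hc, h1, h2, h3, h4⟩ := h.cycle_condition o x y z (φ.injective.ne_iff.mp hne) hx hy
      (φ.map_adj_iff.mp hxz) (φ.map_adj_iff.mp hyz)
    refine ⟨c.map φ.toHom, hc.map φ hX, ?_, ?_, ?_, ?_⟩
    · rw [Walk.edges_map]; exact List.mem_map_of_mem (f := Sym2.map φ.toHom) h1
    · rw [Walk.edges_map]; exact List.mem_map_of_mem (f := Sym2.map φ.toHom) h2
    · rw [Walk.length_map, Walk.getVert_map]; exact hint h3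
    · rw [Walk.length_map, Walk.getVert_map]; exact hint h4
  · have key := h.even_cycles _ _ _ _ (hc.map φ.symm hY) (hd.map φ.symm hY) (by
      rw [Walk.toSubgraph_map, Walk.toSubgraph_map]
      intro e
      have := congrArg (Subgraph.map φ.toHom) e
      rw [Subgraph.map_symm_map, Subgraph.map_symm_map] at this
      exact hne this)
    rw [Walk.toSubgraph_map, Walk.toSubgraph_map, Subgraph.edgeSet_map, Subgraph.edgeSet_map] at key
    intro e he e' he'
    exact Sym2.map.injective φ.symm.injective
      (key ⟨Set.mem_image_of_mem _ he.1, Set.mem_image_of_mem _ he.2⟩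
        ⟨Set.mem_image_of_mem _ he'.1, Set.mem_image_of_mem _ he'.2⟩)

end MediangleIso

/-! ### Rotation systems and periagroups -/

theorem theorem1p1 {G : Type*} [Group G] :
    (∀ {V : Type*} [MulAction G V] [Nontrivial V] (X : SimpleGraph V) (R : Set (Subgroup G)),
      IsRotationSystem X R → ∀ o : V,
        IsPeriagroupBasis (rotStabsAt X R o) ∧ IsMediangle X ∧
        ∃ φ : cayleyGraph (rotStabsAt X R o) ≃g X, ∀ g : G, φ g = g • o) ∧
    (∀ B : Set (Subgroup G), Nontrivial G → IsPeriagroupBasis B →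
      IsMediangle (cayleyGraph B) ∧
      -- here `G` acts on itself, the vertex set of its Cayley graph, by left multiplication
      IsRotationSystem (V := G) (cayleyGraph B) (conjugateSubgroups B)) := by
  constructor
  · intro V _ _ X R hR o
    obtain ⟨f, hf, -⟩ := hR.exists_isRetractionSystem o
    have hgen := hR.sSup_rotStabsAt o
    obtain ⟨φ, hφ⟩ := hR.exists_iso o
    exact ⟨hf.isPeriagroupBasis (fun H hH => hR.ne_bot_of_mem_rotStabsAt hH) hgen,
      (hf.isMediangle hgen).of_iso φ, φ, hφ⟩
  · intro B _ hB
    obtain ⟨f, hf⟩ := hB.exists_isRetractionSystem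
    have hgen := hB.sSup_eq_top
    have hne : B.Nonempty := by
      by_contra he
      rw [Set.not_nonempty_iff_eq_empty] at he
      rw [he, sSup_empty] at hgen
      exact bot_ne_top hgen
    exact ⟨hf.isMediangle hgen, hf.isRotationSystem hB.1 hgen hne⟩
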